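/- For positive integers $k,q$ and real $h\geq 1$ let \[M_k(q,h)=\sum_{1\leq n\leq q}\Bigl(\#\{m\in\mathbb{Z} : n\leq m<n+h,\ \gcd(m,q)=1\}-\frac{\phi(q)}{q}h\Bigr)^k,\] where $\phi$ is Euler's totient function. (When $h$ is an integer, $\frac1q M_k(q,h)$ is the $k$th central moment of the number of integers coprime to $q$ in a uniformly random interval of length $h$.) Theorem. For every odd integer $k\geq 3$ there exist constants $C_k>0$ and $A_k\geq 0$, depending only on $k$, such that for all integers $q\geq 1$ and all real $h\geq 1$ \[\lvert M_k(q,h)\rvert\leq C_k(1+\log h)^{A_k}\left(\frac{\phi(q)}{q}h+\left(\frac{\phi(q)}{q}h\right)^{\frac{k-1}{2}}\right)q.\] -/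

import Mathlib

/-- The finite set of integers `m` with `n ≤ m < n + h` and `gcd(m, q) = 1`, for a real length `h`.
For natural `m`, the condition `m < n + h` is the same as `m < n + ⌈h⌉₊`
(see `mem_coprimeWindow`). -/
noncomputable def coprimeWindow (q : ℕ) (h : ℝ) (n : ℕ) : Finset ℕ :=
  (Finset.Ico n (n + ⌈h⌉₊)).filter (fun m => Nat.Coprime m q)

theorem mem_coprimeWindow (q : ℕ) (h : ℝ) (n m : ℕ) :
    m ∈ coprimeWindow q h n ↔ (n ≤ m ∧ (m : ℝ) < n + h) ∧ Nat.gcd m q = 1 := by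
  unfold coprimeWindow
  rw [Finset.mem_filter, Finset.mem_Ico]
  refine and_congr (and_congr_right fun hnm => ?_) Iff.rfl
  obtain ⟨d, rfl⟩ := Nat.exists_eq_add_of_le hnm
  rw [Nat.add_lt_add_iff_left, Nat.lt_ceil]
  push_cast
  exact (add_lt_add_iff_left _).symm

/-- The density `φ(q)/q` of the integers coprime to `q`. -/
noncomputable def coprimeDensity (q : ℕ) : ℝ := (Nat.totient q : ℝ) / (q : ℝ)

/-- `M_k(q,h) = ∑_{1 ≤ n ≤ q} (#{n ≤ m < n + h : gcd(m,q) = 1} - (φ(q)/q) h)^k`. -/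
noncomputable def reducedResidueMoment (k q : ℕ) (h : ℝ) : ℝ :=
  ∑ n ∈ Finset.Icc 1 q, (((coprimeWindow q h n).card : ℝ) - coprimeDensity q * h) ^ k

/-!
The modulus `q` may be replaced by its radical, and is then split as `q = a * b`, where the prime
factors of `a` are at most a threshold of about `h ^ k` and those of `b` are larger.

*Small primes.* The deviation of the number of `j < H` with `n + j` coprime to `a` from its mean
has a Fourier expansion over the fractions `v` with denominator dividing `a`, with coefficients of
modulus at most `min (2 ^ K) (1 / ‖v‖) / v.den`, where `H ≤ 2 ^ K`. The `m`-th moment is thus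
bounded by a sum over `m`-tuples of such fractions with integral sum
(`abs_sum_coprimeDeviation_pow_le`). The denominators of a tuple are factored into parts indexed by
subsets `J` of the index set, where the part of `J` collects the primes that divide exactly the
denominators with index in `J`; the part of a singleton is trivial. The sum over tuples is carried
out coordinate by coordinate. When the earlier coordinates are fixed, the possible values of a
coordinate are well spaced, and the sum over them loses a factor depending on which parts have
appeared before, so on the order of the coordinates. A combinatorial lemma on weighted hypergraphs
(`exists_order_on`) provides an order for which the total loss is `2 ^ (K * (m / 2))`; this is the
square-root bound `sum_integralTuples_le`, up to powers of `K` and of `∑ 1 / d` over the divisors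
`d` of `a`. As the primes are at most a power of `h`, Chebyshev's bound shows that this last sum
and the inverse of the density of `a` are powers of `log h`.

*Large primes.* Given the set of the `N` elements of the window coprime to `a`, its elements are
coprime to `b` with nearly the same factorial moments as for independent events of probability `P =
φ(b) / b` (`abs_prod_sub_density_pow_le`). So the conditional central moments are close to those of
a binomial distribution, which are combinations of `N.choose s` with `2 s ≤ r` and coefficients
`O(P ^ s)` (`binomExp_central`, `abs_centralCoeff_le`). Expanding the `k`-th moment about the
conditional mean `P * N` leaves mixed moments of `N`, controlled by the small primes
(`abs_sum_pow_mul_choose_le`). All terms are powers `(P h) ^ e` with `1 ≤ e ≤ (k - 1) / 2`, the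
upper bound because `k` is odd (`pow_mul_pow_le_of_odd`).
-/

open Finset

/-! ### Ordering the vertices of a weighted hypergraph -/

/-- A cut at `l` separates the positions `1, …, m - 1` into those `≤ l` and those `> l`. In one
direction the positions `≤ l` count as later, so the items `R J` beyond the cut are uncovered, up
to a deduction `n l` that dominates the weight `p r` of every later singleton; in the other
direction the two sides exchange their roles. An item with two positions is met by at least one cut
and then uncovered in neither direction. A singleton is uncovered in one direction at every cut;
this excess is made up by the deductions, which are estimated at the position `a` of the heaviest
singleton: `hcond` provides as much weight away from `a`. -/
theorem sum_rotation_cost_le {β : Type*} (m : ℕ) (s : Finset β) (R : β → Finset ℕ) (c : β → ℝ)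
    (hc : ∀ J ∈ s, 0 ≤ c J) (hne : ∀ J ∈ s, (R J).Nonempty) (hR : ∀ J ∈ s, R J ⊆ Ico 1 m)
    (p : ℕ → ℝ) (hp : ∀ r ∈ Ico 1 m, ∃ J ∈ s, R J = {r} ∧ c J = p r)
    (hsum : ∑ J ∈ s with (R J).card = 1, c J ≤ ∑ r ∈ Ico 1 m, p r)
    (n n' : ℕ → ℝ) (hn0 : ∀ l, 0 ≤ n l) (hn0' : ∀ l, 0 ≤ n' l)
    (hn : ∀ l < m, ∀ r, 1 ≤ r → r ≤ l → p r ≤ n l)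
    (hn' : ∀ l < m, ∀ r, l < r → r < m → p r ≤ n' l)
    (hcond : ∀ a ∈ Ico 1 m, p a ≤ ∑ J ∈ s with a ∉ R J, c J) :
    ∑ l ∈ range m, (max 0 ((∑ J ∈ s with ∀ r ∈ R J, l < r, c J) - n l) +
        max 0 ((∑ J ∈ s with ∀ r ∈ R J, r ≤ l, c J) - n' l)) ≤
      ((m : ℝ) - 1) * ∑ J ∈ s, c J := by
  classical
  set U : ℕ → ℝ := fun l => ∑ J ∈ s with ∀ r ∈ R J, l < r, c J with hU
  set U' : ℕ → ℝ := fun l => ∑ J ∈ s with ∀ r ∈ R J, r ≤ l, c J with hU'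
  have hU0 : ∀ l, 0 ≤ U l := fun l => sum_nonneg fun J hJ => hc J (mem_of_mem_filter J hJ)
  have hU0' : ∀ l, 0 ≤ U' l := fun l => sum_nonneg fun J hJ => hc J (mem_of_mem_filter J hJ)
  have hUp : ∀ l r, 1 ≤ r → r < m → l < r → p r ≤ U l := by
    intro l r h1 h2 h3
    obtain ⟨J, hJ, hJR, hJc⟩ := hp r (mem_Ico.2 ⟨h1, h2⟩)
    rw [← hJc]
    refine single_le_sum (f := c) (fun J hJ => hc J (mem_of_mem_filter J hJ)) ?_
    simp [hJ, hJR, h3]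
  have hUp' : ∀ l r, 1 ≤ r → r < m → r ≤ l → p r ≤ U' l := by
    intro l r h1 h2 h3
    obtain ⟨J, hJ, hJR, hJc⟩ := hp r (mem_Ico.2 ⟨h1, h2⟩)
    rw [← hJc]
    refine single_le_sum (f := c) (fun J hJ => hc J (mem_of_mem_filter J hJ)) ?_
    simp [hJ, hJR, h3]
  have hmax : ∀ a b : ℝ, max 0 (a - b) = a - min a b := by
    intro a b
    rcases le_total a b with h | h
    · rw [min_eq_left h, max_eq_left (by linarith)]; ring
    · rw [min_eq_right h, max_eq_right (by linarith)]
  have hp0 : ∀ r ∈ Ico 1 m, 0 ≤ p r := by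
    intro r hr
    obtain ⟨J, hJ, -, hJc⟩ := hp r hr
    rw [← hJc]; exact hc J hJ
  -- the mass counted by all cuts, in terms of the cuts that separate no two positions of an item
  have hcount : ∀ (S : β → ℝ), (∀ J ∈ s, ((range m).filter (fun l => ∀ r ∈ R J, l < r)).card +
      ((range m).filter (fun l => ∀ r ∈ R J, r ≤ l)).card ≤ S J) →
      ∑ l ∈ range m, (U l + U' l) ≤ ∑ J ∈ s, S J * c J := by
    intro S hS
    rw [sum_add_distrib]
    simp only [hU, hU', sum_filter]
    rw [sum_comm, sum_comm (s := range m), ← sum_add_distrib]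
    refine sum_le_sum fun J hJ => ?_
    rw [← sum_filter, ← sum_filter, sum_const, sum_const, nsmul_eq_mul, nsmul_eq_mul, ← add_mul]
    exact mul_le_mul_of_nonneg_right (hS J hJ) (hc J hJ)
  have hcut : ∀ (J : β) (E : Finset ℕ), J ∈ s → E ⊆ range m →
      (∀ l ∈ E, (∃ r ∈ R J, r ≤ l) ∧ ∃ r ∈ R J, l < r) →
      ((range m).filter (fun l => ∀ r ∈ R J, l < r)).card +
        ((range m).filter (fun l => ∀ r ∈ R J, r ≤ l)).card + E.card ≤ m := by
    intro J E hJ hE hE2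
    obtain ⟨r0, hr0⟩ := hne J hJ
    have hd1 : Disjoint ((range m).filter (fun l => ∀ r ∈ R J, l < r))
        ((range m).filter (fun l => ∀ r ∈ R J, r ≤ l)) := by
      rw [disjoint_left]
      intro l h1 h2
      have := (mem_filter.1 h1).2 r0 hr0
      have := (mem_filter.1 h2).2 r0 hr0
      omega
    have hd2 : Disjoint ((range m).filter (fun l => ∀ r ∈ R J, l < r) ∪
        (range m).filter (fun l => ∀ r ∈ R J, r ≤ l)) E := by
      rw [disjoint_right]
      intro l hl h1
      obtain ⟨⟨r, hr, hrl⟩, r', hr', hrl'⟩ := hE2 l hl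
      rcases mem_union.1 h1 with h | h
      · have := (mem_filter.1 h).2 r hr
        omega
      · have := (mem_filter.1 h).2 r' hr'
        omega
    rw [← card_union_of_disjoint hd1, ← card_union_of_disjoint hd2]
    calc _ ≤ (range m).card := card_le_card
          (union_subset (union_subset (filter_subset _ _) (filter_subset _ _)) hE)
      _ = m := card_range m
  rcases (Ico 1 m).eq_empty_or_nonempty with hem | hnon
  · have hs : s = ∅ := by
      rw [eq_empty_iff_forall_notMem]
      intro J hJ
      obtain ⟨r, hr⟩ := hne J hJ
      have := hR J hJ hr
      rw [hem] at this
      simp at this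
    subst hs
    simp [hn0, hn0']
  -- the position `a` of the heaviest singleton
  obtain ⟨a, ha, hamax⟩ := exists_max_image (Ico 1 m) p hnon
  obtain ⟨ha1, ham⟩ := mem_Ico.1 ha
  set st : ℝ := ∑ J ∈ s with (∃ r ∈ R J, r < a) ∧ (∃ r ∈ R J, a < r) ∧ a ∉ R J, c J with hst
  have hst0 : 0 ≤ st := sum_nonneg fun J hJ => hc J (mem_of_mem_filter J hJ)
  have htotal : ∑ l ∈ range m, (U l + U' l) ≤
      ((m : ℝ) - 1) * (∑ J ∈ s, c J) + (∑ r ∈ Ico 1 m, p r) - st := by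
    have h := hcount (fun J => (m : ℝ) - 1 + (if (R J).card = 1 then 1 else 0) -
      (if (∃ r ∈ R J, r < a) ∧ (∃ r ∈ R J, a < r) ∧ a ∉ R J then 1 else 0)) ?_
    · refine h.trans ?_
      have : ∑ J ∈ s, ((m : ℝ) - 1 + (if (R J).card = 1 then 1 else 0) -
          (if (∃ r ∈ R J, r < a) ∧ (∃ r ∈ R J, a < r) ∧ a ∉ R J then 1 else 0)) * c J =
          ((m : ℝ) - 1) * (∑ J ∈ s, c J) + (∑ J ∈ s with (R J).card = 1, c J) - st := by
        rw [hst, mul_sum, sum_filter, sum_filter, ← sum_add_distrib, ← sum_sub_distrib]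
        refine sum_congr rfl fun J _ => ?_
        split_ifs <;> ring
      rw [this]
      linarith
    · intro J hJ
      by_cases h1 : (∃ r ∈ R J, r < a) ∧ (∃ r ∈ R J, a < r) ∧ a ∉ R J
      · obtain ⟨⟨r, hr, hra⟩, ⟨r', hr', hra'⟩, -⟩ := id h1
        have hc1 : (R J).card ≠ 1 := by
          intro h
          obtain ⟨z, hz⟩ := card_eq_one.1 h
          rw [hz, mem_singleton] at hr hr'
          omega
        have hrm := mem_Ico.1 (hR J hJ hr)
        have h2 := hcut J {r, a} hJ (by
          intro x hx
          rcases mem_insert.1 hx with rfl | hx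
          · exact mem_range.2 hrm.2
          · rw [mem_singleton.1 hx]; exact mem_range.2 ham) (by
          intro l hl
          rcases mem_insert.1 hl with rfl | hl
          · exact ⟨⟨l, hr, le_rfl⟩, r', hr', by omega⟩
          · rw [mem_singleton.1 hl]
            exact ⟨⟨r, hr, by omega⟩, r', hr', by omega⟩)
        rw [card_pair (by omega)] at h2
        rw [if_neg hc1, if_pos h1]
        have : (((range m).filter (fun l => ∀ r ∈ R J, l < r)).card : ℝ) +
          ((range m).filter (fun l => ∀ r ∈ R J, r ≤ l)).card + 2 ≤ m := by exact_mod_cast h2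
        linarith
      · rw [if_neg h1]
        by_cases h3 : (R J).card = 1
        · have h2 := hcut J ∅ hJ (by simp) (by simp)
          rw [if_pos h3]
          have : (((range m).filter (fun l => ∀ r ∈ R J, l < r)).card : ℝ) +
            ((range m).filter (fun l => ∀ r ∈ R J, r ≤ l)).card ≤ m := by
              simp only [card_empty, add_zero] at h2
              exact_mod_cast h2
          linarith
        · have hlt : 1 < (R J).card := by
            have := (hne J hJ).card_pos
            omega
          obtain ⟨r, hr, r', hr', hrr⟩ := one_lt_card.1 hlt
          have key : ∀ x ∈ R J, ∀ y ∈ R J, x < y →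
              ((range m).filter (fun l => ∀ r ∈ R J, l < r)).card +
              ((range m).filter (fun l => ∀ r ∈ R J, r ≤ l)).card + 1 ≤ m := by
            intro x hx y hy hxy
            have hxm := mem_Ico.1 (hR J hJ hx)
            have h2 := hcut J {x} hJ (by simpa using hxm.2) (by
              intro l hl
              rw [mem_singleton.1 hl]
              exact ⟨⟨x, hx, le_rfl⟩, y, hy, hxy⟩)
            simpa using h2
          have h2 : ((range m).filter (fun l => ∀ r ∈ R J, l < r)).card +
              ((range m).filter (fun l => ∀ r ∈ R J, r ≤ l)).card + 1 ≤ m := by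
            rcases lt_or_gt_of_ne hrr with h | h
            · exact key r hr r' hr' h
            · exact key r' hr' r hr h
          rw [if_neg h3]
          have : (((range m).filter (fun l => ∀ r ∈ R J, l < r)).card : ℝ) +
            ((range m).filter (fun l => ∀ r ∈ R J, r ≤ l)).card + 1 ≤ m := by exact_mod_cast h2
          linarith
  have hgain : (∑ r ∈ Ico 1 m, p r) - st ≤
      ∑ l ∈ range m, (min (U l) (n l) + min (U' l) (n' l)) := by
    have hsplit : ∀ g : ℕ → ℝ, ∑ l ∈ range m, g l =
        ∑ l ∈ range a, g l + ∑ l ∈ Ico a m, g l := by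
      intro g
      rw [range_eq_Ico, range_eq_Ico, sum_Ico_consecutive g (Nat.zero_le a) ham.le]
    have hpsplit : ∑ r ∈ Ico 1 m, p r =
        ∑ r ∈ Ico 1 a, p r + (p a + ∑ r ∈ Ico a (m - 1), p (r + 1)) := by
      rw [← sum_Ico_consecutive p ha1 ham.le, sum_eq_sum_Ico_succ_bot ham p, sum_Ico_add']
      congr 4
      omega
    have hpa0 := hp0 a ha
    have hI : Ico 1 a ⊆ range a := fun x hx => mem_range.2 (mem_Ico.1 hx).2
    have hI' : Ico a (m - 1) ⊆ Ico a m := Ico_subset_Ico_right (by omega)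
    have hF1 : ∑ r ∈ Ico 1 a, p r ≤ ∑ l ∈ range a, min (U l) (n l) := by
      refine le_trans (sum_le_sum fun l hl => ?_)
        (sum_le_sum_of_subset_of_nonneg hI fun l _ _ => le_min (hU0 l) (hn0 l))
      obtain ⟨hl1, hl2⟩ := mem_Ico.1 hl
      refine le_min ((hamax l (mem_Ico.2 ⟨hl1, by omega⟩)).trans (hUp l a ha1 ham hl2)) ?_
      exact hn l (by omega) l hl1 le_rfl
    have hF2 : min (p a) (U a) ≤ ∑ l ∈ Ico a m, min (U l) (n l) := by
      refine le_trans ?_ (single_le_sum (f := fun l => min (U l) (n l))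
        (fun l _ => le_min (hU0 l) (hn0 l)) (mem_Ico.2 ⟨le_rfl, ham⟩))
      have := hn a ham a ha1 le_rfl
      exact le_min (min_le_right _ _) ((min_le_left _ _).trans this)
    have hB1 : ∑ r ∈ Ico a (m - 1), p (r + 1) ≤ ∑ l ∈ Ico a m, min (U' l) (n' l) := by
      refine le_trans (sum_le_sum fun l hl => ?_)
        (sum_le_sum_of_subset_of_nonneg hI' fun l _ _ => le_min (hU0' l) (hn0' l))
      obtain ⟨hl1, hl2⟩ := mem_Ico.1 hl
      refine le_min ((hamax (l + 1) (mem_Ico.2 ⟨by omega, by omega⟩)).trans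
        (hUp' l a ha1 ham hl1)) ?_
      exact hn' l (by omega) (l + 1) (by omega) (by omega)
    have hB2 : min (p a) (U' (a - 1)) ≤ ∑ l ∈ range a, min (U' l) (n' l) := by
      refine le_trans ?_ (single_le_sum (f := fun l => min (U' l) (n' l))
        (fun l _ => le_min (hU0' l) (hn0' l)) (mem_range.2 (show a - 1 < a by omega)))
      have := hn' (a - 1) (by omega) a (by omega) ham
      exact le_min (min_le_right _ _) ((min_le_left _ _).trans this)
    have hthree : p a ≤ U a + U' (a - 1) + st := by
      refine (hcond a ha).trans ?_
      rw [hU, hU', hst]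
      simp only [sum_filter]
      rw [← sum_add_distrib, ← sum_add_distrib]
      refine sum_le_sum fun J hJ => ?_
      have hcJ := hc J hJ
      by_cases h0 : a ∈ R J
      · rw [if_neg (by simpa using h0)]
        positivity
      rw [if_pos h0]
      have hcase : (∀ r ∈ R J, a < r) ∨ (∀ r ∈ R J, r ≤ a - 1) ∨
          ((∃ r ∈ R J, r < a) ∧ (∃ r ∈ R J, a < r) ∧ a ∉ R J) := by
        by_cases h1 : ∀ r ∈ R J, a < r
        · exact Or.inl h1
        by_cases h2 : ∀ r ∈ R J, r ≤ a - 1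
        · exact Or.inr (Or.inl h2)
        push Not at h1 h2
        obtain ⟨x, hx, hxa⟩ := h1
        obtain ⟨y, hy, hya⟩ := h2
        refine Or.inr (Or.inr ⟨⟨x, hx, lt_of_le_of_ne hxa fun h => h0 (h ▸ hx)⟩,
          ⟨y, hy, lt_of_le_of_ne (by omega) fun h => h0 (h ▸ hy)⟩, h0⟩)
      rcases hcase with h | h | h
      · rw [if_pos h]
        have : 0 ≤ (if ∀ r ∈ R J, r ≤ a - 1 then c J else 0) := by split_ifs <;> simp [hcJ]
        have : 0 ≤ (if (∃ r ∈ R J, r < a) ∧ (∃ r ∈ R J, a < r) ∧ a ∉ R J then c J else 0) := by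
          split_ifs <;> simp [hcJ]
        linarith
      · rw [if_pos h]
        have : 0 ≤ (if ∀ r ∈ R J, a < r then c J else 0) := by split_ifs <;> simp [hcJ]
        have : 0 ≤ (if (∃ r ∈ R J, r < a) ∧ (∃ r ∈ R J, a < r) ∧ a ∉ R J then c J else 0) := by
          split_ifs <;> simp [hcJ]
        linarith
      · rw [if_pos h]
        have : 0 ≤ (if ∀ r ∈ R J, a < r then c J else 0) := by split_ifs <;> simp [hcJ]
        have : 0 ≤ (if ∀ r ∈ R J, r ≤ a - 1 then c J else 0) := by split_ifs <;> simp [hcJ]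
        linarith
    rw [sum_add_distrib, hsplit, hsplit, hpsplit]
    have hm1 : 0 ≤ min (p a) (U a) := le_min hpa0 (hU0 a)
    have hm2 : 0 ≤ min (p a) (U' (a - 1)) := le_min hpa0 (hU0' _)
    have hfin : p a ≤ min (p a) (U a) + min (p a) (U' (a - 1)) + st := by
      rcases min_choice (p a) (U a) with h | h
      · linarith
      rcases min_choice (p a) (U' (a - 1)) with h' | h'
      · linarith
      linarith
    linarith
  have : ∑ l ∈ range m, (max 0 (U l - n l) + max 0 (U' l - n' l)) =
      ∑ l ∈ range m, (U l + U' l) - ∑ l ∈ range m, (min (U l) (n l) + min (U' l) (n' l)) := by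
    rw [← sum_sub_distrib]
    refine sum_congr rfl fun l _ => ?_
    rw [hmax, hmax]; ring
  rw [this]
  linarith

/-- The total weight of the sets through `i` that have an element processed after `i`, when the
elements of `T` are processed by increasing rank `r` and everything outside `T` comes after `T`. -/
noncomputable def laterMass {ι : Type*} [Fintype ι] [DecidableEq ι] (c : Finset ι → ℝ)
    (T : Finset ι) (r : ι → ℕ) (i : ι) : ℝ :=
  ∑ J with i ∈ J ∧ ∃ j ∈ J, j ∉ T ∨ r i < r j, c J

/-- The part of `Δ i` that is not covered by the sets that are still open after `i` and by one
further pair `{i, f i}`. -/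
noncomputable def orderCost {ι : Type*} [Fintype ι] [DecidableEq ι] (c : Finset ι → ℝ) (Δ : ι → ℝ)
    (T : Finset ι) (r : ι → ℕ) (f : ι → ι) (i : ι) : ℝ :=
  max 0 (Δ i - laterMass c T r i - c {i, f i})

/-- The rank in a cyclic enumeration `e` of `m` elements that has been rotated by `s`. -/
def rotRank {ι : Type*} (e : ι → ℕ) (m s : ℕ) (t : ι) : ℕ :=
  if e t + s < m then e t + s else e t + s - m

/-- The number of cyclic steps from `i` to `t`. -/
def cyclicPos {ι : Type*} (e : ι → ℕ) (m : ℕ) (i t : ι) : ℕ :=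
  if e i < e t then e t - e i else e t + m - e i

/-- Suppose that `i` cannot be split off together with any `j ∈ T` (hypothesis `hbad`). Then its
cost, averaged over the `|T|` rotations of a cyclic order and their reversals, is at most `κ (|T| -
1) / (2 |T|)`. Seen from `i`, a rotation declares the next `l` elements of the cycle to be later,
and its reversal declares the remaining ones to be later. -/
theorem sum_orderCost_rotations_le {ι : Type*} [Fintype ι] [DecidableEq ι] (c : Finset ι → ℝ)
    (hc : ∀ J, 0 ≤ c J) (hc1 : ∀ i, c {i} = 0) (Δ : ι → ℝ) (κ : ℝ) (T : Finset ι) (i : ι)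
    (hi : i ∈ T) (h0 : 0 ≤ Δ i) (hκ : Δ i ≤ κ) (hΔ : Δ i ≤ ∑ J with i ∈ J, c J)
    (hbad : ∀ j ∈ T, i ≠ j → (∑ J with i ∈ J ∧ (¬ J ⊆ T ∨ j ∈ J), c J) + c {i, j} < Δ i)
    (e : ι → ℕ) (he : Set.InjOn e T) (hem : ∀ t ∈ T, e t < T.card)
    (f f' : ℕ → ι → ι)
    (hf : ∀ s, ∀ t ∈ T, rotRank e T.card s i < rotRank e T.card s t → c {i, t} ≤ c {i, f s i})
    (hf' : ∀ s, ∀ t ∈ T, rotRank e T.card s t < rotRank e T.card s i → c {i, t} ≤ c {i, f' s i}) :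
    ∑ s ∈ range T.card, (orderCost c Δ T (rotRank e T.card s) (f s) i +
      orderCost c Δ T (fun t => T.card - 1 - rotRank e T.card s t) (f' s) i) ≤
      κ * ((T.card : ℝ) - 1) := by
  classical
  set m := T.card with hm
  have hm1 : 1 ≤ m := card_pos.2 ⟨i, hi⟩
  set lam : ℝ := ∑ J with i ∈ J, c J with hlam
  have hlam0 : 0 ≤ lam := sum_nonneg fun J _ => hc J
  have hm1' : (0 : ℝ) ≤ (m : ℝ) - 1 := by
    have : (1 : ℝ) ≤ m := by exact_mod_cast hm1
    linarith
  have hlm0 : ∀ r : ι → ℕ, 0 ≤ laterMass c T r i := fun r => sum_nonneg fun J _ => hc J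
  rcases hlam0.eq_or_lt with hz | hlpos
  · have hΔ0 : Δ i = 0 := le_antisymm (hΔ.trans hz.symm.le) h0
    have : ∀ r g, orderCost c Δ T r g i = 0 := by
      intro r g
      refine max_eq_left ?_
      have := hlm0 r
      have := hc {i, g i}
      linarith
    simp only [this, add_zero, sum_const_zero]
    exact mul_nonneg (h0.trans hκ) hm1'
  have hei := hem i hi
  have hpos : ∀ t ∈ T, t ≠ i → 1 ≤ cyclicPos e m i t ∧ cyclicPos e m i t < m := by
    intro t ht hti
    have h1 := hem t ht
    have h2 : e t ≠ e i := fun h => hti (he ht hi h)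
    unfold cyclicPos
    split_ifs <;> omega
  have hinj : Set.InjOn (cyclicPos e m i) (T.erase i : Finset ι) := by
    intro x hx y hy hxy
    have hx' := mem_erase.1 (mem_coe.1 hx)
    have hy' := mem_erase.1 (mem_coe.1 hy)
    have h1 := hem x hx'.2
    have h2 := hem y hy'.2
    refine he hx'.2 hy'.2 ?_
    unfold cyclicPos at hxy
    split_ifs at hxy <;> omega
  have himg : (T.erase i).image (cyclicPos e m i) = Ico 1 m := by
    refine eq_of_subset_of_card_le ?_ ?_
    · intro x hx
      obtain ⟨t, ht, rfl⟩ := mem_image.1 hx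
      exact mem_Ico.2 (hpos t (mem_erase.1 ht).2 (mem_erase.1 ht).1)
    · rw [card_image_of_injOn hinj, card_erase_of_mem hi, Nat.card_Ico]
  set R : Finset ι → Finset ℕ := fun J => (J.erase i).image (cyclicPos e m i) with hR
  set S : Finset (Finset ι) := univ.filter (fun J => i ∈ J ∧ J ⊆ T ∧ J ≠ {i}) with hS
  set p : ℕ → ℝ := fun r => ∑ t ∈ T.erase i with cyclicPos e m i t = r, c {i, t} with hp
  have hpval : ∀ t ∈ T, t ≠ i → p (cyclicPos e m i t) = c {i, t} := by
    intro t ht hti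
    have : (T.erase i).filter (fun u => cyclicPos e m i u = cyclicPos e m i t) = {t} := by
      ext u
      simp only [mem_filter, mem_singleton]
      constructor
      · rintro ⟨hu, h⟩
        exact hinj hu (mem_erase.2 ⟨hti, ht⟩) h
      · rintro rfl
        exact ⟨mem_erase.2 ⟨hti, ht⟩, rfl⟩
    rw [hp]
    simp only [this, sum_singleton]
  have hex : ∀ r ∈ Ico 1 m, ∃ t ∈ T, t ≠ i ∧ cyclicPos e m i t = r := by
    intro r hr
    rw [← himg] at hr
    obtain ⟨t, ht, h⟩ := mem_image.1 hr
    exact ⟨t, (mem_erase.1 ht).2, (mem_erase.1 ht).1, h⟩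
  have hRpair : ∀ t, t ≠ i → R {i, t} = {cyclicPos e m i t} := by
    intro t ht
    have : ({i, t} : Finset ι).erase i = {t} := by
      ext u
      simp only [mem_erase, mem_insert, mem_singleton]
      constructor
      · rintro ⟨h1, h2 | h2⟩
        · exact absurd h2 h1
        · exact h2
      · rintro rfl
        exact ⟨ht, Or.inr rfl⟩
    rw [hR]
    simp [this]
  have hSpair : ∀ t ∈ T, t ≠ i → ({i, t} : Finset ι) ∈ S := by
    intro t ht hti
    rw [hS, mem_filter]
    refine ⟨mem_univ _, by simp, ?_, ?_⟩
    · intro u hu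
      rcases mem_insert.1 hu with rfl | hu
      · exact hi
      · rw [mem_singleton.1 hu]; exact ht
    · intro h
      have : t ∈ ({i} : Finset ι) := h ▸ (by simp)
      exact hti (mem_singleton.1 this)
  -- the value of the rotation parameter for which exactly the next `l` elements come later
  set σ : ℕ → ℕ := fun l => if e i + l ≤ m - 1 then m - 1 - l - e i else 2 * m - 1 - l - e i with hσ
  have hσr : ∀ l < m, rotRank e m (σ l) i = m - 1 - l := by
    intro l hl
    simp only [rotRank, hσ]
    split_ifs <;> omega
  have hσm : ∀ l < m, σ l < m := by
    intro l hl
    simp only [hσ]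
    split_ifs <;> omega
  have hfwd : ∀ l < m, ∀ t ∈ T, t ≠ i →
      (rotRank e m (σ l) i < rotRank e m (σ l) t ↔ cyclicPos e m i t ≤ l) := by
    intro l hl t ht hti
    have h1 := hem t ht
    have h2 : e t ≠ e i := fun h => hti (he ht hi h)
    rw [hσr l hl]
    simp only [rotRank, hσ, cyclicPos]
    split_ifs <;> omega
  have hrev : ∀ l < m, ∀ t ∈ T, t ≠ i →
      (rotRank e m (σ l) t < rotRank e m (σ l) i ↔ l < cyclicPos e m i t) := by
    intro l hl t ht hti
    have h1 := hem t ht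
    have h2 : e t ≠ e i := fun h => hti (he ht hi h)
    rw [hσr l hl]
    simp only [rotRank, hσ, cyclicPos]
    split_ifs <;> omega
  have hreidx : ∀ g : ℕ → ℝ, ∑ s ∈ range m, g s = ∑ l ∈ range m, g (σ l) := by
    intro g
    symm
    refine sum_nbij' σ (fun s => m - 1 - rotRank e m s i) ?_ ?_ ?_ ?_ ?_
    · intro l hl
      exact mem_range.2 (hσm l (mem_range.1 hl))
    · intro s hs
      refine mem_range.2 (by omega)
    · intro l hl
      have := hσr l (mem_range.1 hl)
      have := mem_range.1 hl
      omega
    · intro s hs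
      have hs' := mem_range.1 hs
      simp only [rotRank, hσ]
      split_ifs <;> omega
    · intro l _
      rfl
  -- the weight of the sets that are not open after `i`
  have hmass : ∀ (r : ι → ℕ) (Q : ℕ → Prop) [DecidablePred Q],
      (∀ t ∈ T, t ≠ i → (¬ r i < r t ↔ Q (cyclicPos e m i t))) →
      laterMass c T r i = lam - ∑ J ∈ S with ∀ x ∈ R J, Q x, c J := by
    intro r Q _ hQ
    have h1 : lam = ∑ J with i ∈ J ∧ ∃ j ∈ J, j ∉ T ∨ r i < r j, c J +
        ∑ J with i ∈ J ∧ ¬ ∃ j ∈ J, j ∉ T ∨ r i < r j, c J := by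
      rw [hlam, ← sum_filter_add_sum_filter_not _ (fun J => ∃ j ∈ J, j ∉ T ∨ r i < r j),
        filter_filter, filter_filter]
    have h2 : ∑ J with i ∈ J ∧ ¬ ∃ j ∈ J, j ∉ T ∨ r i < r j, c J =
        ∑ J ∈ S with ∀ x ∈ R J, Q x, c J := by
      symm
      rw [hS, filter_filter]
      refine sum_subset ?_ ?_
      · intro J hJ
        obtain ⟨-, ⟨hiJ, hJT, -⟩, hx⟩ := mem_filter.1 hJ
        refine mem_filter.2 ⟨mem_univ _, hiJ, ?_⟩
        rintro ⟨j, hj, hj1 | hj1⟩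
        · exact hj1 (hJT hj)
        · have hji : j ≠ i := by rintro rfl; omega
          exact (hQ j (hJT hj) hji).2 (hx _ (mem_image_of_mem _ (mem_erase.2 ⟨hji, hj⟩))) hj1
      · intro J hJ hJ'
        obtain ⟨-, hiJ, hx⟩ := mem_filter.1 hJ
        push Not at hx
        by_cases hJ1 : J = {i}
        · rw [hJ1, hc1]
        · exfalso
          apply hJ'
          refine mem_filter.2 ⟨mem_univ _, ⟨hiJ, fun j hj => (hx j hj).1, hJ1⟩, ?_⟩
          intro x hxR
          obtain ⟨t, ht, rfl⟩ := mem_image.1 hxR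
          obtain ⟨hti, htJ⟩ := mem_erase.1 ht
          exact (hQ t (hx t htJ).1 hti).1 (not_lt.2 (hx t htJ).2)
    unfold laterMass
    rw [h1, h2, add_sub_cancel_right]
  have hscale : ∀ U n : ℝ, U ≤ lam → 0 ≤ n →
      max 0 (Δ i - (lam - U) - n) ≤ (Δ i / lam) * max 0 (U - n) := by
    intro U n hU hn
    have hs0 : 0 ≤ Δ i / lam := div_nonneg h0 hlam0
    have hs1 : Δ i / lam ≤ 1 := (div_le_one hlpos).2 hΔ
    have hs : Δ i = Δ i / lam * lam := by field_simp
    refine max_le (mul_nonneg hs0 (le_max_left _ _)) ?_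
    refine le_trans ?_ (mul_le_mul_of_nonneg_left (le_max_right _ _) hs0)
    nlinarith
  have hSle : ∑ J ∈ S, c J ≤ lam := by
    refine sum_le_sum_of_subset_of_nonneg ?_ fun J _ _ => hc J
    intro J hJ
    exact mem_filter.2 ⟨mem_univ _, (mem_filter.1 hJ).2.1⟩
  have hpart : ∀ (Q : Finset ι → Prop) [DecidablePred Q], ∑ J ∈ S with Q J, c J ≤ lam := by
    intro Q _
    exact (sum_le_sum_of_subset_of_nonneg (filter_subset _ _) fun J _ _ => hc J).trans hSle
  have hmain := sum_rotation_cost_le m S R c (fun J _ => hc J) ?_ ?_ p ?_ ?_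
    (fun l => c {i, f (σ l) i}) (fun l => c {i, f' (σ l) i}) (fun l => hc _) (fun l => hc _)
    ?_ ?_ ?_
  · rw [hreidx]
    have hterm : ∀ l ∈ range m, orderCost c Δ T (rotRank e m (σ l)) (f (σ l)) i +
        orderCost c Δ T (fun t => m - 1 - rotRank e m (σ l) t) (f' (σ l)) i ≤
        (Δ i / lam) * (max 0 ((∑ J ∈ S with ∀ r ∈ R J, l < r, c J) - c {i, f (σ l) i}) +
        max 0 ((∑ J ∈ S with ∀ r ∈ R J, r ≤ l, c J) - c {i, f' (σ l) i})) := by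
      intro l hl
      have hl' := mem_range.1 hl
      rw [mul_add]
      refine add_le_add ?_ ?_
      · have := hmass (rotRank e m (σ l)) (fun x => l < x) (by
          intro t ht hti
          rw [hfwd l hl' t ht hti]; exact not_le)
        unfold orderCost
        rw [this]
        exact hscale _ _ (hpart _) (hc _)
      · have := hmass (fun t => m - 1 - rotRank e m (σ l) t) (fun x => x ≤ l) (by
          intro t ht hti
          have h1 : rotRank e m (σ l) t < m := by
            have := hem t ht
            have := hσm l hl'
            unfold rotRank
            split_ifs <;> omega
          have h2 := hσr l hl'
          rw [← not_lt (a := l), ← hrev l hl' t ht hti]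
          omega)
        unfold orderCost
        rw [this]
        exact hscale _ _ (hpart _) (hc _)
    refine (sum_le_sum hterm).trans ?_
    rw [← mul_sum]
    have hs0 : 0 ≤ Δ i / lam := div_nonneg h0 hlam0
    calc _ ≤ (Δ i / lam) * (((m : ℝ) - 1) * ∑ J ∈ S, c J) := mul_le_mul_of_nonneg_left hmain hs0
      _ ≤ (Δ i / lam) * (((m : ℝ) - 1) * lam) := by gcongr
      _ = Δ i * ((m : ℝ) - 1) := by field_simp
      _ ≤ κ * ((m : ℝ) - 1) := by gcongr
  · intro J hJ
    obtain ⟨-, hiJ, -, hJ1⟩ := mem_filter.1 hJ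
    rw [hR]
    refine Nonempty.image ?_ _
    rw [nonempty_iff_ne_empty, Ne, erase_eq_empty_iff, not_or]
    exact ⟨fun h => by rw [h] at hiJ; simp at hiJ, hJ1⟩
  · intro J hJ x hx
    obtain ⟨-, hiJ, hJT, -⟩ := mem_filter.1 hJ
    obtain ⟨t, ht, rfl⟩ := mem_image.1 hx
    obtain ⟨hti, htJ⟩ := mem_erase.1 ht
    exact mem_Ico.2 (hpos t (hJT htJ) hti)
  · intro r hr
    obtain ⟨t, ht, hti, rfl⟩ := hex r hr
    exact ⟨{i, t}, hSpair t ht hti, hRpair t hti, (hpval t ht hti).symm⟩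
  · have h1 : ∑ r ∈ Ico 1 m, p r = ∑ t ∈ T.erase i, c {i, t} := by
      rw [hp]
      exact sum_fiberwise_of_maps_to (fun t ht =>
        mem_Ico.2 (hpos t (mem_erase.1 ht).2 (mem_erase.1 ht).1)) _
    have h2 : ∑ t ∈ T.erase i, c {i, t} =
        ∑ J ∈ (T.erase i).image (fun t => ({i, t} : Finset ι)), c J := by
      rw [sum_image]
      intro x hx y hy hxy
      have : x ∈ ({i, y} : Finset ι) := by
        have h : ({i, x} : Finset ι) = {i, y} := hxy
        rw [← h]; simp
      rcases mem_insert.1 this with h | h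
      · exact absurd h (mem_erase.1 (mem_coe.1 hx)).1
      · exact mem_singleton.1 h
    rw [h1, h2]
    refine sum_le_sum_of_subset_of_nonneg ?_ fun J _ _ => hc J
    intro J hJ
    obtain ⟨hJS, hJ1⟩ := mem_filter.1 hJ
    obtain ⟨-, hiJ, hJT, -⟩ := mem_filter.1 hJS
    have hsub : J.erase i ⊆ T.erase i := erase_subset_erase i hJT
    rw [hR] at hJ1
    simp only at hJ1
    rw [card_image_of_injOn (hinj.mono (by exact_mod_cast hsub))] at hJ1
    obtain ⟨t, ht⟩ := card_eq_one.1 hJ1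
    refine mem_image.2 ⟨t, hsub (by rw [ht]; simp), ?_⟩
    rw [← insert_erase hiJ, ht]
  · intro l hl r hr1 hr2
    obtain ⟨t, ht, hti, rfl⟩ := hex r (mem_Ico.2 ⟨hr1, by omega⟩)
    rw [hpval t ht hti]
    exact hf _ t ht ((hfwd l hl t ht hti).2 hr2)
  · intro l hl r hr1 hr2
    obtain ⟨t, ht, hti, rfl⟩ := hex r (mem_Ico.2 ⟨by omega, by omega⟩)
    rw [hpval t ht hti]
    exact hf' _ t ht ((hrev l hl t ht hti).2 hr1)
  · intro a ha
    obtain ⟨t, ht, hti, rfl⟩ := hex a ha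
    rw [hpval t ht hti]
    have hb := hbad t ht (Ne.symm hti)
    have h1 : lam = ∑ J with i ∈ J ∧ (¬ J ⊆ T ∨ t ∈ J), c J +
        ∑ J with i ∈ J ∧ ¬ (¬ J ⊆ T ∨ t ∈ J), c J := by
      rw [hlam, ← sum_filter_add_sum_filter_not _ (fun J => ¬ J ⊆ T ∨ t ∈ J),
        filter_filter, filter_filter]
    have h2 : ∑ J with i ∈ J ∧ ¬ (¬ J ⊆ T ∨ t ∈ J), c J ≤
        ∑ J ∈ S with cyclicPos e m i t ∉ R J, c J := by
      rw [← sum_subset (s₁ := (univ.filter fun J => i ∈ J ∧ ¬ (¬ J ⊆ T ∨ t ∈ J)).erase {i})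
        (erase_subset _ _)]
      · refine sum_le_sum_of_subset_of_nonneg ?_ fun J _ _ => hc J
        intro J hJ
        obtain ⟨hJ1, hJ2⟩ := mem_erase.1 hJ
        obtain ⟨-, hiJ, hJ3⟩ := mem_filter.1 hJ2
        push Not at hJ3
        refine mem_filter.2 ⟨mem_filter.2 ⟨mem_univ _, hiJ, hJ3.1, hJ1⟩, ?_⟩
        intro hmem
        obtain ⟨u, hu, hut⟩ := mem_image.1 hmem
        obtain ⟨hui, huJ⟩ := mem_erase.1 hu
        have : u = t := hinj (mem_erase.2 ⟨hui, hJ3.1 huJ⟩) (mem_erase.2 ⟨hti, ht⟩) hut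
        exact hJ3.2 (this ▸ huJ)
      · intro J hJ hJ'
        by_cases hJ1 : J = {i}
        · rw [hJ1, hc1]
        · exact absurd (mem_erase.2 ⟨hJ1, hJ⟩) hJ'
    linarith

/-- The combinatorial heart of the argument: the elements of `T` can be ordered, and each given a
partner not earlier than itself, so that the total cost is at most `κ ⌊|T| / 2⌋`. If for some pair
`i, j` the sets through `i` that leave `T` or contain `j`, with `{i, j}` counted twice, cover `Δ
i`, then `i, j` is put last at cost `0 + κ`, and induction applies. If there is no such pair, some
rotation of an arbitrary cyclic order, or its reversal, is cheap enough. -/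
theorem exists_order_on {ι : Type*} [Fintype ι] [DecidableEq ι] (c : Finset ι → ℝ)
    (hc : ∀ J, 0 ≤ c J) (hc1 : ∀ i, c {i} = 0) (Δ : ι → ℝ) (κ : ℝ) (h0 : ∀ i, 0 ≤ Δ i)
    (hκ : ∀ i, Δ i ≤ κ) (hΔ : ∀ i, Δ i ≤ ∑ J with i ∈ J, c J) (T : Finset ι) :
    ∃ (r : ι → ℕ) (f : ι → ι), Set.InjOn r T ∧ (∀ i ∈ T, r i ≤ r (f i) ∧ f i ∈ T) ∧
      ∑ i ∈ T, orderCost c Δ T r f i ≤ κ * ((T.card / 2 : ℕ) : ℝ) := by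
  classical
  induction hn : T.card using Nat.strong_induction_on generalizing T with
  | _ m ih =>
  rcases T.eq_empty_or_nonempty with rfl | hT
  · exact ⟨fun _ => 0, id, by simp, by simp, by simp [← hn]⟩
  have hκ0 : 0 ≤ κ := by
    obtain ⟨i, -⟩ := hT
    exact (h0 i).trans (hκ i)
  by_cases hgood : ∃ i ∈ T, ∃ j ∈ T, i ≠ j ∧
      Δ i ≤ (∑ J with i ∈ J ∧ (¬ J ⊆ T ∨ j ∈ J), c J) + c {i, j}
  · obtain ⟨i, hi, j, hj, hij, hΔi⟩ := hgood
    set T' := (T.erase i).erase j with hT'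
    have hjT : j ∈ T.erase i := mem_erase.2 ⟨hij.symm, hj⟩
    have hcard : T'.card + 2 = m := by
      have h1 := card_erase_add_one hjT
      have h2 := card_erase_add_one hi
      rw [← hT'] at h1
      omega
    have hmem : ∀ t, t ∈ T' ↔ t ≠ j ∧ t ≠ i ∧ t ∈ T := by
      intro t
      rw [hT', mem_erase, mem_erase]
    obtain ⟨r, f, hr, hf, hcost⟩ := ih T'.card (by omega) T' rfl
    -- the pair `i, j` is appended at the end of the order of the other elements
    obtain ⟨M, hM⟩ : ∃ M, ∀ t ∈ T', r t < M :=
      ⟨T'.sup r + 1, fun t ht => Nat.lt_succ_of_le (le_sup (f := r) ht)⟩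
    set r' : ι → ℕ := fun t => if t = i then M else if t = j then M + 1 else r t with hr'
    set f' : ι → ι := fun t => if t = i then j else if t = j then j else f t with hf'
    have hri : r' i = M := by simp [hr']
    have hrj : r' j = M + 1 := by simp [hr', hij.symm]
    have hrt : ∀ t ∈ T', r' t = r t := by
      intro t ht
      obtain ⟨h1, h2, -⟩ := (hmem t).1 ht
      simp [hr', h1, h2]
    have hft : ∀ t ∈ T', f' t = f t := by
      intro t ht
      obtain ⟨h1, h2, -⟩ := (hmem t).1 ht
      simp [hf', h1, h2]
    have hcases : ∀ t ∈ T, t = i ∨ t = j ∨ t ∈ T' := by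
      intro t ht
      by_cases h1 : t = i
      · exact Or.inl h1
      by_cases h2 : t = j
      · exact Or.inr (Or.inl h2)
      exact Or.inr (Or.inr ((hmem t).2 ⟨h2, h1, ht⟩))
    refine ⟨r', f', ?_, ?_, ?_⟩
    · intro x hx y hy hxy
      rcases hcases x hx with rfl | rfl | hx' <;> rcases hcases y hy with rfl | rfl | hy'
      · rfl
      · omega
      · have := hM y hy'
        have := hrt y hy'
        omega
      · omega
      · rfl
      · have := hM y hy'
        have := hrt y hy'
        omega
      · have := hM x hx'
        have := hrt x hx'
        omega
      · have := hM x hx'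
        have := hrt x hx'
        omega
      · rw [hrt x hx', hrt y hy'] at hxy
        exact hr hx' hy' hxy
    · intro t ht
      rcases hcases t ht with rfl | rfl | ht'
      · have : f' t = j := by simp [hf']
        rw [this]
        exact ⟨by omega, hj⟩
      · have : f' t = t := by simp [hf', hij.symm]
        rw [this]
        exact ⟨le_rfl, hj⟩
      · rw [hft t ht', hrt t ht', hrt _ (hf t ht').2]
        exact ⟨(hf t ht').1, ((hmem _).1 (hf t ht').2).2.2⟩
    · have hsum : ∑ t ∈ T, orderCost c Δ T r' f' t =
          orderCost c Δ T r' f' i + (orderCost c Δ T r' f' j +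
            ∑ t ∈ T', orderCost c Δ T r' f' t) := by
        rw [hT', add_sum_erase _ _ hjT, add_sum_erase _ _ hi]
      have hT'cost : ∑ t ∈ T', orderCost c Δ T r' f' t = ∑ t ∈ T', orderCost c Δ T' r f t := by
        refine sum_congr rfl fun t ht => ?_
        unfold orderCost
        have : laterMass c T r' t = laterMass c T' r t := by
          unfold laterMass
          congr 1
          refine filter_congr fun J _ => and_congr_right fun _ =>
            exists_congr fun u => and_congr_right fun _ => ?_
          rw [hrt t ht]
          have hMt := hM t ht
          by_cases huT : u ∈ T
          · rcases hcases u huT with rfl | rfl | hu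
            · rw [hri]
              exact iff_of_true (Or.inr hMt) (Or.inl fun h => ((hmem _).1 h).2.1 rfl)
            · rw [hrj]
              exact iff_of_true (Or.inr (by omega)) (Or.inl fun h => ((hmem _).1 h).1 rfl)
            · rw [hrt u hu]
              simp [hu, huT]
          · refine iff_of_true (Or.inl huT) (Or.inl fun h => huT ((hmem _).1 h).2.2)
        rw [this, hft t ht]
      have hi0 : orderCost c Δ T r' f' i ≤ 0 := by
        refine max_le le_rfl ?_
        have hfi : f' i = j := by simp [hf']
        rw [hfi]
        have : (∑ J with i ∈ J ∧ (¬ J ⊆ T ∨ j ∈ J), c J) ≤ laterMass c T r' i := by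
          refine sum_le_sum_of_subset_of_nonneg ?_ fun J _ _ => hc J
          intro J hJ
          obtain ⟨-, hiJ, hJ2⟩ := mem_filter.1 hJ
          refine mem_filter.2 ⟨mem_univ _, hiJ, ?_⟩
          rcases hJ2 with h | h
          · obtain ⟨u, hu, hu'⟩ := not_subset.1 h
            exact ⟨u, hu, Or.inl hu'⟩
          · exact ⟨j, h, Or.inr (by omega)⟩
        linarith
      have hj0 : orderCost c Δ T r' f' j ≤ κ := by
        refine max_le hκ0 ?_
        have h1 : 0 ≤ laterMass c T r' j := sum_nonneg fun J _ => hc J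
        have h2 := hc {j, f' j}
        have h3 := hκ j
        linarith
      have hm2 : m / 2 = T'.card / 2 + 1 := by omega
      rw [hsum, hT'cost, hm2]
      rw [Nat.cast_add, Nat.cast_one, mul_add, mul_one]
      linarith only [hi0, hj0, hcost]
  · -- no pair can be split off, so one of the rotations of a cyclic order has small cost
    push Not at hgood
    set e : ι → ℕ := fun t => if h : t ∈ T then (T.equivFin ⟨t, h⟩ : ℕ) else 0 with he
    have heinj : Set.InjOn e T := by
      intro x hx y hy hxy
      have hx' : x ∈ T := hx
      have hy' : y ∈ T := hy
      simp only [he, hx', hy', dif_pos] at hxy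
      have := T.equivFin.injective (Fin.ext hxy)
      simpa using this
    have hem : ∀ t ∈ T, e t < T.card := by
      intro t ht
      simp only [he, ht, dif_pos]
      exact (T.equivFin ⟨t, ht⟩).2
    have hbest : ∀ (Q : ι → ι → Prop), ∃ g : ι → ι, ∀ i ∈ T, (g i = i ∨ (g i ∈ T ∧ Q i (g i))) ∧
        ∀ t ∈ T, Q i t → c {i, t} ≤ c {i, g i} := by
      intro Q
      have : ∀ i, ∃ u, i ∈ T → (u = i ∨ (u ∈ T ∧ Q i u)) ∧
          ∀ t ∈ T, Q i t → c {i, t} ≤ c {i, u} := by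
        intro i
        rcases (T.filter (Q i)).eq_empty_or_nonempty with h | h
        · refine ⟨i, fun _ => ⟨Or.inl rfl, fun t ht hQ => ?_⟩⟩
          exact absurd (mem_filter.2 ⟨ht, hQ⟩) (by rw [h]; simp)
        · obtain ⟨u, hu, hmax⟩ := exists_max_image _ (fun t => c {i, t}) h
          exact ⟨u, fun _ => ⟨Or.inr (mem_filter.1 hu),
            fun t ht hQ => hmax t (mem_filter.2 ⟨ht, hQ⟩)⟩⟩
      choose g hg using this
      exact ⟨g, hg⟩
    choose g hg using fun s => hbest (fun i t => rotRank e T.card s i < rotRank e T.card s t)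
    choose g' hg' using fun s => hbest (fun i t => rotRank e T.card s t < rotRank e T.card s i)
    have hvert : ∀ i ∈ T, ∑ s ∈ range T.card, (orderCost c Δ T (rotRank e T.card s) (g s) i +
        orderCost c Δ T (fun t => T.card - 1 - rotRank e T.card s t) (g' s) i) ≤
        κ * ((T.card : ℝ) - 1) := fun i hi =>
      sum_orderCost_rotations_le c hc hc1 Δ κ T i hi (h0 i) (hκ i) (hΔ i)
        (fun j hj hij => hgood i hi j hj hij) e heinj hem g g' (fun s => (hg s i hi).2)
        (fun s => (hg' s i hi).2)
    have htot : ∑ s ∈ range T.card, (∑ i ∈ T, orderCost c Δ T (rotRank e T.card s) (g s) i +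
        ∑ i ∈ T, orderCost c Δ T (fun t => T.card - 1 - rotRank e T.card s t) (g' s) i) ≤
        ∑ s ∈ range T.card, κ * ((T.card : ℝ) - 1) := by
      simp only [← sum_add_distrib]
      rw [sum_comm]
      refine (sum_le_sum hvert).trans ?_
      rw [sum_const, sum_const, card_range]
    obtain ⟨s, hs, hle⟩ := exists_le_of_sum_le (by simpa using hT.ne_empty) htot
    have hsm := mem_range.1 hs
    have hhalf : κ * ((T.card : ℝ) - 1) / 2 ≤ κ * ((m / 2 : ℕ) : ℝ) := by
      have h1 : T.card ≤ 2 * (m / 2) + 1 := by omega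
      have h2 : (T.card : ℝ) ≤ 2 * ((m / 2 : ℕ) : ℝ) + 1 := by exact_mod_cast h1
      have h3 := mul_le_mul_of_nonneg_left h2 hκ0
      generalize ((m / 2 : ℕ) : ℝ) = z at h3 ⊢
      linarith only [h3]
    have hrinj : Set.InjOn (rotRank e T.card s) T := by
      intro x hx y hy hxy
      have h1 := hem x hx
      have h2 := hem y hy
      refine heinj hx hy ?_
      unfold rotRank at hxy
      split_ifs at hxy <;> omega
    have hrlt : ∀ t ∈ T, rotRank e T.card s t < T.card := by
      intro t ht
      have h1 := hem t ht
      unfold rotRank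
      split_ifs <;> omega
    rcases le_total (∑ i ∈ T, orderCost c Δ T (rotRank e T.card s) (g s) i)
      (∑ i ∈ T, orderCost c Δ T (fun t => T.card - 1 - rotRank e T.card s t) (g' s) i) with h | h
    · refine ⟨_, g s, hrinj, ?_, le_trans (by linarith only [h, hle]) hhalf⟩
      intro i hi
      rcases (hg s i hi).1 with h1 | h1
      · rw [h1]; exact ⟨le_rfl, hi⟩
      · exact ⟨h1.2.le, h1.1⟩
    · refine ⟨fun t => T.card - 1 - rotRank e T.card s t, g' s, ?_, ?_,
        le_trans (by linarith only [h, hle]) hhalf⟩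
      · intro x hx y hy hxy
        have h1 := hrlt x hx
        have h2 := hrlt y hy
        refine hrinj hx hy ?_
        simp only at hxy
        omega
      · intro i hi
        rcases (hg' s i hi).1 with h1 | h1
        · rw [h1]; exact ⟨le_rfl, hi⟩
        · refine ⟨?_, h1.1⟩
          have := h1.2
          change T.card - 1 - _ ≤ T.card - 1 - _
          omega

/-! ### Weights of spaced frequencies, and sums over tuples -/

theorem card_le_of_spaced (V : Finset ℝ) {η a l : ℝ} (hη : 0 < η) (hl : 0 ≤ l)
    (hV : ∀ v ∈ V, a ≤ v ∧ v ≤ a + l)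
    (hsp : ∀ v ∈ V, ∀ w ∈ V, v ≠ w → η ≤ |v - w|) : (V.card : ℝ) ≤ l / η + 1 := by
  have h1 : V.card ≤ (range (⌊l / η⌋₊ + 1)).card := by
    refine card_le_card_of_injOn (fun v => ⌊(v - a) / η⌋₊) ?_ ?_
    · intro v hv
      obtain ⟨h1, h2⟩ := hV v hv
      rw [mem_coe, mem_range, Nat.lt_succ_iff]
      refine Nat.floor_le_floor ?_
      gcongr
      linarith
    · intro v hv w hw hvw
      by_contra hne
      have h3 := hsp v hv w hw hne
      have hv0 : 0 ≤ (v - a) / η := div_nonneg (by linarith [(hV v hv).1]) hη.le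
      have hw0 : 0 ≤ (w - a) / η := div_nonneg (by linarith [(hV w hw).1]) hη.le
      have e1 := Nat.floor_le hv0
      have e2 := Nat.lt_floor_add_one ((v - a) / η)
      have e3 := Nat.floor_le hw0
      have e4 := Nat.lt_floor_add_one ((w - a) / η)
      simp only at hvw
      rw [hvw] at e1 e2
      have h4 : |(v - a) / η - (w - a) / η| < 1 := by
        rw [abs_lt]; constructor <;> linarith
      rw [← sub_div, abs_div, abs_of_pos hη, div_lt_one hη] at h4
      have : v - a - (w - a) = v - w := by ring
      rw [this] at h4
      linarith
  rw [card_range] at h1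
  have h2 : (V.card : ℝ) ≤ (⌊l / η⌋₊ : ℝ) + 1 := by exact_mod_cast h1
  have h3 := Nat.floor_le (div_nonneg hl hη.le)
  linarith

/-- The bound `min (2 ^ K) (1 / ‖v‖)` for the modulus of an exponential sum of length at most
`2 ^ K` at the frequency `v` in `(0, 1)`, where `‖v‖` is the distance to the nearest integer. -/
noncomputable def peak (K : ℕ) (v : ℝ) : ℝ := min (2 ^ K) (1 / |min v (1 - v)|)

theorem peak_nonneg (K : ℕ) (v : ℝ) : 0 ≤ peak K v := by
  unfold peak
  positivity

/-- A dyadic decomposition according to the distance to the nearest integer. -/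
theorem sum_peak_le_of_spaced (K : ℕ) (V : Finset ℝ) {η H : ℝ} (hη : 0 < η) (hH : 0 ≤ H)
    (hV : ∀ v ∈ V, 0 < v ∧ v < 1) (hVH : ∀ v ∈ V, peak K v ≤ H)
    (hsp : ∀ v ∈ V, ∀ w ∈ V, v ≠ w → η ≤ |v - w|) :
    ∑ v ∈ V, peak K v ≤ (K + 1) * (2 * H + 4 / η) := by
  classical
  have hlevel : ∀ v ∈ V, ∃ j ∈ range (K + 1), min v (1 - v) ≤ 2 ^ j / 2 ^ K ∧
      peak K v ≤ 2 ^ (K + 1) / 2 ^ j := by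
    intro v hv
    obtain ⟨h0, h1⟩ := hV v hv
    have hd : 0 < min v (1 - v) := lt_min h0 (by linarith)
    have hex : ∃ j : ℕ, min v (1 - v) ≤ 2 ^ j / 2 ^ K := by
      refine ⟨K, ?_⟩
      rw [div_self (by positivity)]
      exact (min_le_left _ _).trans h1.le
    refine ⟨Nat.find hex, ?_, Nat.find_spec hex, ?_⟩
    · rw [mem_range, Nat.lt_succ_iff]
      refine Nat.find_min' hex ?_
      rw [div_self (by positivity)]
      exact (min_le_left _ _).trans h1.le
    · rcases Nat.eq_zero_or_pos (Nat.find hex) with h | h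
      · rw [h, pow_zero, div_one]
        refine (min_le_left _ _).trans ?_
        exact pow_le_pow_right₀ (by norm_num) (by omega)
      · have hm := Nat.find_min hex (m := Nat.find hex - 1) (by omega)
        push Not at hm
        refine (min_le_right _ _).trans ?_
        rw [abs_of_pos hd, div_le_div_iff₀ hd (by positivity), one_mul]
        rw [div_lt_iff₀ (by positivity)] at hm
        have : (2 : ℝ) ^ (Nat.find hex) = 2 * 2 ^ (Nat.find hex - 1) := by
          rw [← pow_succ']; congr 1; omega
        rw [this, pow_succ']
        nlinarith
  choose! lev hlev1 hlev2 hlev3 using hlevel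
  have hcard : ∀ j ∈ range (K + 1), ∑ v ∈ V with lev v = j, peak K v ≤ 2 * H + 4 / η := by
    intro j _
    set W := V.filter (fun v => lev v = j) with hW
    have hW1 : ((W.filter (fun v => v ≤ 2 ^ j / 2 ^ K)).card : ℝ) ≤ (2 ^ j / 2 ^ K) / η + 1 := by
      refine card_le_of_spaced _ hη (a := 0) (by positivity) ?_ ?_
      · intro v hv
        obtain ⟨hv1, hv2⟩ := mem_filter.1 hv
        rw [zero_add]
        exact ⟨(hV v (mem_filter.1 hv1).1).1.le, hv2⟩
      · intro v hv w hw hvw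
        exact hsp v (mem_filter.1 (mem_filter.1 hv).1).1 w (mem_filter.1 (mem_filter.1 hw).1).1 hvw
    have hW2 : ((W.filter (fun v => ¬ v ≤ 2 ^ j / 2 ^ K)).card : ℝ) ≤
        (2 ^ j / 2 ^ K) / η + 1 := by
      refine card_le_of_spaced _ hη (a := 1 - 2 ^ j / 2 ^ K) (by positivity) ?_ ?_
      · intro v hv
        obtain ⟨hv1, hv2⟩ := mem_filter.1 hv
        obtain ⟨hv3, hv4⟩ := mem_filter.1 hv1
        have h1 := hlev2 v hv3
        rw [hv4] at h1
        have h2 := (hV v hv3).2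
        rcases min_choice v (1 - v) with h | h
        · rw [h] at h1; exact absurd h1 hv2
        · rw [h] at h1
          constructor <;> linarith
      · intro v hv w hw hvw
        exact hsp v (mem_filter.1 (mem_filter.1 hv).1).1 w (mem_filter.1 (mem_filter.1 hw).1).1 hvw
    have hWc : (W.card : ℝ) ≤ 2 * ((2 ^ j / 2 ^ K) / η) + 2 := by
      rw [← card_filter_add_card_filter_not (s := W) (fun v => v ≤ 2 ^ j / 2 ^ K)]
      push_cast
      linarith
    have hmin : ∀ v ∈ W, peak K v ≤ min H (2 ^ (K + 1) / 2 ^ j) := by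
      intro v hv
      obtain ⟨hv3, hv4⟩ := mem_filter.1 hv
      refine le_min (hVH v hv3) ?_
      have := hlev3 v hv3
      rwa [hv4] at this
    have hm0 : 0 ≤ min H ((2 : ℝ) ^ (K + 1) / 2 ^ j) := le_min hH (by positivity)
    calc ∑ v ∈ W, peak K v ≤ W.card • min H ((2 : ℝ) ^ (K + 1) / 2 ^ j) :=
          sum_le_card_nsmul _ _ _ hmin
      _ = W.card * min H ((2 : ℝ) ^ (K + 1) / 2 ^ j) := by rw [nsmul_eq_mul]
      _ ≤ (2 * ((2 ^ j / 2 ^ K) / η) + 2) * min H ((2 : ℝ) ^ (K + 1) / 2 ^ j) := by gcongr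
      _ = 2 * ((2 ^ j / 2 ^ K) / η) * min H ((2 : ℝ) ^ (K + 1) / 2 ^ j) +
          2 * min H ((2 : ℝ) ^ (K + 1) / 2 ^ j) := by ring
      _ ≤ 2 * ((2 ^ j / 2 ^ K) / η) * ((2 : ℝ) ^ (K + 1) / 2 ^ j) + 2 * H := by
          gcongr
          · exact min_le_right _ _
          · exact min_le_left _ _
      _ = 2 * H + 4 / η := by
          rw [pow_succ]; field_simp; ring
  rw [← sum_fiberwise_of_maps_to hlev1]
  refine (sum_le_sum hcard).trans ?_
  rw [sum_const, card_range, nsmul_eq_mul]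
  push_cast
  exact le_rfl

/-- A sum over tuples, evaluated coordinate by coordinate in the order of the rank `r`: it suffices
to bound the sum over the possible values of each coordinate when all earlier coordinates are
fixed. -/
theorem sum_prod_le_of_prefix {ι α : Type*} [DecidableEq ι] [DecidableEq α] (r : ι → ℕ)
    (w : α → ℝ) (hw : ∀ a, 0 ≤ w a) (B : ι → ℝ) (hB : ∀ i, 0 ≤ B i) (a0 : α) (T : Finset ι)
    (hr : Set.InjOn r T) (X : Finset (ι → α)) (hX : ∀ x ∈ X, ∀ i ∉ T, x i = a0)
    (h : ∀ i ∈ T, ∀ Y ⊆ X, (∀ x ∈ Y, ∀ y ∈ Y, ∀ j, r j < r i → x j = y j) →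
      ∑ v ∈ Y.image (fun x => x i), w v ≤ B i) :
    ∑ x ∈ X, ∏ i ∈ T, w (x i) ≤ ∏ i ∈ T, B i := by
  classical
  replace h : ∀ i ∈ T, ∀ Y ⊆ X, (∀ x ∈ Y, ∀ y ∈ Y, ∀ j ∈ T, r j < r i → x j = y j) →
      ∑ v ∈ Y.image (fun x => x i), w v ≤ B i := by
    intro i hi Y hY hYY
    refine h i hi Y hY fun x hx y hy j hj => ?_
    by_cases hjT : j ∈ T
    · exact hYY x hx y hy j hjT hj
    · rw [hX x (hY hx) j hjT, hX y (hY hy) j hjT]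
  induction T using Finset.induction_on_max_value r generalizing X with
  | empty =>
    simp only [prod_empty, sum_const, nsmul_eq_mul, mul_one]
    have : X.card ≤ 1 := by
      rw [card_le_one]
      intro x hx y hy
      funext i
      rw [hX x hx i (by simp), hX y hy i (by simp)]
    exact_mod_cast this
  | insert a s has hmax ih =>
    have hlt : ∀ x ∈ s, r x < r a := by
      intro x hx
      refine lt_of_le_of_ne (hmax x hx) fun he => ?_
      have := hr (mem_insert_of_mem hx) (mem_insert_self a s) he
      exact has (this ▸ hx)
    set u : (ι → α) → ι → α := fun x => Function.update x a a0 with hu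
    have hus : ∀ x, ∀ i ∈ s, u x i = x i := by
      intro x i hi
      rw [hu]
      exact Function.update_of_ne (by rintro rfl; exact has hi) _ _
    set X' := X.image u with hX'
    have hfib : ∀ y ∈ X', ∑ x ∈ X with u x = y, ∏ i ∈ insert a s, w (x i) ≤
        (∏ i ∈ s, w (y i)) * B a := by
      intro y _
      have h1 : ∀ x ∈ X.filter (fun x => u x = y), ∏ i ∈ insert a s, w (x i) =
          (∏ i ∈ s, w (y i)) * w (x a) := by
        intro x hx
        have hxy := (mem_filter.1 hx).2
        rw [prod_insert has, mul_comm]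
        congr 1
        refine prod_congr rfl fun i hi => ?_
        rw [← hxy, hus x i hi]
      rw [sum_congr rfl h1, ← mul_sum]
      refine mul_le_mul_of_nonneg_left ?_ (prod_nonneg fun i _ => hw _)
      have hinj : Set.InjOn (fun x : ι → α => x a) (X.filter (fun x => u x = y)) := by
        intro x hx z hz hxz
        have hx' := (mem_filter.1 (mem_coe.1 hx)).2
        have hz' := (mem_filter.1 (mem_coe.1 hz)).2
        funext i
        by_cases hi : i = a
        · rw [hi]; exact hxz
        · have e1 : u x i = x i := Function.update_of_ne hi _ _
          have e2 : u z i = z i := Function.update_of_ne hi _ _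
          rw [← e1, ← e2, hx', hz']
      have := h a (mem_insert_self a s) (X.filter (fun x => u x = y)) (filter_subset _ _) ?_
      · rwa [sum_image hinj] at this
      · intro x hx z hz j hj hjr
        have hja : j ≠ a := by rintro rfl; omega
        have hx' := (mem_filter.1 hx).2
        have hz' := (mem_filter.1 hz).2
        have e1 : u x j = x j := Function.update_of_ne hja _ _
        have e2 : u z j = z j := Function.update_of_ne hja _ _
        rw [← e1, ← e2, hx', hz']
    have hih := ih (hr.mono (by simp)) X' ?_ ?_
    · rw [← sum_fiberwise_of_maps_to (g := u) (t := X') (fun x hx => mem_image_of_mem u hx)]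
      refine (sum_le_sum hfib).trans ?_
      rw [← sum_mul, prod_insert has, mul_comm (B a)]
      exact mul_le_mul_of_nonneg_right hih (hB a)
    · intro x hx i hi
      obtain ⟨z, hz, rfl⟩ := mem_image.1 hx
      by_cases hia : i = a
      · rw [hia, hu]; simp
      · have e1 : u z i = z i := Function.update_of_ne hia _ _
        rw [e1]
        exact hX z hz i (by simp [hia, hi])
    · intro i hi Y' hY' hagree
      refine le_trans ?_ (h i (mem_insert_of_mem hi) (X.filter (fun x => u x ∈ Y'))
        (filter_subset _ _) ?_)
      · refine sum_le_sum_of_subset_of_nonneg ?_ fun _ _ _ => hw _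
        intro v hv
        obtain ⟨y, hy, rfl⟩ := mem_image.1 hv
        obtain ⟨x, hx, rfl⟩ := mem_image.1 (hY' hy)
        exact mem_image.2 ⟨x, mem_filter.2 ⟨hx, hy⟩, (hus x i hi).symm⟩
      · intro x hx z hz j hj hjr
        rcases mem_insert.1 hj with rfl | hjs
        · have := hlt i hi
          omega
        · rw [← hus x j hjs, ← hus z j hjs]
          exact hagree _ (mem_filter.1 hx).2 _ (mem_filter.1 hz).2 j hjs hjr

/-! ### Denominators of tuples of fractions with integral sum -/

/-- The fractions `b / q` with `0 < b < q`. -/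
def properFractions (q : ℕ) : Finset ℚ := (Ico 1 q).image fun b : ℕ => (b : ℚ) / q

theorem mem_properFractions {q : ℕ} {v : ℚ} (hv : v ∈ properFractions q) :
    0 < v ∧ v < 1 ∧ v.den ∣ q := by
  obtain ⟨b, hb, rfl⟩ := mem_image.1 hv
  obtain ⟨h1, h2⟩ := mem_Ico.1 hb
  have hb' : (0 : ℚ) < b := by exact_mod_cast h1
  have hq' : (0 : ℚ) < q := by exact_mod_cast (by omega : 0 < q)
  refine ⟨by positivity, ?_, ?_⟩
  · rw [div_lt_one hq']; exact_mod_cast h2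
  · have := Rat.den_dvd (b : ℤ) (q : ℤ)
    rw [Rat.divInt_eq_div, Int.cast_natCast, Int.cast_natCast] at this
    exact Int.natCast_dvd_natCast.1 this

/-- The weight of the frequency `v` in the moment expansion. -/
noncomputable def freqWeight (K : ℕ) (v : ℚ) : ℝ := peak K v / v.den

theorem freqWeight_nonneg (K : ℕ) (v : ℚ) : 0 ≤ freqWeight K v :=
  div_nonneg (peak_nonneg K _) (Nat.cast_nonneg _)

theorem inv_den_le_of_pos {v : ℚ} (h : 0 < v) : (1 : ℝ) / v.den ≤ v := by
  have h1 : 1 ≤ v.num := Rat.num_pos.2 h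
  have h2 : (v : ℝ) = v.num / v.den := Rat.cast_def v
  rw [h2]
  gcongr
  exact_mod_cast h1

theorem peak_le_den (K : ℕ) {v : ℚ} (h0 : 0 < v) (h1 : v < 1) : peak K v ≤ v.den := by
  have hd : (0 : ℝ) < v.den := by exact_mod_cast v.den_pos
  have e1 := inv_den_le_of_pos h0
  have e2 := inv_den_le_of_pos (v := 1 - v) (by linarith)
  have e3 : (1 - v).den = v.den := by
    have := Rat.intCast_sub_den 1 v
    exact_mod_cast this
  rw [e3] at e2
  push_cast at e2
  have hm : (1 : ℝ) / v.den ≤ min (v : ℝ) (1 - v) := le_min e1 e2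
  have hpos : (0 : ℝ) < min (v : ℝ) (1 - v) := lt_of_lt_of_le (by positivity) hm
  refine (min_le_right _ _).trans ?_
  rw [abs_of_pos hpos, div_le_iff₀ hpos]
  rw [div_le_iff₀ hd] at hm
  linarith

/-- Total weight of a spaced set of frequencies whose denominators are `g * x * z` with `2 ^ n ≤ g
< 2 ^ (n + 1)`. -/
theorem sum_freqWeight_le (K : ℕ) (V : Finset ℚ) (n x z : ℕ) (hx : 0 < x) (hz : 0 < z)
    (hV : ∀ v ∈ V, 0 < v ∧ v < 1) (hden : ∀ v ∈ V, ∃ g : ℕ, v.den = g * x * z ∧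
      2 ^ n ≤ g ∧ g < 2 ^ (n + 1))
    (hsp : ∀ v ∈ V, ∀ w ∈ V, v ≠ w → (1 : ℝ) / (4 ^ (n + 1) * z) ≤ |(v : ℝ) - w|) :
    ∑ v ∈ V, freqWeight K v ≤
      (K + 1) * (2 ^ n / x) * (2 * min ((2 : ℝ) ^ K) (2 ^ (n + 1) * x * z) / (4 ^ n * z) + 16) := by
  have hx' : (0 : ℝ) < x := by exact_mod_cast hx
  have hz' : (0 : ℝ) < z := by exact_mod_cast hz
  set H : ℝ := min (2 ^ K) (2 ^ (n + 1) * x * z) with hH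
  have hH0 : 0 ≤ H := by positivity
  have hpk : ∀ v ∈ V, peak K v ≤ H := by
    intro v hv
    refine le_min (min_le_left _ _) ((peak_le_den K (hV v hv).1 (hV v hv).2).trans ?_)
    obtain ⟨g, hg, -, hg2⟩ := hden v hv
    rw [hg]
    push_cast
    have : (g : ℝ) ≤ 2 ^ (n + 1) := by exact_mod_cast hg2.le
    gcongr
  have hsum : ∑ v ∈ V, peak K v ≤ (K + 1) * (2 * H + 4 / (1 / (4 ^ (n + 1) * z))) := by
    have := sum_peak_le_of_spaced K (V.image (fun v : ℚ => (v : ℝ)))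
      (η := 1 / (4 ^ (n + 1) * z)) (H := H) (by positivity) hH0 ?_ ?_ ?_
    · rwa [sum_image (fun v _ w _ h => by exact_mod_cast h)] at this
    · intro v hv
      obtain ⟨u, hu, rfl⟩ := mem_image.1 hv
      exact_mod_cast hV u hu
    · intro v hv
      obtain ⟨u, hu, rfl⟩ := mem_image.1 hv
      exact hpk u hu
    · intro v hv w hw hvw
      obtain ⟨u, hu, rfl⟩ := mem_image.1 hv
      obtain ⟨u', hu', rfl⟩ := mem_image.1 hw
      exact hsp u hu u' hu' (fun h => hvw (by rw [h]))
  have hterm : ∀ v ∈ V, freqWeight K v ≤ (1 / (2 ^ n * x * z)) * peak K v := by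
    intro v hv
    obtain ⟨g, hg, hg1, -⟩ := hden v hv
    have hg' : (2 : ℝ) ^ n ≤ g := by exact_mod_cast hg1
    unfold freqWeight
    rw [hg, div_eq_inv_mul, ← one_div]
    push_cast
    have := peak_nonneg K (v : ℝ)
    gcongr
  refine (sum_le_sum hterm).trans ?_
  rw [← mul_sum]
  calc _ ≤ (1 / (2 ^ n * x * z)) * ((K + 1) * (2 * H + 4 / (1 / (4 ^ (n + 1) * z)))) := by
        gcongr
    _ = (K + 1) * (2 ^ n / x) * (2 * H / (4 ^ n * z) + 16) := by
        have h4 : (4 : ℝ) ^ n = 2 ^ n * 2 ^ n := by rw [← mul_pow]; norm_num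
        rw [pow_succ, h4]
        field_simp
        ring

/-- The product of the primes `p` dividing `q` for which `J` is the set of the indices `i` such
that `p` divides the denominator of `θ i`. -/
def denPart {ι : Type*} [Fintype ι] [DecidableEq ι] (q : ℕ) (θ : ι → ℚ) (J : Finset ι) : ℕ :=
  ∏ p ∈ q.primeFactors with univ.filter (fun i => p ∣ (θ i).den) = J, p

section denPart

variable {ι : Type*} [Fintype ι] [DecidableEq ι] {q : ℕ} {θ : ι → ℚ}

theorem denPart_pos (q : ℕ) (θ : ι → ℚ) (J : Finset ι) : 0 < denPart q θ J :=
  prod_pos fun _ hp => (Nat.prime_of_mem_primeFactors (mem_filter.1 hp).1).pos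

theorem denPart_dvd (hq : Squarefree q) (J : Finset ι) : denPart q θ J ∣ q := by
  conv_rhs => rw [← Nat.prod_primeFactors_of_squarefree hq]
  exact prod_dvd_prod_of_subset _ _ _ (filter_subset _ _)

theorem denPart_eq_of_prime_dvd {p : ℕ} (hp : p.Prime) {J : Finset ι}
    (h : p ∣ denPart q θ J) : univ.filter (fun i => p ∣ (θ i).den) = J := by
  obtain ⟨p', hp', hd⟩ := (hp.prime.dvd_finsetProd_iff _).1 h
  obtain ⟨h1, h2⟩ := mem_filter.1 hp'
  rwa [← (Nat.prime_dvd_prime_iff_eq hp (Nat.prime_of_mem_primeFactors h1)).1 hd] at h2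

theorem den_eq_prod_denPart (hq : Squarefree q) (i : ι) (hi : (θ i).den ∣ q) :
    (θ i).den = ∏ J with i ∈ J, denPart q θ J := by
  have hsq : Squarefree (θ i).den := hq.squarefree_of_dvd hi
  have h1 : (θ i).den.primeFactors = q.primeFactors.filter (fun p => p ∣ (θ i).den) := by
    ext p
    simp only [Nat.mem_primeFactors, mem_filter]
    constructor
    · rintro ⟨h1, h2, -⟩
      exact ⟨⟨h1, h2.trans hi, hq.ne_zero⟩, h2⟩
    · rintro ⟨⟨h1, -, -⟩, h2⟩
      exact ⟨h1, h2, (θ i).den_nz⟩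
  conv_lhs => rw [← Nat.prod_primeFactors_of_squarefree hsq, h1]
  unfold denPart
  rw [← prod_fiberwise_of_maps_to (t := univ.filter (fun J : Finset ι => i ∈ J))
    (g := fun p => univ.filter (fun i => p ∣ (θ i).den))]
  · refine prod_congr rfl fun J hJ => ?_
    rw [filter_filter]
    refine prod_congr (filter_congr fun p _ => ?_) fun _ _ => rfl
    constructor
    · rintro ⟨-, h⟩; exact h
    · intro h
      refine ⟨?_, h⟩
      have : i ∈ univ.filter (fun i => p ∣ (θ i).den) := h ▸ (mem_filter.1 hJ).2
      exact (mem_filter.1 this).2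
  · intro p hp
    simpa using (mem_filter.1 hp).2

end denPart

theorem not_dvd_den_add {p : ℕ} (hp : p.Prime) {a b : ℚ} (ha : ¬ p ∣ a.den) (hb : ¬ p ∣ b.den) :
    ¬ p ∣ (a + b).den := fun h =>
  ((hp.dvd_mul.1 (h.trans (Rat.add_den_dvd a b))).elim ha hb)

theorem not_dvd_den_sum {p : ℕ} (hp : p.Prime) {ι : Type*} (s : Finset ι) (u : ι → ℚ)
    (h : ∀ i ∈ s, ¬ p ∣ (u i).den) : ¬ p ∣ (∑ i ∈ s, u i).den := by
  classical
  induction s using Finset.induction_on with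
  | empty => simpa using hp.one_lt.ne'
  | insert a s ha ih =>
    rw [sum_insert ha]
    exact not_dvd_den_add hp (h a (mem_insert_self a s))
      (ih fun i hi => h i (mem_insert_of_mem hi))

theorem not_dvd_den_of_sum {p : ℕ} (hp : p.Prime) {ι : Type*} [Fintype ι] [DecidableEq ι]
    (u : ι → ℚ) (hu : ¬ p ∣ (∑ i, u i).den) (i : ι) (h : ∀ j, j ≠ i → ¬ p ∣ (u j).den) :
    ¬ p ∣ (u i).den := by
  have h1 : u i = ∑ j, u j + ∑ j ∈ univ.erase i, -u j := by
    rw [← add_sum_erase _ _ (mem_univ i), sum_neg_distrib]; ring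
  rw [h1]
  refine not_dvd_den_add hp hu (not_dvd_den_sum hp _ _ fun j hj => ?_)
  rw [Rat.neg_den]
  exact h j (mem_erase.1 hj).1

/-- The tuples of fractions with denominator dividing `q` whose sum is an integer. -/
def integralTuples (ι : Type*) [Fintype ι] [DecidableEq ι] (q : ℕ) : Finset (ι → ℚ) :=
  (Fintype.piFinset fun _ => properFractions q).filter fun θ => (∑ i, θ i).den = 1

section integralTuples

variable {ι : Type*} [Fintype ι] [DecidableEq ι] {q : ℕ} {θ θ' : ι → ℚ}

theorem mem_integralTuples (hθ : θ ∈ integralTuples ι q) :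
    (∀ i, 0 < θ i ∧ θ i < 1 ∧ (θ i).den ∣ q) ∧ (∑ i, θ i).den = 1 := by
  obtain ⟨h1, h2⟩ := mem_filter.1 hθ
  exact ⟨fun i => mem_properFractions (Fintype.mem_piFinset.1 h1 i), h2⟩

/-- A prime cannot divide exactly one of the denominators of fractions with integral sum. -/
theorem denPart_singleton (hθ : θ ∈ integralTuples ι q) (i : ι) : denPart q θ {i} = 1 := by
  by_contra hne
  obtain ⟨p, hp, hpd⟩ := Nat.exists_prime_and_dvd hne
  have h := denPart_eq_of_prime_dvd hp hpd
  have hmem : ∀ j, p ∣ (θ j).den ↔ j = i := by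
    intro j
    have : j ∈ univ.filter (fun i => p ∣ (θ i).den) ↔ j ∈ ({i} : Finset ι) := by rw [h]
    simpa using this
  refine not_dvd_den_of_sum hp θ ?_ i (fun j hj hd => hj ((hmem j).1 hd)) ((hmem i).2 rfl)
  rw [(mem_integralTuples hθ).2]
  exact fun hd => hp.one_lt.ne' (Nat.dvd_one.1 hd)

/-- Let two tuples agree in all coordinates except `i` and those in `later`. The difference of
their `i`-th coordinates is, up to integers, a sum of differences over `later`, so no prime factor
of `x` divides its denominator; the factor `x` is therefore saved in the spacing. -/
theorem spacing_of_agree (hθ : θ ∈ integralTuples ι q) (hθ' : θ' ∈ integralTuples ι q)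
    (i : ι) (later : Finset ι) (hagree : ∀ j, j ∉ later → j ≠ i → θ j = θ' j)
    (g g' x z : ℕ) (hg : (θ i).den = g * x * z) (hg' : (θ' i).den = g' * x * z)
    (hx : ∀ p, p.Prime → p ∣ x → ∀ j ∈ later, ¬ p ∣ (θ j).den ∧ ¬ p ∣ (θ' j).den)
    (hne : θ i ≠ θ' i) :
    (1 : ℝ) / (g * g' * z) ≤ |(θ i : ℝ) - θ' i| := by
  have hcop : Nat.Coprime (θ i - θ' i).den x := by
    rw [Nat.coprime_iff_gcd_eq_one]
    by_contra hne1
    obtain ⟨p, hp, hpd⟩ := Nat.exists_prime_and_dvd hne1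
    have hpx := hpd.trans (Nat.gcd_dvd_right _ _)
    refine not_dvd_den_of_sum hp (fun j => θ j - θ' j) ?_ i ?_ (hpd.trans (Nat.gcd_dvd_left _ _))
    · rw [sum_sub_distrib, sub_eq_add_neg]
      refine not_dvd_den_add hp ?_ ?_
      · rw [(mem_integralTuples hθ).2]
        exact fun hd => hp.one_lt.ne' (Nat.dvd_one.1 hd)
      · rw [Rat.neg_den, (mem_integralTuples hθ').2]
        exact fun hd => hp.one_lt.ne' (Nat.dvd_one.1 hd)
    · intro j hj
      by_cases hjl : j ∈ later
      · obtain ⟨h1, h2⟩ := hx p hp hpx j hjl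
        simp only [sub_eq_add_neg]
        refine not_dvd_den_add hp h1 ?_
        rwa [Rat.neg_den]
      · simp only [hagree j hjl hj, sub_self]
        exact fun hd => hp.one_lt.ne' (Nat.dvd_one.1 hd)
  have hpos : 0 < g * x * z := hg ▸ (θ i).den_pos
  have hpos' : 0 < g' * x * z := hg' ▸ (θ' i).den_pos
  have hg0 : 0 < g := Nat.pos_of_ne_zero (by rintro rfl; simp at hpos)
  have hg0' : 0 < g' := Nat.pos_of_ne_zero (by rintro rfl; simp at hpos')
  have hx0 : 0 < x := Nat.pos_of_ne_zero (by rintro rfl; simp at hpos)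
  have hz0 : 0 < z := Nat.pos_of_ne_zero (by rintro rfl; simp at hpos)
  have hdvd : (θ i - θ' i).den ∣ g * g' * z * x := by
    have h1 : θ i - θ' i = (((θ i).num * g' - (θ' i).num * g : ℤ) : ℚ) /
        ((g * g' * z * x : ℕ) : ℤ) := by
      have e1 := Rat.num_div_den (θ i)
      have e2 := Rat.num_div_den (θ' i)
      rw [hg] at e1
      rw [hg'] at e2
      have q1 : (g : ℚ) ≠ 0 := by exact_mod_cast hg0.ne'
      have q2 : (g' : ℚ) ≠ 0 := by exact_mod_cast hg0'.ne'
      have q3 : (x : ℚ) ≠ 0 := by exact_mod_cast hx0.ne'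
      have q4 : (z : ℚ) ≠ 0 := by exact_mod_cast hz0.ne'
      conv_lhs => rw [← e1, ← e2]
      push_cast
      field_simp
    have := Rat.den_dvd ((θ i).num * g' - (θ' i).num * g) ((g * g' * z * x : ℕ) : ℤ)
    rw [Rat.divInt_eq_div, ← h1] at this
    exact Int.natCast_dvd_natCast.1 this
  have hdvd2 : (θ i - θ' i).den ∣ g * g' * z := hcop.dvd_of_dvd_mul_right hdvd
  have hle : ((θ i - θ' i).den : ℝ) ≤ g * g' * z := by
    exact_mod_cast Nat.le_of_dvd (by positivity) hdvd2
  have hd0 : (0 : ℝ) < (θ i - θ' i).den := by exact_mod_cast (θ i - θ' i).den_pos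
  have habs : (1 : ℝ) / (θ i - θ' i).den ≤ |(θ i : ℝ) - θ' i| := by
    have hsub : (θ i : ℝ) - θ' i = ((θ i - θ' i).num : ℝ) / (θ i - θ' i).den := by
      rw [← Rat.cast_def]; push_cast; ring
    rw [hsub, abs_div, abs_of_pos hd0]
    gcongr
    have : 1 ≤ |(θ i - θ' i).num| := Int.one_le_abs (Rat.num_ne_zero.2 (sub_ne_zero.2 hne))
    exact_mod_cast this
  refine le_trans ?_ habs
  gcongr

end integralTuples

/-! ### One coordinate, with all earlier coordinates fixed -/

/-- The dyadic size of `denPart q θ J`, capped at `K`. -/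
def denClass {ι : Type*} [Fintype ι] [DecidableEq ι] (K q : ℕ) (θ : ι → ℚ) (J : Finset ι) : ℕ :=
  min K (Nat.log 2 (denPart q θ J))

theorem chosenPair_injective {ι : Type*} [DecidableEq ι] {r : ι → ℕ} {f : ι → ι}
    (hr : Function.Injective r) (hf : ∀ i, r i ≤ r (f i)) :
    Function.Injective fun i => ({i, f i} : Finset ι) := by
  have key : ∀ i j, ({i, f i} : Finset ι) = {j, f j} → r j ≤ r i := by
    intro i j h
    have : i ∈ ({j, f j} : Finset ι) := h ▸ mem_insert_self _ _
    rcases mem_insert.1 this with h | h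
    · rw [h]
    · rw [mem_singleton.1 h]; exact hf j
  intro i j h
  exact hr (le_antisymm (key j i h.symm) (key i j h))

section ordered

variable {ι : Type*} [Fintype ι] [DecidableEq ι] {q : ℕ} {r : ι → ℕ} {f : ι → ι}

/-- Once the parts attached to the sets that are not chosen pairs are fixed, the coordinates up to
an element `l` determine the part attached to its chosen pair `{l, f l}`, as the quotient of the
denominator of the `l`-th coordinate by its other parts. -/
theorem denPart_eq_of_agree (hq : Squarefree q) (hr : Function.Injective r)
    (hf : ∀ i, r i ≤ r (f i)) {y y' : ι → ℚ} (hy : y ∈ integralTuples ι q)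
    (hy' : y' ∈ integralTuples ι q)
    (hkey : ∀ J : Finset ι, J.Nonempty → (∀ i, J ≠ {i, f i}) → denPart q y J = denPart q y' J)
    (i : ι) (hagree : ∀ j, r j < r i → y j = y' j) (J : Finset ι) (hiJ : i ∈ J)
    (hJ : J ≠ {i, f i}) : denPart q y J = denPart q y' J := by
  induction hn : r i using Nat.strong_induction_on generalizing i J with
  | _ n ih =>
  by_cases hch : ∀ l, J ≠ {l, f l}
  · exact hkey J ⟨i, hiJ⟩ hch
  push Not at hch
  obtain ⟨l, rfl⟩ := hch
  have hli : l ≠ i := by rintro rfl; exact hJ rfl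
  have hil : i = f l := by
    rcases mem_insert.1 hiJ with h | h
    · exact absurd h.symm hli
    · exact mem_singleton.1 h
  have hrl : r l < r i := lt_of_le_of_ne (hil ▸ hf l) fun h => hli (hr h)
  have hothers := ih (r l) (by omega) l (fun j hj => hagree j (by omega))
  have hmem : ({l, f l} : Finset ι) ∈ univ.filter (fun J : Finset ι => l ∈ J) := by simp
  have e1 := den_eq_prod_denPart hq l ((mem_integralTuples hy).1 l).2.2
  have e2 := den_eq_prod_denPart hq l ((mem_integralTuples hy').1 l).2.2
  rw [hagree l hrl, e2, ← mul_prod_erase _ _ hmem, ← mul_prod_erase _ _ hmem] at e1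
  have e3 : ∏ J ∈ (univ.filter (fun J : Finset ι => l ∈ J)).erase {l, f l}, denPart q y J =
      ∏ J ∈ (univ.filter (fun J : Finset ι => l ∈ J)).erase {l, f l}, denPart q y' J := by
    refine prod_congr rfl fun J' hJ' => ?_
    obtain ⟨h1, h2⟩ := mem_erase.1 hJ'
    exact hothers J' (mem_filter.1 h2).2 h1 rfl
  rw [e3] at e1
  exact (Nat.eq_of_mul_eq_mul_right (prod_pos fun J _ => denPart_pos q y' J) e1).symm

/-- The sets through `i`, other than the pair chosen for `i`, all of whose elements come no later
than `i`. -/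
def closingSets (r : ι → ℕ) (f : ι → ι) (i : ι) : Finset (Finset ι) :=
  univ.filter fun J => i ∈ J ∧ J ≠ {i, f i} ∧ ∀ j ∈ J, r j ≤ r i

/-- The sets through `i`, other than the pair chosen for `i`, with an element later than `i`. -/
def openSets (r : ι → ℕ) (f : ι → ι) (i : ι) : Finset (Finset ι) :=
  univ.filter fun J => i ∈ J ∧ J ≠ {i, f i} ∧ ¬ ∀ j ∈ J, r j ≤ r i

theorem prod_through (r : ι → ℕ) (f : ι → ι) (i : ι) {M : Type*} [CommMonoid M]
    (g : Finset ι → M) : ∏ J with i ∈ J, g J =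
      g {i, f i} * (∏ J ∈ closingSets r f i, g J) * ∏ J ∈ openSets r f i, g J := by
  have hmem : ({i, f i} : Finset ι) ∈ univ.filter (fun J : Finset ι => i ∈ J) := by simp
  rw [← mul_prod_erase _ _ hmem, mul_assoc,
    ← prod_filter_mul_prod_filter_not _ (fun J => ∀ j ∈ J, r j ≤ r i)]
  congr 2
  · refine prod_congr ?_ fun _ _ => rfl
    ext J; simp only [closingSets, mem_filter, mem_erase, mem_univ, true_and]; tauto
  · refine prod_congr ?_ fun _ _ => rfl
    ext J; simp only [openSets, mem_filter, mem_erase, mem_univ, true_and]; tauto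

/-- The sum over one coordinate, all earlier ones being fixed. Its denominator is `g * x * z`,
where only the part `g` of the chosen pair varies, within a dyadic range, and `x` is the product
over the sets that close at `i`. The loss over the desired bound is governed by `orderCost`. -/
theorem sum_freqWeight_agree_le (hq : Squarefree q) (K : ℕ) (c : Finset ι → ℕ)
    (hr : Function.Injective r) (hf : ∀ i, r i ≤ r (f i)) (hcf : ∀ i, c {i, f i} < K ∨ f i = i)
    (i : ι) (hc1 : c {i} = 0)
    (Y : Finset (ι → ℚ)) (hY : ∀ y ∈ Y, y ∈ integralTuples ι q ∧ ∀ J, denClass K q y J = c J)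
    (hkey : ∀ y ∈ Y, ∀ y' ∈ Y, ∀ J : Finset ι, J.Nonempty → (∀ i, J ≠ {i, f i}) →
      denPart q y J = denPart q y' J)
    (hagree : ∀ y ∈ Y, ∀ y' ∈ Y, ∀ j, r j < r i → y j = y' j)
    (y₀ : ι → ℚ) (hy₀ : y₀ ∈ Y) :
    ∑ v ∈ Y.image (fun y => y i), freqWeight K v ≤
      (18 * 2 ^ Fintype.card (Finset ι) * (K + 1)) *
        2 ^ orderCost (fun J => (c J : ℝ)) (fun i => min (K : ℝ) (∑ J with i ∈ J, (c J : ℝ)))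
          univ r f i * 2 ^ c {i, f i} / ∏ J ∈ closingSets r f i, (denPart q y₀ J : ℝ) := by
  set N := Fintype.card (Finset ι) with hN
  set n := c {i, f i} with hn
  set x := ∏ J ∈ closingSets r f i, denPart q y₀ J with hx
  set z := ∏ J ∈ openSets r f i, denPart q y₀ J with hz
  have hx0 : 0 < x := prod_pos fun J _ => denPart_pos q y₀ J
  have hz0 : 0 < z := prod_pos fun J _ => denPart_pos q y₀ J
  have hsame : ∀ y ∈ Y, ∀ J : Finset ι, i ∈ J → J ≠ {i, f i} →
      denPart q y J = denPart q y₀ J := fun y hy J hiJ hJ =>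
    denPart_eq_of_agree hq hr hf (hY y hy).1 (hY y₀ hy₀).1 (hkey y hy y₀ hy₀) i
      (hagree y hy y₀ hy₀) J hiJ hJ
  have hlow : ∀ y ∈ Y, ∀ J, 2 ^ c J ≤ denPart q y J := by
    intro y hy J
    rw [← (hY y hy).2 J]
    exact (Nat.pow_le_pow_right (by norm_num) (min_le_right _ _)).trans
      (Nat.pow_log_le_self 2 (denPart_pos q y J).ne')
  have hup : ∀ y ∈ Y, ∀ J, c J < K → denPart q y J < 2 ^ (c J + 1) := by
    intro y hy J hJ
    have h := (hY y hy).2 J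
    unfold denClass at h
    have h2 : Nat.log 2 (denPart q y J) = c J := by
      rcases min_choice K (Nat.log 2 (denPart q y J)) with h' | h' <;> omega
    rw [← h2]
    exact Nat.lt_pow_succ_log_self (by norm_num) _
  have hden : ∀ y ∈ Y, (y i).den = denPart q y {i, f i} * x * z := by
    intro y hy
    rw [den_eq_prod_denPart hq i ((mem_integralTuples (hY y hy).1).1 i).2.2, prod_through r f i]
    congr 1
    · congr 1
      refine prod_congr rfl fun J hJ => ?_
      obtain ⟨-, h1, h2, -⟩ := mem_filter.1 hJ
      exact hsame y hy J h1 h2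
    · refine prod_congr rfl fun J hJ => ?_
      obtain ⟨-, h1, h2, -⟩ := mem_filter.1 hJ
      exact hsame y hy J h1 h2
  have hgup : ∀ y ∈ Y, denPart q y {i, f i} < 2 ^ (n + 1) := by
    intro y hy
    rcases hcf i with h | h
    · exact hup y hy _ h
    · rw [hn, h, pair_eq_singleton, denPart_singleton (hY y hy).1, hc1]
      norm_num
  have hmain := sum_freqWeight_le K (Y.image fun y => y i) n x z hx0 hz0 ?_ ?_ ?_
  · refine hmain.trans ?_
    -- comparison of the two sizes of the vertex factor
    set v : ℕ := ∑ J with i ∈ J ∧ ∃ j ∈ J, j ∉ (univ : Finset ι) ∨ r i < r j, c J with hv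
    set D : ℕ := min K (∑ J with i ∈ J, c J) with hD
    have hopen : v ≤ n + ∑ J ∈ openSets r f i, c J := by
      have hsub : (univ.filter fun J : Finset ι =>
          i ∈ J ∧ ∃ j ∈ J, j ∉ (univ : Finset ι) ∨ r i < r j) ⊆
          insert {i, f i} (openSets r f i) := by
        intro J hJ
        obtain ⟨-, h1, j, hj, h2⟩ := mem_filter.1 hJ
        by_cases hJ1 : J = {i, f i}
        · rw [hJ1]; exact mem_insert_self _ _
        · refine mem_insert_of_mem (mem_filter.2 ⟨mem_univ _, h1, hJ1, fun h => ?_⟩)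
          have := h j hj
          rcases h2 with h2 | h2
          · exact h2 (mem_univ j)
          · omega
      refine (sum_le_sum_of_subset hsub).trans ?_
      rw [sum_insert]
      intro h
      exact (mem_filter.1 h).2.2.1 rfl
    have hzlow : 2 ^ (∑ J ∈ openSets r f i, c J) ≤ z := by
      rw [← prod_pow_eq_pow_sum]
      exact prod_le_prod' fun J _ => hlow y₀ hy₀ J
    have hzn : 2 ^ (v + n) ≤ 4 ^ n * z := by
      calc 2 ^ (v + n) ≤ 2 ^ (n + (∑ J ∈ openSets r f i, c J) + n) :=
            Nat.pow_le_pow_right (by norm_num) (by omega)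
        _ = 4 ^ n * 2 ^ (∑ J ∈ openSets r f i, c J) := by
            rw [pow_add, pow_add, show 4 = 2 * 2 from rfl, mul_pow]; ring
        _ ≤ 4 ^ n * z := Nat.mul_le_mul_left _ hzlow
    have hH : min (2 ^ K) (2 ^ (n + 1) * x * z) ≤ 2 ^ N * 2 ^ D := by
      by_cases hall : ∀ J : Finset ι, i ∈ J → c J < K
      · have h1 : 2 ^ (n + 1) * x * z ≤ 2 ^ (∑ J with i ∈ J, (c J + 1)) := by
          rw [← prod_pow_eq_pow_sum, prod_through r f i]
          refine Nat.mul_le_mul (Nat.mul_le_mul le_rfl ?_) ?_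
          · refine prod_le_prod' fun J hJ => (hup y₀ hy₀ J (hall J ?_)).le
            exact (mem_filter.1 hJ).2.1
          · refine prod_le_prod' fun J hJ => (hup y₀ hy₀ J (hall J ?_)).le
            exact (mem_filter.1 hJ).2.1
        have h2 : ∑ J with i ∈ J, (c J + 1) ≤ (∑ J with i ∈ J, c J) + N := by
          rw [sum_add_distrib]
          refine Nat.add_le_add_left ?_ _
          rw [sum_const, smul_eq_mul, mul_one]
          exact card_le_univ _
        rw [hD]
        rcases min_choice K (∑ J with i ∈ J, c J) with h | h
        · rw [h]
          refine (min_le_left _ _).trans ?_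
          exact Nat.le_mul_of_pos_left _ (by positivity)
        · rw [h, ← pow_add]
          refine (min_le_right _ _).trans (h1.trans (Nat.pow_le_pow_right (by norm_num) ?_))
          omega
      · push Not at hall
        obtain ⟨J, hiJ, hJ⟩ := hall
        have h1 : c J ≤ ∑ J with i ∈ J, c J :=
          single_le_sum (f := c) (fun _ _ => Nat.zero_le _) (mem_filter.2 ⟨mem_univ _, hiJ⟩)
        have h2 : D = K := min_eq_left (hJ.trans h1)
        rw [h2]
        refine (min_le_left _ _).trans ?_
        exact Nat.le_mul_of_pos_left _ (by positivity)
    set cost := orderCost (fun J => (c J : ℝ))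
      (fun i => min (K : ℝ) (∑ J with i ∈ J, (c J : ℝ))) univ r f i with hcost
    have hcost1 : (D : ℝ) - v - n ≤ cost := by
      rw [hcost]
      unfold orderCost laterMass
      refine le_trans (le_of_eq ?_) (le_max_right _ _)
      rw [hD, hv]
      push_cast
      rfl
    have hcost0 : 0 ≤ cost := le_max_left _ _
    have hratio : min ((2 : ℝ) ^ K) (2 ^ (n + 1) * x * z) / (4 ^ n * z) ≤ 2 ^ N * 2 ^ cost := by
      have h1 : min ((2 : ℝ) ^ K) (2 ^ (n + 1) * x * z) ≤ 2 ^ N * 2 ^ D := by exact_mod_cast hH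
      have h2 : (2 : ℝ) ^ (v + n) ≤ 4 ^ n * z := by exact_mod_cast hzn
      have h3 : (2 : ℝ) ^ D / 2 ^ (v + n) ≤ 2 ^ cost := by
        rw [← Real.rpow_natCast, ← Real.rpow_natCast, ← Real.rpow_sub (by norm_num)]
        refine Real.rpow_le_rpow_of_exponent_le (by norm_num) ?_
        push_cast
        linarith
      calc _ ≤ (2 ^ N * 2 ^ D) / (2 : ℝ) ^ (v + n) := by gcongr
        _ = 2 ^ N * (2 ^ D / (2 : ℝ) ^ (v + n)) := by rw [mul_div_assoc]
        _ ≤ _ := by gcongr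
    have hone : (1 : ℝ) ≤ 2 ^ N * 2 ^ cost := by
      have h1 : (1 : ℝ) ≤ 2 ^ N := one_le_pow₀ (by norm_num)
      have h2 : (1 : ℝ) ≤ 2 ^ cost := Real.one_le_rpow (by norm_num) hcost0
      nlinarith
    have hfin : 2 * min ((2 : ℝ) ^ K) (2 ^ (n + 1) * x * z) / (4 ^ n * z) + 16 ≤
        18 * (2 ^ N * 2 ^ cost) := by
      rw [mul_div_assoc]
      linarith
    have hxc : ((x : ℕ) : ℝ) = ∏ J ∈ closingSets r f i, (denPart q y₀ J : ℝ) := by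
      rw [hx]; push_cast; rfl
    rw [← hxc]
    calc _ ≤ ((K : ℝ) + 1) * (2 ^ n / x) * (18 * (2 ^ N * 2 ^ cost)) := by gcongr
      _ = _ := by ring
  · intro v hv
    obtain ⟨y, hy, rfl⟩ := mem_image.1 hv
    have := (mem_integralTuples (hY y hy).1).1 i
    exact ⟨this.1, this.2.1⟩
  · intro v hv
    obtain ⟨y, hy, rfl⟩ := mem_image.1 hv
    exact ⟨_, hden y hy, hlow y hy _, hgup y hy⟩
  · intro v hv w hw hvw
    obtain ⟨y, hy, rfl⟩ := mem_image.1 hv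
    obtain ⟨y', hy', rfl⟩ := mem_image.1 hw
    have h := spacing_of_agree (hY y hy).1 (hY y' hy').1 i (univ.filter fun j => r i < r j) ?_
      _ _ x z (hden y hy) (hden y' hy') ?_ hvw
    · refine le_trans ?_ h
      have g1 : (denPart q y {i, f i} : ℝ) ≤ 2 ^ (n + 1) := by exact_mod_cast (hgup y hy).le
      have g2 : (denPart q y' {i, f i} : ℝ) ≤ 2 ^ (n + 1) := by exact_mod_cast (hgup y' hy').le
      have g3 : (0 : ℝ) < denPart q y {i, f i} := by exact_mod_cast denPart_pos q y _
      have g4 : (0 : ℝ) < denPart q y' {i, f i} := by exact_mod_cast denPart_pos q y' _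
      have g5 : (0 : ℝ) < z := by exact_mod_cast hz0
      have h4 : (4 : ℝ) ^ (n + 1) = 2 ^ (n + 1) * 2 ^ (n + 1) := by rw [← mul_pow]; norm_num
      rw [h4]
      gcongr
    · intro j hj hji
      refine hagree y hy y' hy' j ?_
      have h1 : ¬ r i < r j := fun h => hj (mem_filter.2 ⟨mem_univ _, h⟩)
      exact lt_of_le_of_ne (not_lt.1 h1) fun h => hji (hr h)
    · intro p hp hpx j hj
      have hj' := (mem_filter.1 hj).2
      obtain ⟨J, hJ, hpJ⟩ := (hp.prime.dvd_finsetProd_iff _).1 hpx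
      obtain ⟨-, h1, h2, h3⟩ := mem_filter.1 hJ
      have hnot : ∀ u ∈ Y, ¬ p ∣ (u j).den := by
        intro u hu hd
        rw [← hsame u hu J h1 h2] at hpJ
        have hsupp := denPart_eq_of_prime_dvd hp hpJ
        have : j ∈ J := by rw [← hsupp]; simpa using hd
        have := h3 j this
        omega
      exact ⟨hnot y hy, hnot y' hy'⟩

end ordered

/-! ### The sum over all tuples -/

section classes

variable {ι : Type*} [Fintype ι] [DecidableEq ι] {q : ℕ} {r : ι → ℕ} {f : ι → ι}

/-- A nonempty set closes exactly at its last element, except for a chosen singleton, where the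
factor is `1`. -/
theorem prod_closingSets (hr : Function.Injective r) (hf : ∀ i, r i ≤ r (f i)) (g : Finset ι → ℝ)
    (g0 : g ∅ = 1) (g1 : ∀ i, f i = i → g {i} = 1) :
    ∏ i, ∏ J ∈ closingSets r f i, g J = ∏ J, g J := by
  have hcomm : ∏ i, ∏ J ∈ closingSets r f i, g J =
      ∏ J, ∏ i with J ∈ closingSets r f i, g J :=
    prod_comm' (by simp)
  rw [hcomm]
  refine prod_congr rfl fun J _ => ?_
  rcases J.eq_empty_or_nonempty with rfl | hne
  · rw [g0, prod_const_one]
  obtain ⟨i, hi, hmax⟩ := exists_max_image J r hne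
  by_cases hJ : J = {i, f i}
  · have h1 : f i ∈ J := by rw [hJ]; simp
    have h2 : f i = i := hr (le_antisymm (hmax _ h1) (hf i))
    have h3 : J = {i} := by rw [hJ, h2, pair_eq_singleton]
    rw [h3, g1 i h2, prod_const_one]
  · have : (univ.filter fun i => J ∈ closingSets r f i) = {i} := by
      ext j
      simp only [closingSets, mem_filter, mem_univ, true_and, mem_singleton]
      constructor
      · rintro ⟨h1, -, h2⟩
        exact hr (le_antisymm (hmax j h1) (h2 i hi))
      · rintro rfl
        exact ⟨hi, hJ, hmax⟩
    rw [this, prod_singleton]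

/-- The tuples with given dyadic classes and given parts `G` outside the chosen pairs. In the
product of the bounds for the single coordinates every part is divided out exactly once, at the
last element of its set, and the chosen pairs cancel against the factors `2 ^ c {i, f i}`. -/
theorem sum_class_key_le (hq : Squarefree q) (K : ℕ) (c : Finset ι → ℕ)
    (hr : Function.Injective r) (hf : ∀ i, r i ≤ r (f i)) (hcf : ∀ i, c {i, f i} < K ∨ f i = i)
    (hc1 : ∀ i, c {i} = 0) (G : Finset ι → ℕ) (hG : ∀ J, 0 < G J)
    (hG1 : ∀ J, (J = ∅ ∨ ∃ i, J = {i, f i}) → G J = 1) (Y : Finset (ι → ℚ))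
    (hY : ∀ y ∈ Y, y ∈ integralTuples ι q ∧ ∀ J, denClass K q y J = c J)
    (hkey : ∀ y ∈ Y, ∀ J : Finset ι, J.Nonempty → (∀ i, J ≠ {i, f i}) → denPart q y J = G J) :
    ∑ y ∈ Y, ∏ i, freqWeight K (y i) ≤
      (18 * 2 ^ Fintype.card (Finset ι) * (K + 1)) ^ Fintype.card ι *
        2 ^ (∑ i, orderCost (fun J => (c J : ℝ))
          (fun i => min (K : ℝ) (∑ J with i ∈ J, (c J : ℝ))) univ r f i) *
        ∏ J, (1 : ℝ) / G J := by
  classical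
  set M : ℝ := 18 * 2 ^ Fintype.card (Finset ι) * (K + 1) with hM
  have hM0 : 0 ≤ M := by positivity
  set cost := fun i => orderCost (fun J => (c J : ℝ))
    (fun i => min (K : ℝ) (∑ J with i ∈ J, (c J : ℝ))) univ r f i with hcost
  set gh : Finset ι → ℝ := fun J => if ∃ i, J = {i, f i} then 2 ^ c J else (G J : ℝ) with hgh
  have hgh0 : ∀ J, 0 < gh J := by
    intro J
    simp only [hgh]
    split_ifs
    · positivity
    · exact_mod_cast hG J
  have hlow : ∀ y ∈ Y, ∀ J : Finset ι, J.Nonempty → gh J ≤ denPart q y J := by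
    intro y hy J hJ
    simp only [hgh]
    split_ifs with h
    · rw [← (hY y hy).2 J]
      exact_mod_cast (Nat.pow_le_pow_right (by norm_num) (min_le_right _ _)).trans
        (Nat.pow_log_le_self 2 (denPart_pos q y J).ne')
    · rw [hkey y hy J hJ (fun i hi => h ⟨i, hi⟩)]
  set B : ι → ℝ := fun i => M * 2 ^ cost i * 2 ^ c {i, f i} / ∏ J ∈ closingSets r f i, gh J with hB
  have hB0 : ∀ i, 0 ≤ B i := fun i =>
    div_nonneg (by positivity) (prod_nonneg fun J _ => (hgh0 J).le)
  have hmain := sum_prod_le_of_prefix r (freqWeight K) (freqWeight_nonneg K) B hB0 0 univ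
    (hr.injOn) Y (fun x _ i hi => absurd (mem_univ i) hi) ?_
  · refine hmain.trans (le_of_eq ?_)
    have e1 : ∏ J, gh J = (∏ J, (G J : ℝ)) * ∏ i, 2 ^ c {i, f i} := by
      have h1 : ∀ J, gh J = (G J : ℝ) *
          if J ∈ univ.image (fun i => ({i, f i} : Finset ι)) then 2 ^ c J else 1 := by
        intro J
        simp only [hgh, mem_image, mem_univ, true_and]
        by_cases h : ∃ i, J = {i, f i}
        · have h' : ∃ i, {i, f i} = J := by obtain ⟨i, hi⟩ := h; exact ⟨i, hi.symm⟩
          rw [if_pos h, if_pos h', hG1 J (Or.inr h)]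
          simp
        · have h' : ¬ ∃ i, {i, f i} = J := by rintro ⟨i, hi⟩; exact h ⟨i, hi.symm⟩
          rw [if_neg h, if_neg h', mul_one]
      rw [prod_congr rfl fun J _ => h1 J, prod_mul_distrib, prod_ite_mem, univ_inter,
        prod_image (chosenPair_injective hr hf).injOn]
    have e2 := prod_closingSets hr hf gh
      (by
        have : ¬ ∃ i, (∅ : Finset ι) = {i, f i} := by
          rintro ⟨i, hi⟩
          exact absurd hi.symm (insert_ne_empty _ _)
        simp only [hgh]
        rw [if_neg this, hG1 ∅ (Or.inl rfl), Nat.cast_one])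
      (by
        intro i hi
        have : ∃ j, ({i} : Finset ι) = {j, f j} := ⟨i, by rw [hi, pair_eq_singleton]⟩
        simp only [hgh]
        rw [if_pos this, hc1 i, pow_zero])
    simp only [hB]
    rw [prod_div_distrib, e2, e1, prod_mul_distrib, prod_mul_distrib, prod_const, card_univ,
      ← Real.rpow_sum_of_pos (by norm_num), prod_div_distrib, prod_const_one]
    have h3 : (0 : ℝ) < ∏ i, 2 ^ c {i, f i} := prod_pos fun i _ => by positivity
    have h4 : (0 : ℝ) < ∏ J, (G J : ℝ) := prod_pos fun J _ => by exact_mod_cast hG J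
    field_simp
  · intro i _ Z hZ hagree
    rcases Z.eq_empty_or_nonempty with rfl | ⟨y₀, hy₀⟩
    · simpa using hB0 i
    refine (sum_freqWeight_agree_le hq K c hr hf hcf i (hc1 i) Z (fun y hy => hY y (hZ hy)) ?_
      hagree y₀ hy₀).trans ?_
    · intro y hy y' hy' J hJ hJ'
      rw [hkey y (hZ hy) J hJ hJ', hkey y' (hZ hy') J hJ hJ']
    · refine div_le_div_of_nonneg_left (by positivity) (prod_pos fun J _ => hgh0 J) ?_
      refine prod_le_prod (fun J _ => (hgh0 J).le) fun J hJ => ?_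
      exact hlow y₀ (hZ hy₀) J ⟨i, (mem_filter.1 hJ).2.1⟩

/-- The tuples with given dyadic classes `c`. The capacities `Δ i` are the exponents of the sizes
of the denominators, capped at the exponent `K` of the length of the window. -/
theorem sum_class_le (hq : Squarefree q) (K : ℕ) (c : Finset ι → ℕ) :
    ∑ y ∈ integralTuples ι q with ∀ J, denClass K q y J = c J, ∏ i, freqWeight K (y i) ≤
      (18 * 2 ^ Fintype.card (Finset ι) * (K + 1)) ^ Fintype.card ι *
        2 ^ (K * (Fintype.card ι / 2)) *
        (∑ d ∈ q.divisors, (1 : ℝ) / d) ^ Fintype.card (Finset ι) := by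
  classical
  set X := (integralTuples ι q).filter fun y => ∀ J, denClass K q y J = c J with hX
  rcases X.eq_empty_or_nonempty with h0 | ⟨y₁, hy₁⟩
  · rw [h0, sum_empty]
    have : 0 ≤ ∑ d ∈ q.divisors, (1 : ℝ) / d := sum_nonneg fun _ _ => by positivity
    positivity
  have hc1 : ∀ i, c {i} = 0 := by
    intro i
    obtain ⟨h1, h2⟩ := mem_filter.1 hy₁
    rw [← h2 {i}]
    unfold denClass
    rw [denPart_singleton h1]
    simp
  obtain ⟨r, f, hr, hf, hsum⟩ := exists_order_on (fun J : Finset ι => (c J : ℝ))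
    (fun J => Nat.cast_nonneg _) (fun i => by simp [hc1 i])
    (fun i => min (K : ℝ) (∑ J with i ∈ J, (c J : ℝ))) K
    (fun i => le_min (Nat.cast_nonneg _) (sum_nonneg fun _ _ => Nat.cast_nonneg _))
    (fun i => min_le_left _ _) (fun i => min_le_right _ _) univ
  have hr' : Function.Injective r := by
    intro a b hab; exact hr (mem_coe.2 (mem_univ a)) (mem_coe.2 (mem_univ b)) hab
  -- a chosen pair of maximal class is not needed: it already counts as an open set
  set f' : ι → ι := fun i => if c {i, f i} < K then f i else i with hf'
  have hrf' : ∀ i, r i ≤ r (f' i) := by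
    intro i
    simp only [hf']
    split_ifs
    · exact (hf i (mem_univ i)).1
    · exact le_rfl
  have hcf' : ∀ i, c {i, f' i} < K ∨ f' i = i := by
    intro i
    simp only [hf']
    split_ifs with h
    · exact Or.inl h
    · exact Or.inr rfl
  have hcost : ∀ i, orderCost (fun J => (c J : ℝ))
      (fun i => min (K : ℝ) (∑ J with i ∈ J, (c J : ℝ))) univ r f' i ≤
      orderCost (fun J => (c J : ℝ))
      (fun i => min (K : ℝ) (∑ J with i ∈ J, (c J : ℝ))) univ r f i := by
    intro i
    by_cases h : c {i, f i} < K
    · have : f' i = f i := if_pos h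
      unfold orderCost
      rw [this]
    · have h1 : f' i = i := if_neg h
      refine le_trans (max_le le_rfl ?_) (le_max_left _ _)
      rw [h1, pair_eq_singleton]
      beta_reduce
      rw [hc1 i, Nat.cast_zero, sub_zero, sub_nonpos]
      refine (min_le_left _ _).trans ?_
      by_cases h2 : f i = i
      · rw [h2, pair_eq_singleton, hc1 i] at h
        have hK : K = 0 := by omega
        rw [hK, Nat.cast_zero]
        exact sum_nonneg fun _ _ => Nat.cast_nonneg _
      · have h3 : (K : ℝ) ≤ c {i, f i} := by exact_mod_cast not_lt.1 h
        refine h3.trans ?_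
        unfold laterMass
        refine single_le_sum (f := fun J => (c J : ℝ)) (fun _ _ => Nat.cast_nonneg _)
          (mem_filter.2 ⟨mem_univ _, by simp, f i, by simp, Or.inr ?_⟩)
        exact lt_of_le_of_ne (hf i (mem_univ i)).1 fun h => h2 (hr' h).symm
  have hcostsum : (2 : ℝ) ^ (∑ i, orderCost (fun J => (c J : ℝ))
      (fun i => min (K : ℝ) (∑ J with i ∈ J, (c J : ℝ))) univ r f' i) ≤
      2 ^ (K * (Fintype.card ι / 2)) := by
    rw [← Real.rpow_natCast]
    refine Real.rpow_le_rpow_of_exponent_le (by norm_num) ?_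
    refine (sum_le_sum fun i _ => hcost i).trans (hsum.trans (le_of_eq ?_))
    rw [card_univ]
    push_cast
    rfl
  set key : (ι → ℚ) → Finset ι → ℕ := fun y J =>
    if J = ∅ ∨ ∃ i, J = {i, f' i} then 1 else denPart q y J with hkey
  have hq0 : q ≠ 0 := hq.ne_zero
  have hmaps : ∀ y ∈ X, key y ∈ Fintype.piFinset fun _ : Finset ι => q.divisors := by
    intro y _
    rw [Fintype.mem_piFinset]
    intro J
    simp only [hkey]
    split_ifs
    · simp [hq0]
    · exact Nat.mem_divisors.2 ⟨denPart_dvd hq J, hq0⟩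
  rw [← sum_fiberwise_of_maps_to hmaps]
  set R : ℝ := (18 * 2 ^ Fintype.card (Finset ι) * (K + 1)) ^ Fintype.card ι with hR
  have hstep : ∀ G ∈ Fintype.piFinset fun _ : Finset ι => q.divisors,
      ∑ y ∈ X with key y = G, ∏ i, freqWeight K (y i) ≤
        R * 2 ^ (K * (Fintype.card ι / 2)) * ∏ J, (1 : ℝ) / G J := by
    intro G hG
    have hGp : ∀ J, 0 < G J := fun J =>
      Nat.pos_of_mem_divisors (Fintype.mem_piFinset.1 hG J)
    rcases (X.filter fun y => key y = G).eq_empty_or_nonempty with h0 | ⟨y₀, hy₀⟩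
    · rw [h0, sum_empty]
      have : 0 ≤ ∏ J, (1 : ℝ) / G J := prod_nonneg fun _ _ => by positivity
      positivity
    refine (sum_class_key_le hq K c hr' hrf' hcf' hc1 G hGp ?_ _ ?_ ?_).trans ?_
    · intro J hJ
      rw [← (mem_filter.1 hy₀).2]
      exact if_pos hJ
    · intro y hy
      exact mem_filter.1 (mem_filter.1 hy).1
    · intro y hy J hJ hJ'
      rw [← (mem_filter.1 hy).2]
      refine (if_neg ?_).symm
      rintro (h | ⟨i, h⟩)
      · exact hJ.ne_empty h
      · exact hJ' i h
    · have : 0 ≤ ∏ J, (1 : ℝ) / G J := prod_nonneg fun _ _ => by positivity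
      gcongr
  refine (sum_le_sum hstep).trans (le_of_eq ?_)
  rw [← mul_sum, ← Finset.prod_univ_sum (fun _ : Finset ι => q.divisors)
    (fun (_ : Finset ι) (d : ℕ) => (1 : ℝ) / d), prod_const, card_univ]

/-- The tuples of frequencies with integral sum contribute, up to logarithms, as if they were
paired off. -/
theorem sum_integralTuples_le (ι : Type*) [Fintype ι] [DecidableEq ι] (hq : Squarefree q) (K : ℕ) :
    ∑ y ∈ integralTuples ι q, ∏ i, freqWeight K (y i) ≤
      ((K : ℝ) + 1) ^ Fintype.card (Finset ι) *
      ((18 * 2 ^ Fintype.card (Finset ι) * (K + 1)) ^ Fintype.card ι *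
        2 ^ (K * (Fintype.card ι / 2)) *
        (∑ d ∈ q.divisors, (1 : ℝ) / d) ^ Fintype.card (Finset ι)) := by
  classical
  have hmaps : ∀ y ∈ integralTuples ι q, denClass K q y ∈
      Fintype.piFinset fun _ : Finset ι => range (K + 1) := by
    intro y _
    rw [Fintype.mem_piFinset]
    intro J
    exact mem_range.2 (Nat.lt_succ_of_le (min_le_left _ _))
  rw [← sum_fiberwise_of_maps_to hmaps]
  have := sum_le_card_nsmul (Fintype.piFinset fun _ : Finset ι => range (K + 1))
    (fun c => ∑ y ∈ integralTuples ι q with denClass K q y = c, ∏ i, freqWeight K (y i)) _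
    (fun c _ => le_trans (le_of_eq (by
      refine sum_congr ?_ fun _ _ => rfl
      ext y
      simp only [mem_filter, funext_iff])) (sum_class_le hq K c))
  refine this.trans (le_of_eq ?_)
  rw [Fintype.card_piFinset, prod_const, card_univ, card_range, nsmul_eq_mul]
  push_cast
  ring

end classes

/-! ### Fourier expansion of the deviation -/

/-- The additive character `v ↦ exp (2 π i v)` on the rationals. -/
noncomputable def ratChar (v : ℚ) : ℂ := Complex.exp (Complex.I * ((2 * Real.pi * (v : ℝ) : ℝ) : ℂ))

theorem ratChar_add (v w : ℚ) : ratChar (v + w) = ratChar v * ratChar w := by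
  unfold ratChar
  rw [← Complex.exp_add]
  congr 1
  push_cast
  ring

theorem ratChar_zero : ratChar 0 = 1 := by simp [ratChar]

theorem ratChar_nat_mul (n : ℕ) (v : ℚ) : ratChar (n * v) = ratChar v ^ n := by
  unfold ratChar
  rw [← Complex.exp_nat_mul]
  congr 1
  push_cast
  ring

theorem ratChar_sum {ι : Type*} (s : Finset ι) (u : ι → ℚ) :
    ratChar (∑ i ∈ s, u i) = ∏ i ∈ s, ratChar (u i) := by
  classical
  induction s using Finset.induction_on with
  | empty => simp [ratChar_zero]
  | insert a s ha ih => rw [sum_insert ha, prod_insert ha, ratChar_add, ih]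

theorem norm_ratChar (v : ℚ) : ‖ratChar v‖ = 1 := by
  unfold ratChar
  rw [mul_comm]
  exact Complex.norm_exp_ofReal_mul_I _

theorem ratChar_eq_one_iff (v : ℚ) : ratChar v = 1 ↔ v.den = 1 := by
  unfold ratChar
  rw [Complex.exp_eq_one_iff]
  constructor
  · rintro ⟨n, hn⟩
    have hpi : (Real.pi : ℂ) ≠ 0 := by exact_mod_cast Real.pi_ne_zero
    have h1 : ((v : ℝ) : ℂ) = n := by
      have : Complex.I * (2 * Real.pi) * (v : ℝ) = Complex.I * (2 * Real.pi) * n := by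
        push_cast at hn ⊢
        linear_combination hn
      exact mul_left_cancel₀ (by simp [hpi]) this
    have h2 : v = n := by exact_mod_cast h1
    rw [h2]
    exact Rat.den_intCast n
  · intro h
    refine ⟨v.num, ?_⟩
    have : v = v.num := (Rat.den_eq_one_iff v).1 h ▸ rfl
    have h2 : ((v : ℝ) : ℂ) = v.num := by
      rw [Rat.cast_def, h]
      simp
    push_cast
    push_cast at h2
    rw [h2]
    ring

theorem sum_ratChar_range (q : ℕ) (v : ℚ) (hv : v.den ∣ q) :
    ∑ n ∈ range q, ratChar (n * v) = if v.den = 1 then (q : ℂ) else 0 := by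
  simp_rw [ratChar_nat_mul]
  split_ifs with h
  · rw [(ratChar_eq_one_iff v).2 h]
    simp
  · have h1 : ratChar v ≠ 1 := fun h' => h ((ratChar_eq_one_iff v).1 h')
    have h2 : ratChar v ^ q = 1 := by
      rw [← ratChar_nat_mul, ratChar_eq_one_iff]
      obtain ⟨k, rfl⟩ := hv
      have : ((v.den * k : ℕ) : ℚ) * v = ((k * v.num : ℤ) : ℚ) := by
        have := Rat.den_mul_eq_num v
        push_cast
        linear_combination (k : ℚ) * this
      rw [this]
      exact Rat.den_intCast _
    rw [geom_sum_eq h1, h2, sub_self, zero_div]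

theorem norm_sum_ratChar_le (K H : ℕ) (hH : H ≤ 2 ^ K) (v : ℚ) (h0 : 0 < v) (h1 : v < 1) :
    ‖∑ j ∈ range H, ratChar (j * v)‖ ≤ peak K v := by
  unfold peak
  refine le_min ?_ ?_
  · refine (norm_sum_le _ _).trans ?_
    simp only [norm_ratChar, sum_const, card_range, nsmul_eq_mul, mul_one]
    exact_mod_cast hH
  · have h0' : (0 : ℝ) < v := by exact_mod_cast h0
    have h1' : (v : ℝ) < 1 := by exact_mod_cast h1
    set t : ℝ := min (v : ℝ) (1 - v) with ht
    have ht0 : 0 < t := lt_min h0' (by linarith)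
    have ht1 : t ≤ 1 / 2 := by
      rcases le_total (v : ℝ) (1 / 2) with h | h
      · exact (min_le_left _ _).trans h
      · exact (min_le_right _ _).trans (by linarith)
    have hsin : 2 * t ≤ Real.sin (Real.pi * v) := by
      have h2 : Real.sin (Real.pi * v) = Real.sin (Real.pi * t) := by
        rcases min_choice (v : ℝ) (1 - v) with h | h
        · rw [ht, h]
        · rw [ht, h, mul_sub, mul_one, Real.sin_pi_sub]
      rw [h2]
      have := Real.mul_le_sin (x := Real.pi * t) (by positivity) (by nlinarith [Real.pi_pos])
      calc 2 * t = 2 / Real.pi * (Real.pi * t) := by field_simp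
        _ ≤ _ := this
    have hden : 4 * t ≤ ‖ratChar v - 1‖ := by
      unfold ratChar
      rw [Complex.norm_exp_I_mul_ofReal_sub_one, Real.norm_eq_abs]
      refine le_trans ?_ (le_abs_self _)
      rw [show 2 * Real.pi * (v : ℝ) / 2 = Real.pi * v by ring]
      linarith
    have hne : ratChar v ≠ 1 := by
      intro h
      rw [h, sub_self, norm_zero] at hden
      linarith
    simp_rw [ratChar_nat_mul]
    rw [geom_sum_eq hne, norm_div]
    have hnum : ‖ratChar v ^ H - 1‖ ≤ 2 := by
      refine (norm_sub_le _ _).trans ?_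
      rw [norm_pow, norm_ratChar, one_pow, norm_one]
      norm_num
    rw [abs_of_pos ht0]
    calc _ ≤ 2 / (4 * t) := by gcongr
      _ ≤ 1 / t := by
        rw [div_le_div_iff₀ (by positivity) ht0]
        linarith

theorem sum_moebius_div (m : ℕ) (hm : 0 < m) :
    ∑ s ∈ m.divisors, (ArithmeticFunction.moebius s : ℝ) / s = (m.totient : ℝ) / m := by
  have h := (ArithmeticFunction.sum_eq_iff_sum_mul_moebius_eq (R := ℝ)
    (f := fun n => (n.totient : ℝ)) (g := fun n => (n : ℝ))).1
    (fun n _ => by exact_mod_cast Nat.sum_totient n) m hm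
  rw [Nat.sum_divisorsAntidiagonal (f := fun a b => (ArithmeticFunction.moebius a : ℝ) * (b : ℝ))]
    at h
  rw [← h, sum_div]
  refine sum_congr rfl fun s hs => ?_
  have hs0 : (s : ℝ) ≠ 0 := by exact_mod_cast (Nat.pos_of_mem_divisors hs).ne'
  have hm0 : (m : ℝ) ≠ 0 := by exact_mod_cast hm.ne'
  rw [Nat.cast_div (Nat.dvd_of_mem_divisors hs) hs0]
  field_simp

theorem sum_moebius_dvd (q n : ℕ) (hq : 0 < q) :
    ∑ r ∈ q.divisors with r ∣ n, ArithmeticFunction.moebius r =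
      if Nat.Coprime n q then 1 else 0 := by
  have h1 : (q.divisors.filter fun r => r ∣ n) = (Nat.gcd n q).divisors := by
    ext r
    have := (Nat.gcd_pos_of_pos_right n hq).ne'
    have hq' := hq.ne'
    simp only [mem_filter, Nat.mem_divisors, Nat.dvd_gcd_iff]
    tauto
  rw [h1, ← ArithmeticFunction.coe_zeta_mul_apply, ArithmeticFunction.coe_zeta_mul_moebius,
    ArithmeticFunction.one_apply]

/-- The Fourier coefficient at frequency `v` of the indicator function of the integers coprime
to `q`. -/
noncomputable def coprimeCoeff (q : ℕ) (v : ℚ) : ℝ :=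
  ∑ r ∈ q.divisors with v.den ∣ r, (ArithmeticFunction.moebius r : ℝ) / r

theorem coprimeCoeff_zero (q : ℕ) (hq : 0 < q) : coprimeCoeff q 0 = coprimeDensity q := by
  unfold coprimeCoeff coprimeDensity
  rw [← sum_moebius_div q hq]
  simp

/-- For `d = v.den` the coefficient is `μ(d) / d * φ(q / d) / (q / d)`. -/
theorem abs_coprimeCoeff_le {q : ℕ} (hq : Squarefree q) {v : ℚ} (hv : v.den ∣ q) :
    |coprimeCoeff q v| ≤ 1 / v.den := by
  obtain ⟨m, hm⟩ := hv
  set d := v.den with hd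
  have hd0 : 0 < d := v.den_pos
  have hq0 : q ≠ 0 := hq.ne_zero
  have hm0 : 0 < m := Nat.pos_of_ne_zero (by rintro rfl; exact hq0 (by simp [hm]))
  have hcop : Nat.Coprime d m := by
    rw [hm] at hq
    exact Nat.coprime_of_squarefree_mul hq
  have h1 : (q.divisors.filter fun r => d ∣ r) = m.divisors.image (fun s => d * s) := by
    ext r
    simp only [mem_filter, Nat.mem_divisors, mem_image]
    constructor
    · rintro ⟨⟨h1, -⟩, s, rfl⟩
      rw [hm] at h1
      exact ⟨s, ⟨Nat.dvd_of_mul_dvd_mul_left hd0 h1, hm0.ne'⟩, rfl⟩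
    · rintro ⟨s, ⟨h1, -⟩, rfl⟩
      exact ⟨⟨by rw [hm]; exact Nat.mul_dvd_mul_left d h1, hq0⟩, dvd_mul_right _ _⟩
  have h2 : coprimeCoeff q v = (ArithmeticFunction.moebius d : ℝ) / d * (m.totient / m) := by
    unfold coprimeCoeff
    rw [← hd, h1, sum_image fun a _ b _ h => Nat.eq_of_mul_eq_mul_left hd0 h,
      ← sum_moebius_div m hm0, mul_sum]
    refine sum_congr rfl fun s hs => ?_
    have hc : Nat.Coprime d s := hcop.coprime_dvd_right (Nat.dvd_of_mem_divisors hs)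
    rw [ArithmeticFunction.isMultiplicative_moebius.map_mul_of_coprime hc]
    push_cast
    rw [div_mul_div_comm]
  rw [h2, abs_mul, abs_div, Nat.abs_cast]
  have h3 : |(ArithmeticFunction.moebius d : ℝ)| ≤ 1 := by
    exact_mod_cast ArithmeticFunction.abs_moebius_le_one (n := d)
  have h4 : |(m.totient : ℝ) / m| ≤ 1 := by
    rw [abs_of_nonneg (by positivity)]
    exact div_le_one_of_le₀ (by exact_mod_cast Nat.totient_le m) (Nat.cast_nonneg _)
  calc _ ≤ 1 / (d : ℝ) * 1 := by gcongr
    _ = _ := mul_one _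

/-- The Fourier expansion of the indicator function of the integers coprime to `q`. -/
theorem coprime_indicator_eq_sum {q : ℕ} (hq : 0 < q) (n : ℕ) :
    (if Nat.Coprime n q then (1 : ℂ) else 0) =
      ∑ b ∈ range q, (coprimeCoeff q ((b : ℚ) / q) : ℂ) * ratChar (n * ((b : ℚ) / q)) := by
  have hq0 : (q : ℚ) ≠ 0 := by exact_mod_cast hq.ne'
  have e1 : (if Nat.Coprime n q then (1 : ℂ) else 0) =
      ∑ r ∈ q.divisors, (ArithmeticFunction.moebius r : ℂ) / r * if r ∣ n then (r : ℂ) else 0 := by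
    have h := sum_moebius_dvd q n hq
    have h' : ((∑ r ∈ q.divisors with r ∣ n, ArithmeticFunction.moebius r : ℤ) : ℂ) =
      ((if Nat.Coprime n q then 1 else 0 : ℤ) : ℂ) := by rw [h]
    push_cast at h'
    rw [← h', sum_filter]
    refine sum_congr rfl fun r hr => ?_
    have hr0 : (r : ℂ) ≠ 0 := by exact_mod_cast (Nat.pos_of_mem_divisors hr).ne'
    split_ifs
    · field_simp
    · simp
  have e2 : ∀ r ∈ q.divisors, (if r ∣ n then (r : ℂ) else 0) =
      ∑ b ∈ (range q).filter (fun b : ℕ => ((b : ℚ) / q).den ∣ r), ratChar (n * ((b : ℚ) / q)) := by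
    intro r hr
    have hr0 := Nat.pos_of_mem_divisors hr
    have hr' : (r : ℚ) ≠ 0 := by exact_mod_cast hr0.ne'
    obtain ⟨s, hs⟩ := Nat.dvd_of_mem_divisors hr
    have hs0 : 0 < s := Nat.pos_of_ne_zero (by rintro rfl; simp at hs; omega)
    have hs' : (s : ℚ) ≠ 0 := by exact_mod_cast hs0.ne'
    have h1 : (range q).filter (fun b : ℕ => ((b : ℚ) / q).den ∣ r) =
        (range r).image fun a => a * s := by
      ext b
      simp only [mem_filter, mem_range, mem_image]
      constructor
      · rintro ⟨hb, c, hc⟩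
        set v : ℚ := (b : ℚ) / q with hv
        have h2 : (r : ℚ) * v = ((c * v.num : ℤ) : ℚ) := by
          have := Rat.den_mul_eq_num v
          rw [hc]
          push_cast
          linear_combination (c : ℚ) * this
        have h3 : (b : ℚ) = ((c * v.num : ℤ) : ℚ) * s := by
          rw [← h2, hv, hs]
          push_cast
          field_simp
        have h4 : (b : ℤ) = (c * v.num) * s := by exact_mod_cast h3
        have h5 : s ∣ b := by
          have : (s : ℤ) ∣ b := ⟨c * v.num, by rw [h4]; ring⟩
          exact_mod_cast this
        obtain ⟨a, rfl⟩ := h5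
        refine ⟨a, ?_, mul_comm _ _⟩
        rw [hs, mul_comm r] at hb
        exact lt_of_mul_lt_mul_left hb (Nat.zero_le _)
      · rintro ⟨a, ha, rfl⟩
        refine ⟨by rw [hs]; exact Nat.mul_lt_mul_of_pos_right ha hs0, ?_⟩
        have : (((a * s : ℕ) : ℚ)) / q = Rat.divInt (a : ℤ) (r : ℤ) := by
          rw [Rat.divInt_eq_div, hs]
          push_cast
          field_simp
        rw [this]
        exact_mod_cast Rat.den_dvd (a : ℤ) (r : ℤ)
    rw [h1, sum_image fun a _ b _ h => Nat.eq_of_mul_eq_mul_right hs0 h]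
    have h2 : ∀ a ∈ range r, ratChar (n * (((a * s : ℕ) : ℚ) / q)) =
        ratChar (a * ((n : ℚ) / r)) := by
      intro a _
      congr 1
      rw [hs]
      push_cast
      field_simp
    rw [sum_congr rfl h2, sum_ratChar_range]
    · have : (r ∣ n) ↔ ((n : ℚ) / r).den = 1 := by
        have h3 : ((n : ℚ) / r) = Rat.divInt (n : ℤ) (r : ℤ) := by
          rw [Rat.divInt_eq_div]; push_cast; rfl
        rw [h3, Rat.den_eq_one_iff]
        constructor
        · rintro ⟨k, rfl⟩
          rw [← h3]
          have : (((r * k : ℕ) : ℚ) / r) = ((k : ℤ) : ℚ) := by push_cast; field_simp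
          rw [this, Rat.num_intCast]
        · intro h
          rw [← h3] at h
          set u := ((n : ℚ) / r).num with hu
          have h4 : (n : ℚ) = u * r := by rw [h]; field_simp
          have h5 : (n : ℤ) = u * r := by exact_mod_cast h4
          have : (r : ℤ) ∣ n := ⟨u, by rw [h5]; ring⟩
          exact_mod_cast this
      simp only [this]
    · have h3 : ((n : ℚ) / r) = Rat.divInt (n : ℤ) (r : ℤ) := by
        rw [Rat.divInt_eq_div]; push_cast; rfl
      rw [h3]
      exact_mod_cast Rat.den_dvd (n : ℤ) (r : ℤ)
  rw [e1]
  calc _ = ∑ r ∈ q.divisors, ∑ b ∈ range q, if ((b : ℚ) / q).den ∣ r then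
          (ArithmeticFunction.moebius r : ℂ) / r * ratChar (n * ((b : ℚ) / q)) else 0 := by
        refine sum_congr rfl fun r hr => ?_
        rw [e2 r hr, mul_sum, sum_filter]
    _ = _ := by
        rw [sum_comm]
        refine sum_congr rfl fun b _ => ?_
        unfold coprimeCoeff
        push_cast
        rw [sum_mul, sum_filter]

/-- The deviation from its mean of the number of integers coprime to `q` among
`n, …, n + H - 1`. -/
noncomputable def coprimeDeviation (q H n : ℕ) : ℝ :=
  (∑ j ∈ range H, if Nat.Coprime (n + j) q then (1 : ℝ) else 0) - coprimeDensity q * H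

theorem coprimeDeviation_eq_sum {q : ℕ} (hq : 0 < q) (H n : ℕ) :
    (coprimeDeviation q H n : ℂ) = ∑ v ∈ properFractions q,
      (coprimeCoeff q v : ℂ) * (∑ j ∈ range H, ratChar (j * v)) * ratChar (n * v) := by
  have hq0 : (q : ℚ) ≠ 0 := by exact_mod_cast hq.ne'
  unfold properFractions
  rw [sum_image]
  · have h1 : (∑ j ∈ range H, if Nat.Coprime (n + j) q then (1 : ℂ) else 0) =
        ∑ b ∈ range q, (coprimeCoeff q ((b : ℚ) / q) : ℂ) *
          (∑ j ∈ range H, ratChar (j * ((b : ℚ) / q))) * ratChar (n * ((b : ℚ) / q)) := by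
      rw [sum_congr rfl fun j _ => coprime_indicator_eq_sum hq (n + j), sum_comm]
      refine sum_congr rfl fun b _ => ?_
      rw [mul_sum, sum_mul]
      refine sum_congr rfl fun j _ => ?_
      rw [Nat.cast_add, add_mul, ratChar_add]
      ring
    rw [range_eq_Ico (a := q), sum_eq_sum_Ico_succ_bot hq] at h1
    unfold coprimeDeviation
    rw [Complex.ofReal_sub, Complex.ofReal_sum, Complex.ofReal_mul, Complex.ofReal_natCast]
    simp_rw [apply_ite Complex.ofReal, Complex.ofReal_one, Complex.ofReal_zero]
    rw [h1]
    simp [ratChar_zero, coprimeCoeff_zero q hq]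
  · intro a _ b _ h
    have : (a : ℚ) / q = (b : ℚ) / q := h
    have : (a : ℚ) = b := by field_simp at this; exact this
    exact_mod_cast this

/-- Orthogonality of characters: only the tuples of frequencies with integral sum contribute to a
moment of the deviation. -/
theorem abs_sum_coprimeDeviation_pow_le {q : ℕ} (hq : Squarefree q) (K H m : ℕ) (hH : H ≤ 2 ^ K) :
    |∑ n ∈ range q, coprimeDeviation q H n ^ m| ≤
      q * ∑ θ ∈ integralTuples (Fin m) q, ∏ i, freqWeight K (θ i) := by
  have hq0 : 0 < q := Nat.pos_of_ne_zero hq.ne_zero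
  set a : ℚ → ℂ := fun v => (coprimeCoeff q v : ℂ) * (∑ j ∈ range H, ratChar (j * v)) with ha
  have hE : ((∑ n ∈ range q, coprimeDeviation q H n ^ m : ℝ) : ℂ) =
      q * ∑ θ ∈ integralTuples (Fin m) q, ∏ i, a (θ i) := by
    push_cast
    calc _ = ∑ n ∈ range q, ∑ θ ∈ Fintype.piFinset fun _ : Fin m => properFractions q,
          (∏ i, a (θ i)) * ratChar (n * ∑ i, θ i) := by
          refine sum_congr rfl fun n _ => ?_
          rw [coprimeDeviation_eq_sum hq0]
          have : ∀ x : ℂ, x ^ m = ∏ _i : Fin m, x := fun x => by simp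
          rw [this, Finset.prod_univ_sum]
          refine sum_congr rfl fun θ _ => ?_
          rw [prod_mul_distrib, mul_sum, ratChar_sum]
      _ = ∑ θ ∈ Fintype.piFinset fun _ : Fin m => properFractions q,
          (∏ i, a (θ i)) * if (∑ i, θ i).den = 1 then (q : ℂ) else 0 := by
          rw [sum_comm]
          refine sum_congr rfl fun θ hθ => ?_
          rw [← mul_sum, sum_ratChar_range]
          have hmem := fun i => (mem_properFractions (Fintype.mem_piFinset.1 hθ i)).2.2
          have : ∀ s : Finset (Fin m), (∑ i ∈ s, θ i).den ∣ q := by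
            intro s
            have key : ∀ v : ℚ, v.den ∣ q ↔ ∃ z : ℤ, (q : ℚ) * v = z := by
              intro v
              constructor
              · rintro ⟨k, hk⟩
                refine ⟨k * v.num, ?_⟩
                have := Rat.den_mul_eq_num v
                rw [hk]
                push_cast
                linear_combination (k : ℚ) * this
              · rintro ⟨z, hz⟩
                have hq' : (q : ℚ) ≠ 0 := by exact_mod_cast hq0.ne'
                have : v = Rat.divInt z (q : ℤ) := by
                  rw [Rat.divInt_eq_div, ← hz]; push_cast; field_simp
                rw [this]
                exact_mod_cast Rat.den_dvd z (q : ℤ)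
            choose z hz using fun i => (key (θ i)).1 (hmem i)
            refine (key _).2 ⟨∑ i ∈ s, z i, ?_⟩
            rw [mul_sum, sum_congr rfl fun i _ => hz i]
            push_cast
            rfl
          exact this univ
      _ = _ := by
          unfold integralTuples
          rw [sum_filter, mul_sum]
          refine sum_congr rfl fun θ _ => ?_
          split_ifs <;> ring
  have hnorm := congrArg norm hE
  rw [Complex.norm_real, Real.norm_eq_abs] at hnorm
  rw [hnorm, norm_mul, Complex.norm_natCast]
  refine mul_le_mul_of_nonneg_left ?_ (Nat.cast_nonneg _)
  refine (norm_sum_le _ _).trans (sum_le_sum fun θ hθ => ?_)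
  rw [norm_prod]
  refine prod_le_prod (fun _ _ => norm_nonneg _) fun i _ => ?_
  obtain ⟨h0, h1, h2⟩ := (mem_integralTuples hθ).1 i
  simp only [ha]
  rw [norm_mul, Complex.norm_real, Real.norm_eq_abs, freqWeight, div_eq_mul_one_div, mul_comm]
  exact mul_le_mul (norm_sum_ratChar_le K H hH _ h0 h1) (abs_coprimeCoeff_le hq h2)
    (abs_nonneg _) (peak_nonneg K _)

/-! ### Moduli without large prime factors -/

theorem coprimeDensity_eq_prod {q : ℕ} (hq : q ≠ 0) :
    coprimeDensity q = ∏ p ∈ q.primeFactors, (1 - 1 / (p : ℝ)) := by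
  have h : ((q.totient : ℚ) : ℝ) = ((q * ∏ p ∈ q.primeFactors, (1 - (p : ℚ)⁻¹) : ℚ) : ℝ) := by
    rw [Nat.totient_eq_mul_prod_factors q]
  have hq' : (q : ℝ) ≠ 0 := by exact_mod_cast hq
  push_cast at h
  unfold coprimeDensity
  rw [h, mul_div_cancel_left₀ _ hq']
  simp

theorem coprimeDensity_pos {q : ℕ} (hq : q ≠ 0) : 0 < coprimeDensity q := by
  unfold coprimeDensity
  have := Nat.totient_pos.2 (Nat.pos_of_ne_zero hq)
  positivity

theorem coprimeDensity_le_one (q : ℕ) : coprimeDensity q ≤ 1 := by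
  unfold coprimeDensity
  exact div_le_one_of_le₀ (by exact_mod_cast Nat.totient_le q) (Nat.cast_nonneg _)

/-- Chebyshev's bound for the primes in a dyadic block, read off from the primorial. -/
theorem sum_inv_prime_block_le (j : ℕ) (hj : 0 < j) :
    ∑ p ∈ (Ioc (2 ^ j) (2 ^ (j + 1))).filter Nat.Prime, (1 : ℝ) / p ≤ 4 / j := by
  set S := (Ioc (2 ^ j) (2 ^ (j + 1))).filter Nat.Prime with hS
  have h1 : (2 ^ j) ^ S.card ≤ 4 ^ 2 ^ (j + 1) := by
    calc (2 ^ j) ^ S.card ≤ ∏ p ∈ S, p := by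
          refine pow_card_le_prod _ _ _ (fun p hp => ?_)
          exact (mem_Ioc.1 (mem_filter.1 hp).1).1.le
      _ ≤ primorial (2 ^ (j + 1)) := by
          unfold primorial
          refine prod_le_prod_of_subset_of_one_le' ?_ ?_
          · intro p hp
            obtain ⟨h1, h2⟩ := mem_filter.1 hp
            exact mem_filter.2 ⟨mem_range.2 (Nat.lt_succ_of_le (mem_Ioc.1 h1).2), h2⟩
          · intro p hp _
            exact (mem_filter.1 hp).2.one_le
      _ ≤ _ := primorial_le_four_pow _
  have h2 : j * S.card ≤ 4 * 2 ^ j := by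
    rw [← pow_mul, show 4 = 2 ^ 2 from rfl, ← pow_mul] at h1
    have := (Nat.pow_le_pow_iff_right (by norm_num : 1 < 2)).1 h1
    rw [pow_succ] at this
    omega
  have hj' : (0 : ℝ) < j := by exact_mod_cast hj
  calc ∑ p ∈ S, (1 : ℝ) / p ≤ ∑ p ∈ S, (1 : ℝ) / 2 ^ j := by
        refine sum_le_sum fun p hp => ?_
        have : (2 : ℝ) ^ j ≤ p := by exact_mod_cast (mem_Ioc.1 (mem_filter.1 hp).1).1.le
        gcongr
    _ = S.card / 2 ^ j := by rw [sum_const, nsmul_eq_mul]; ring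
    _ ≤ 4 / j := by
        rw [div_le_div_iff₀ (by positivity) hj']
        have : ((j * S.card : ℕ) : ℝ) ≤ ((4 * 2 ^ j : ℕ) : ℝ) := by exact_mod_cast h2
        push_cast at this
        linarith

theorem sum_inv_prime_le_harmonic (J : ℕ) :
    ∑ p ∈ (Icc 1 (2 ^ (J + 1))).filter Nat.Prime, (1 : ℝ) / p ≤ 1 + 4 * harmonic J := by
  induction J with
  | zero =>
    have : (Icc 1 (2 ^ (0 + 1))).filter Nat.Prime = {2} := by decide
    rw [this]
    norm_num
  | succ J ih =>
    have h1 : (Icc 1 (2 ^ (J + 1 + 1))).filter Nat.Prime =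
        (Icc 1 (2 ^ (J + 1))).filter Nat.Prime ∪
          (Ioc (2 ^ (J + 1)) (2 ^ (J + 1 + 1))).filter Nat.Prime := by
      have h2 : 2 ^ (J + 1) ≤ 2 ^ (J + 1 + 1) := Nat.pow_le_pow_right (by norm_num) (by omega)
      ext p
      simp only [mem_filter, mem_union, mem_Icc, mem_Ioc]
      constructor
      · rintro ⟨⟨h3, h4⟩, h5⟩
        by_cases h6 : p ≤ 2 ^ (J + 1)
        · exact Or.inl ⟨⟨h3, h6⟩, h5⟩
        · exact Or.inr ⟨⟨not_le.1 h6, h4⟩, h5⟩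
      · rintro (⟨⟨h3, h4⟩, h5⟩ | ⟨⟨h3, h4⟩, h5⟩)
        · exact ⟨⟨h3, h4.trans h2⟩, h5⟩
        · exact ⟨⟨h5.one_le, h4⟩, h5⟩
    rw [h1]
    have h3 := sum_inv_prime_block_le (J + 1) (Nat.succ_pos J)
    rw [sum_union, harmonic_succ]
    · push_cast at h3 ⊢
      have : (4 : ℝ) / (J + 1) = 4 * ((J : ℝ) + 1)⁻¹ := div_eq_mul_inv _ _
      linarith
    · rw [disjoint_left]
      intro p hp hp'
      have h4 := (mem_Icc.1 (mem_filter.1 hp).1).2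
      have h5 := (mem_Ioc.1 (mem_filter.1 hp').1).1
      omega

theorem sum_inv_primeFactors_le {q J : ℕ} (hJ : 0 < J) (hq : ∀ p ∈ q.primeFactors, p ≤ 2 ^ J) :
    ∑ p ∈ q.primeFactors, (1 : ℝ) / p ≤ 5 + 4 * Real.log J := by
  have h1 : ∑ p ∈ q.primeFactors, (1 : ℝ) / p ≤
      ∑ p ∈ (Icc 1 (2 ^ J)).filter Nat.Prime, (1 : ℝ) / p := by
    refine sum_le_sum_of_subset_of_nonneg ?_ fun _ _ _ => by positivity
    intro p hp
    have := Nat.prime_of_mem_primeFactors hp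
    exact mem_filter.2 ⟨mem_Icc.2 ⟨this.one_le, hq p hp⟩, this⟩
  obtain ⟨i, rfl⟩ := Nat.exists_eq_succ_of_ne_zero hJ.ne'
  have h2 := sum_inv_prime_le_harmonic i
  have h3 := harmonic_le_one_add_log i
  have h4 : Real.log i ≤ Real.log (i + 1 : ℕ) := by
    rcases Nat.eq_zero_or_pos i with rfl | hi
    · simp
    · exact Real.log_le_log (by exact_mod_cast hi) (by exact_mod_cast Nat.le_succ i)
  have h5 : ∑ p ∈ q.primeFactors, (1 : ℝ) / p ≤ 1 + 4 * harmonic i := h1.trans h2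
  have h6 : Real.log (i + 1 : ℕ) = Real.log (i.succ : ℕ) := rfl
  linarith

theorem exp_five_add_log {J : ℕ} (hJ : 0 < J) :
    Real.exp (5 + 4 * Real.log J) = Real.exp 5 * (J : ℝ) ^ 4 := by
  have : (0 : ℝ) < J := by exact_mod_cast hJ
  rw [Real.exp_add]
  congr 1
  have h : (4 : ℝ) * Real.log J = Real.log ((J : ℝ) ^ 4) := by rw [Real.log_pow]; norm_num
  rw [h, Real.exp_log (by positivity)]

theorem sum_inv_divisors_le {q J : ℕ} (hq : Squarefree q) (hJ : 0 < J)
    (hqJ : ∀ p ∈ q.primeFactors, p ≤ 2 ^ J) :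
    ∑ d ∈ q.divisors, (1 : ℝ) / d ≤ Real.exp 5 * (J : ℝ) ^ 4 := by
  set g : ArithmeticFunction ℝ := ⟨fun n => 1 / (n : ℝ), by simp⟩ with hg
  have hgm : g.IsMultiplicative := by
    refine ⟨by simp [hg], fun {m n} _ => ?_⟩
    simp [hg, mul_comm]
  have h := hgm.prodPrimeFactors_one_add_of_squarefree hq
  have h' : ∑ d ∈ q.divisors, (1 : ℝ) / d = ∏ p ∈ q.primeFactors, (1 + 1 / (p : ℝ)) := h.symm
  rw [h', ← exp_five_add_log hJ]
  calc ∏ p ∈ q.primeFactors, (1 + 1 / (p : ℝ)) ≤ ∏ p ∈ q.primeFactors, Real.exp (1 / (p : ℝ)) := by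
        refine prod_le_prod (fun p _ => by positivity) fun p _ => ?_
        rw [add_comm]
        exact Real.add_one_le_exp _
    _ = Real.exp (∑ p ∈ q.primeFactors, 1 / (p : ℝ)) := (Real.exp_sum _ _).symm
    _ ≤ _ := Real.exp_le_exp.2 (sum_inv_primeFactors_le hJ hqJ)

/-- Since `(1 + t) ^ 2 * (1 - t) ≥ 1` for `0 ≤ t ≤ 1 / 2`, the inverse of the density is at most
`exp (2 * ∑ 1 / p)`. -/
theorem inv_coprimeDensity_le {q J : ℕ} (hq : q ≠ 0) (hJ : 0 < J)
    (hqJ : ∀ p ∈ q.primeFactors, p ≤ 2 ^ J) :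
    1 / coprimeDensity q ≤ (Real.exp 5 * (J : ℝ) ^ 4) ^ 2 := by
  rw [coprimeDensity_eq_prod hq, ← exp_five_add_log hJ]
  calc 1 / ∏ p ∈ q.primeFactors, (1 - 1 / (p : ℝ)) =
        ∏ p ∈ q.primeFactors, 1 / (1 - 1 / (p : ℝ)) := by rw [prod_div_distrib, prod_const_one]
    _ ≤ ∏ p ∈ q.primeFactors, Real.exp (1 / (p : ℝ)) ^ 2 := by
        refine prod_le_prod (fun p hp => ?_) fun p hp => ?_
        all_goals
          have h2 : (2 : ℝ) ≤ p := by exact_mod_cast (Nat.prime_of_mem_primeFactors hp).two_le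
          have h3 : 1 / (p : ℝ) ≤ 1 / 2 := by gcongr
          have h4 : 0 < 1 / (p : ℝ) := by positivity
        · exact div_nonneg zero_le_one (by linarith)
        · rw [div_le_iff₀ (by linarith)]
          have h5 : 1 + 1 / (p : ℝ) ≤ Real.exp (1 / (p : ℝ)) := by
            rw [add_comm]; exact Real.add_one_le_exp _
          generalize 1 / (p : ℝ) = t at *
          nlinarith [mul_le_mul h5 h5 (by linarith) (by linarith), mul_nonneg h4.le h4.le,
            mul_nonneg h4.le (mul_nonneg h4.le h4.le)]
    _ = (Real.exp (∑ p ∈ q.primeFactors, 1 / (p : ℝ))) ^ 2 := by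
        rw [prod_pow, ← Real.exp_sum]
    _ ≤ _ := by
        have := Real.exp_le_exp.2 (sum_inv_primeFactors_le hJ hqJ)
        gcongr

/-- Moments of the deviation for a modulus free of large prime factors. -/
theorem abs_sum_coprimeDeviation_pow_le_of_smooth {q J : ℕ} (hq : Squarefree q) (hJ : 0 < J)
    (hqJ : ∀ p ∈ q.primeFactors, p ≤ 2 ^ J) (K H m k : ℕ) (hH : H ≤ 2 ^ K) (hm : m ≤ k) :
    |∑ n ∈ range q, coprimeDeviation q H n ^ m| ≤
      q * ((((K : ℝ) + 1) * (Real.exp 5 * (J : ℝ) ^ 4)) ^ 2 ^ k *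
        (18 * 2 ^ 2 ^ k * (K + 1)) ^ k * 2 ^ (K * (m / 2))) := by
  refine (abs_sum_coprimeDeviation_pow_le hq K H m hH).trans ?_
  refine mul_le_mul_of_nonneg_left ?_ (Nat.cast_nonneg _)
  refine (sum_integralTuples_le (Fin m) hq K).trans ?_
  rw [Fintype.card_finset, Fintype.card_fin]
  have hJ1 : (1 : ℝ) ≤ J := by exact_mod_cast hJ
  have hE : (1 : ℝ) ≤ Real.exp 5 * (J : ℝ) ^ 4 :=
    one_le_mul_of_one_le_of_one_le (Real.one_le_exp (by norm_num)) (one_le_pow₀ hJ1)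
  have hK : (1 : ℝ) ≤ (K : ℝ) + 1 := by linarith [Nat.cast_nonneg (α := ℝ) K]
  have hN : 2 ^ m ≤ 2 ^ k := Nat.pow_le_pow_right (by norm_num) hm
  have hW := sum_inv_divisors_le hq hJ hqJ
  have hW0 : 0 ≤ ∑ d ∈ q.divisors, (1 : ℝ) / d := sum_nonneg fun _ _ => by positivity
  have h18 : (1 : ℝ) ≤ 18 * 2 ^ 2 ^ k * (K + 1) := by
    have : (1 : ℝ) ≤ 2 ^ 2 ^ k := one_le_pow₀ (by norm_num)
    nlinarith
  have a1 : ((K : ℝ) + 1) ^ 2 ^ m ≤ ((K : ℝ) + 1) ^ 2 ^ k := pow_le_pow_right₀ hK hN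
  have a2 : (∑ d ∈ q.divisors, (1 : ℝ) / d) ^ 2 ^ m ≤ (Real.exp 5 * (J : ℝ) ^ 4) ^ 2 ^ k :=
    (pow_le_pow_left₀ hW0 hW _).trans (pow_le_pow_right₀ hE hN)
  have a3 : (18 * 2 ^ 2 ^ m * ((K : ℝ) + 1)) ^ m ≤ (18 * 2 ^ 2 ^ k * ((K : ℝ) + 1)) ^ k := by
    refine (pow_le_pow_left₀ (by positivity) ?_ m).trans (pow_le_pow_right₀ h18 hm)
    have : (2 : ℝ) ^ 2 ^ m ≤ 2 ^ 2 ^ k := pow_le_pow_right₀ (by norm_num) hN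
    gcongr
  calc _ ≤ ((K : ℝ) + 1) ^ 2 ^ k * ((18 * 2 ^ 2 ^ k * ((K : ℝ) + 1)) ^ k * 2 ^ (K * (m / 2)) *
        (Real.exp 5 * (J : ℝ) ^ 4) ^ 2 ^ k) := by gcongr
    _ = _ := by rw [mul_pow ((K : ℝ) + 1)]; ring

/-! ### Central moments of the binomial distribution -/

section binomial

/-- The expectation of `f X` for a binomial variable `X` with `N` trials of success
probability `P`. -/
noncomputable def binomExp (P : ℝ) : ℕ → (ℕ → ℝ) → ℝ
  | 0, f => f 0
  | N + 1, f => P * binomExp P N (fun x => f (x + 1)) + (1 - P) * binomExp P N f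

theorem binomExp_sum (P : ℝ) (N : ℕ) {α : Type*} (s : Finset α) (c : α → ℝ) (f : α → ℕ → ℝ) :
    binomExp P N (fun x => ∑ i ∈ s, c i * f i x) = ∑ i ∈ s, c i * binomExp P N (f i) := by
  induction N generalizing f with
  | zero => rfl
  | succ N ih =>
    simp only [binomExp]
    rw [ih f, ih (fun i x => f i (x + 1)), mul_sum, mul_sum, ← sum_add_distrib]
    refine sum_congr rfl fun i _ => ?_
    ring

/-- The factorial moments of the binomial distribution. -/
theorem binomExp_choose (P : ℝ) (N s : ℕ) :
    binomExp P N (fun x => (x.choose s : ℝ)) = N.choose s * P ^ s := by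
  induction N generalizing s with
  | zero => cases s <;> simp [binomExp]
  | succ N ih =>
    simp only [binomExp]
    cases s with
    | zero =>
      have := ih 0
      simp only [Nat.choose_zero_right] at this ⊢
      rw [this]
      ring
    | succ s =>
      have h1 : (fun x : ℕ => (((x + 1).choose (s + 1) : ℕ) : ℝ)) =
          fun x => ∑ i ∈ range 2, (1 : ℝ) * ((x.choose (s + i) : ℕ) : ℝ) := by
        funext x
        rw [Nat.choose_succ_succ]
        simp [sum_range_succ]
      rw [h1, binomExp_sum, sum_range_succ, sum_range_one, ih, ih, Nat.choose_succ_succ']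
      simp only [add_zero]
      push_cast
      ring

/-- The central moment of order `t` of a Bernoulli variable with success probability `P`. -/
def bernoulliMoment (P : ℝ) (t : ℕ) : ℝ := P * (1 - P) ^ t + (1 - P) * (-P) ^ t

theorem abs_bernoulliMoment_le {P : ℝ} (h0 : 0 ≤ P) (h1 : P ≤ 1) {t : ℕ} (ht : 0 < t) :
    |bernoulliMoment P t| ≤ 2 * P := by
  have h2 : |1 - P| ≤ 1 := by rw [abs_le]; constructor <;> linarith
  have h3 : |-P| ≤ P := by rw [abs_neg, abs_of_nonneg h0]
  have h4 : |(1 - P) ^ t| ≤ 1 := by rw [abs_pow]; exact pow_le_one₀ (abs_nonneg _) h2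
  have h5 : |(-P) ^ t| ≤ P := by
    rw [abs_pow, abs_neg, abs_of_nonneg h0]
    exact pow_le_of_le_one h0 h1 ht.ne'
  unfold bernoulliMoment
  calc _ ≤ |P * (1 - P) ^ t| + |(1 - P) * (-P) ^ t| := abs_add_le _ _
    _ ≤ P * 1 + 1 * P := by
        rw [abs_mul, abs_mul, abs_of_nonneg h0]
        gcongr
    _ = _ := by ring

/-- The coefficient of `N.choose s` in the central moment of order `r` of the binomial distribution
with `N` trials. -/
noncomputable def centralCoeff (P : ℝ) : ℕ → ℕ → ℝ
  | 0, r => if r = 0 then 1 else 0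
  | s + 1, r => ∑ t ∈ Icc 2 r, r.choose t * bernoulliMoment P t * centralCoeff P s (r - t)

theorem centralCoeff_eq_zero (P : ℝ) {s r : ℕ} (h : r < 2 * s) : centralCoeff P s r = 0 := by
  induction s generalizing r with
  | zero => omega
  | succ s ih =>
    rw [centralCoeff]
    refine sum_eq_zero fun t ht => ?_
    obtain ⟨h1, h2⟩ := mem_Icc.1 ht
    rw [ih (by omega), mul_zero]

theorem abs_centralCoeff_le {P : ℝ} (h0 : 0 ≤ P) (h1 : P ≤ 1) (s r : ℕ) :
    |centralCoeff P s r| ≤ (2 ^ (r + 1) * P) ^ s := by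
  induction s generalizing r with
  | zero =>
    rw [centralCoeff, pow_zero]
    split_ifs <;> simp
  | succ s ih =>
    rw [centralCoeff]
    refine (abs_sum_le_sum_abs _ _).trans ?_
    calc _ ≤ ∑ t ∈ Icc 2 r, (r.choose t : ℝ) * (2 * P * (2 ^ (r + 1) * P) ^ s) := by
          refine sum_le_sum fun t ht => ?_
          obtain ⟨h2, h3⟩ := mem_Icc.1 ht
          rw [abs_mul, abs_mul, Nat.abs_cast, mul_assoc]
          have h4 := abs_bernoulliMoment_le h0 h1 (t := t) (by omega)
          have h5 : (2 ^ (r - t + 1) * P) ^ s ≤ (2 ^ (r + 1) * P) ^ s := by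
            have : (2 : ℝ) ^ (r - t + 1) ≤ 2 ^ (r + 1) :=
              pow_le_pow_right₀ (by norm_num) (by omega)
            gcongr
          have h6 := (ih (r - t)).trans h5
          gcongr
      _ = ((∑ t ∈ Icc 2 r, r.choose t : ℕ) : ℝ) * (2 * P * (2 ^ (r + 1) * P) ^ s) := by
          push_cast
          rw [sum_mul]
      _ ≤ ((2 ^ r : ℕ) : ℝ) * (2 * P * (2 ^ (r + 1) * P) ^ s) := by
          have : ∑ t ∈ Icc 2 r, r.choose t ≤ 2 ^ r := by
            rw [← Nat.sum_range_choose]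
            refine sum_le_sum_of_subset fun t ht => ?_
            have := (mem_Icc.1 ht).2
            exact mem_range.2 (by omega)
          gcongr
      _ = _ := by
          push_cast
          rw [pow_succ _ s, pow_succ 2 r]
          ring

/-- The central moments of the binomial distribution are polynomials of low degree in the number
of trials. -/
theorem binomExp_central (P : ℝ) (M N r : ℕ) (hr : r < M) :
    binomExp P N (fun x => ((x : ℝ) - P * N) ^ r) =
      ∑ s ∈ range M, centralCoeff P s r * N.choose s := by
  induction N generalizing r with
  | zero =>
    obtain ⟨M, rfl⟩ := Nat.exists_eq_succ_of_ne_zero (by omega : M ≠ 0)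
    rw [sum_range_succ']
    simp [binomExp, centralCoeff, zero_pow_eq]
  | succ N ih =>
    have e1 : ∀ u : ℝ, binomExp P N (fun x => (u + ((x : ℝ) - P * N)) ^ r) =
        ∑ t ∈ range (r + 1), (u ^ t * r.choose t) *
          ∑ s ∈ range M, centralCoeff P s (r - t) * N.choose s := by
      intro u
      have h1 : (fun x : ℕ => (u + ((x : ℝ) - P * N)) ^ r) = fun x : ℕ =>
          ∑ t ∈ range (r + 1), (u ^ t * r.choose t) * ((x : ℝ) - P * N) ^ (r - t) := by
        funext x
        rw [add_pow]
        refine sum_congr rfl fun t _ => ?_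
        ring
      rw [h1, binomExp_sum]
      refine sum_congr rfl fun t _ => ?_
      rw [ih (r - t) (by omega)]
    have e2 : binomExp P (N + 1) (fun x => ((x : ℝ) - P * (N + 1 : ℕ)) ^ r) =
        ∑ t ∈ range (r + 1), (r.choose t * bernoulliMoment P t) *
          ∑ s ∈ range M, centralCoeff P s (r - t) * N.choose s := by
      have h1 : (fun x : ℕ => (((x + 1 : ℕ) : ℝ) - P * (N + 1 : ℕ)) ^ r) =
          fun x : ℕ => ((1 - P) + ((x : ℝ) - P * N)) ^ r := by
        funext x; push_cast; congr 1; ring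
      have h2 : (fun x : ℕ => ((x : ℝ) - P * (N + 1 : ℕ)) ^ r) =
          fun x : ℕ => (-P + ((x : ℝ) - P * N)) ^ r := by
        funext x; push_cast; congr 1; ring
      simp only [binomExp]
      rw [h1, h2, e1, e1, mul_sum, mul_sum, ← sum_add_distrib]
      refine sum_congr rfl fun t _ => ?_
      unfold bernoulliMoment
      ring
    rw [e2]
    -- the linear term vanishes, since the variable is centered
    have e3 : ∑ t ∈ range (r + 1), (r.choose t * bernoulliMoment P t) *
          ∑ s ∈ range M, centralCoeff P s (r - t) * N.choose s =
        ∑ s ∈ range M, centralCoeff P s r * N.choose s +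
          ∑ s ∈ range M, centralCoeff P (s + 1) r * N.choose s := by
      have h1 : insert 0 (Icc 2 r) ⊆ range (r + 1) := by
        intro t ht
        rcases mem_insert.1 ht with rfl | ht
        · exact mem_range.2 (Nat.succ_pos r)
        · have := (mem_Icc.1 ht).2
          exact mem_range.2 (by omega)
      rw [← sum_subset h1, sum_insert]
      · congr 1
        · simp [bernoulliMoment]
        · simp only [centralCoeff]
          simp_rw [mul_sum, sum_mul]
          rw [sum_comm]
          refine sum_congr rfl fun s _ => sum_congr rfl fun t _ => ?_
          ring
      · simp
      · intro t ht ht'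
        have h2 := mem_range.1 ht
        have h3 : t = 1 := by
          by_contra hne
          refine ht' ?_
          rcases Nat.eq_zero_or_pos t with rfl | hpos
          · exact mem_insert_self _ _
          · exact mem_insert_of_mem (mem_Icc.2 ⟨by omega, by omega⟩)
        subst h3
        have : bernoulliMoment P 1 = 0 := by unfold bernoulliMoment; ring
        rw [this, mul_zero, zero_mul]
    rw [e3]
    obtain ⟨M, rfl⟩ := Nat.exists_eq_succ_of_ne_zero (by omega : M ≠ 0)
    rw [sum_range_succ' (fun s => centralCoeff P s r * ((N + 1).choose s : ℝ)),
      sum_range_succ' (fun s => centralCoeff P s r * (N.choose s : ℝ)),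
      sum_range_succ (fun s => centralCoeff P (s + 1) r * (N.choose s : ℝ)),
      centralCoeff_eq_zero P (s := M + 1) (by omega)]
    simp only [Nat.choose_succ_succ, Nat.choose_zero_right]
    push_cast
    simp only [mul_add, sum_add_distrib]
    ring

/-- The coefficients of `x ^ i` in the basis of binomial polynomials. -/
def powCoeff : ℕ → ℕ → ℕ
  | 0, 0 => 1
  | 0, _ + 1 => 0
  | _ + 1, 0 => 0
  | i + 1, s + 1 => (s + 1) * (powCoeff i s + powCoeff i (s + 1))

theorem powCoeff_eq_zero {i s : ℕ} (h : i < s) : powCoeff i s = 0 := by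
  induction i generalizing s with
  | zero =>
    obtain ⟨s, rfl⟩ := Nat.exists_eq_succ_of_ne_zero h.ne'
    rfl
  | succ i ih =>
    obtain ⟨s, rfl⟩ := Nat.exists_eq_succ_of_ne_zero (by omega : s ≠ 0)
    rw [powCoeff, ih (by omega), ih (by omega), add_zero, mul_zero]

theorem pow_eq_sum_choose (x i M : ℕ) (h : i < M) :
    x ^ i = ∑ s ∈ range M, powCoeff i s * x.choose s := by
  induction i generalizing M with
  | zero =>
    obtain ⟨M, rfl⟩ := Nat.exists_eq_succ_of_ne_zero h.ne'
    rw [sum_range_succ', sum_eq_zero (fun s _ => by simp [powCoeff])]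
    simp [powCoeff]
  | succ i ih =>
    obtain ⟨M, rfl⟩ := Nat.exists_eq_succ_of_ne_zero (by omega : M ≠ 0)
    have hx : ∀ s, x.choose s * x = (s + 1) * x.choose (s + 1) + s * x.choose s := by
      intro s
      rcases le_or_gt s x with hs | hs
      · have h1 := Nat.choose_succ_right_eq x s
        obtain ⟨d, rfl⟩ := Nat.exists_eq_add_of_le hs
        rw [Nat.add_sub_cancel_left] at h1
        rw [mul_comm (s + 1), h1]
        ring
      · simp [Nat.choose_eq_zero_of_lt hs, Nat.choose_eq_zero_of_lt (Nat.lt_succ_of_lt hs)]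
    rw [pow_succ, ih (M + 1) (by omega), sum_mul,
      sum_range_succ' (fun s => powCoeff (i + 1) s * x.choose s)]
    simp only [powCoeff, zero_mul, add_zero]
    have h1 : ∀ s, powCoeff i s * x.choose s * x =
        (s + 1) * powCoeff i s * x.choose (s + 1) + s * powCoeff i s * x.choose s := by
      intro s
      rw [mul_assoc, hx]
      ring
    simp_rw [h1]
    rw [sum_add_distrib, sum_range_succ,
      sum_range_succ' (fun s => s * powCoeff i s * x.choose s),
      powCoeff_eq_zero (s := M) (by omega)]
    simp only [mul_zero, zero_mul, add_zero]
    rw [← sum_add_distrib]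
    refine sum_congr rfl fun s _ => ?_
    ring

/-- If the factorial moments of a random variable are close to those of a binomial variable, then
so are the central moments. -/
theorem abs_average_sub_binomExp_le {α : Type*} (Ω : Finset α) (B : α → ℕ) (V P ε : ℝ)
    (hP0 : 0 ≤ P) (hP1 : P ≤ 1) (N r : ℕ) (ρ : ℕ → ℝ)
    (hB : ∀ s ≤ r, ∑ y ∈ Ω, ((B y).choose s : ℝ) = V * (N.choose s * ρ s)) (hV : 0 ≤ V)
    (hρ : ∀ s ≤ r, |ρ s - P ^ s| ≤ ε) :
    |∑ y ∈ Ω, ((B y : ℝ) - P * N) ^ r - V * binomExp P N (fun x => ((x : ℝ) - P * N) ^ r)| ≤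
      V * ((2 * N) ^ r * ε) := by
  have hexp : ∀ x : ℕ, ((x : ℝ) - P * N) ^ r = ∑ i ∈ range (r + 1), ∑ s ∈ range (r + 1),
      ((-(P * N)) ^ (r - i) * r.choose i * powCoeff i s) * x.choose s := by
    intro x
    rw [sub_eq_add_neg, add_pow]
    refine sum_congr rfl fun i hi => ?_
    have h1 : ((x : ℝ)) ^ i = ∑ s ∈ range (r + 1), (powCoeff i s : ℝ) * x.choose s := by
      have := pow_eq_sum_choose x i (r + 1) (mem_range.1 hi)
      exact_mod_cast this
    rw [h1, sum_mul, sum_mul]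
    refine sum_congr rfl fun s _ => ?_
    ring
  have e1 : ∑ y ∈ Ω, ((B y : ℝ) - P * N) ^ r = V * ∑ i ∈ range (r + 1), ∑ s ∈ range (r + 1),
      ((-(P * N)) ^ (r - i) * r.choose i * powCoeff i s) * (N.choose s * ρ s) := by
    simp_rw [hexp]
    rw [sum_comm, mul_sum]
    refine sum_congr rfl fun i _ => ?_
    rw [sum_comm, mul_sum]
    refine sum_congr rfl fun s hs => ?_
    rw [← mul_sum, hB s (Nat.lt_succ_iff.1 (mem_range.1 hs))]
    ring
  have e2 : binomExp P N (fun x => ((x : ℝ) - P * N) ^ r) =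
      ∑ i ∈ range (r + 1), ∑ s ∈ range (r + 1),
      ((-(P * N)) ^ (r - i) * r.choose i * powCoeff i s) * (N.choose s * P ^ s) := by
    simp_rw [hexp, ← sum_product']
    rw [binomExp_sum P N (range (r + 1) ×ˢ range (r + 1))
      (fun z => (-(P * N)) ^ (r - z.1) * r.choose z.1 * powCoeff z.1 z.2)
      (fun z x => (x.choose z.2 : ℝ))]
    simp_rw [binomExp_choose]
  rw [e1, e2, ← mul_sub, abs_mul, abs_of_nonneg hV]
  refine mul_le_mul_of_nonneg_left ?_ hV
  rw [← sum_sub_distrib]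
  have hN : (0 : ℝ) ≤ N := Nat.cast_nonneg _
  calc _ ≤ ∑ i ∈ range (r + 1), ∑ s ∈ range (r + 1),
        (N : ℝ) ^ (r - i) * r.choose i * powCoeff i s * N.choose s * ε := by
        refine (abs_sum_le_sum_abs _ _).trans (sum_le_sum fun i _ => ?_)
        rw [← sum_sub_distrib]
        refine (abs_sum_le_sum_abs _ _).trans (sum_le_sum fun s hs => ?_)
        have h1 : ((-(P * N)) ^ (r - i) * r.choose i * powCoeff i s) * (N.choose s * ρ s) -
            ((-(P * N)) ^ (r - i) * r.choose i * powCoeff i s) * (N.choose s * P ^ s) =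
            (-(P * N)) ^ (r - i) * (r.choose i * powCoeff i s * N.choose s * (ρ s - P ^ s)) := by
          ring
        have h2 : |(-(P * N)) ^ (r - i)| ≤ (N : ℝ) ^ (r - i) := by
          rw [abs_pow, abs_neg, abs_of_nonneg (by positivity)]
          exact pow_le_pow_left₀ (by positivity) (mul_le_of_le_one_left hN hP1) _
        rw [h1, abs_mul, abs_mul, abs_of_nonneg (by positivity :
          (0 : ℝ) ≤ r.choose i * powCoeff i s * N.choose s)]
        calc _ ≤ (N : ℝ) ^ (r - i) * (r.choose i * powCoeff i s * N.choose s * ε) := by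
              have := hρ s (Nat.lt_succ_iff.1 (mem_range.1 hs))
              gcongr
          _ = _ := by ring
    _ = ∑ i ∈ range (r + 1), (N : ℝ) ^ i * N ^ (r - i) * r.choose i * ε := by
        refine sum_congr rfl fun i hi => ?_
        have h1 : ((N : ℝ)) ^ i = ∑ s ∈ range (r + 1), (powCoeff i s : ℝ) * N.choose s := by
          have := pow_eq_sum_choose N i (r + 1) (mem_range.1 hi)
          exact_mod_cast this
        rw [h1, sum_mul, sum_mul, sum_mul]
        refine sum_congr rfl fun s _ => ?_
        ring
    _ = _ := by
        rw [← sum_mul, ← add_pow, two_mul]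

end binomial

/-! ### Moduli with only large prime factors -/

theorem sum_range_mul_of_coprime {a b : ℕ} (ha : 0 < a) (hb : 0 < b) (hab : Nat.Coprime a b)
    (F : ℕ → ℕ → ℝ) :
    ∑ n ∈ range (a * b), F (n % a) (n % b) = ∑ x ∈ range a, ∑ y ∈ range b, F x y := by
  rw [← sum_product']
  refine sum_bij (fun n _ => (n % a, n % b)) ?_ ?_ ?_ ?_
  · intro n _
    exact mem_product.2 ⟨mem_range.2 (Nat.mod_lt _ ha), mem_range.2 (Nat.mod_lt _ hb)⟩
  · intro m hm n hn h
    obtain ⟨h1, h2⟩ := Prod.mk.inj h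
    have h3 : m ≡ n [MOD a * b] := (Nat.modEq_and_modEq_iff_modEq_mul hab).1 ⟨h1, h2⟩
    exact Nat.ModEq.eq_of_lt_of_lt h3 (mem_range.1 hm) (mem_range.1 hn)
  · rintro ⟨x, y⟩ hxy
    obtain ⟨hx, hy⟩ := mem_product.1 hxy
    have hx := mem_range.1 hx
    have hy := mem_range.1 hy
    refine ⟨Nat.chineseRemainder hab x y,
      mem_range.2 (Nat.chineseRemainder_lt_mul hab x y ha.ne' hb.ne'), ?_⟩
    have h1 := (Nat.chineseRemainder hab x y).2
    ext
    · exact Eq.trans (show _ % a = x % a from h1.1) (Nat.mod_eq_of_lt hx)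
    · exact Eq.trans (show _ % b = y % b from h1.2) (Nat.mod_eq_of_lt hy)
  · intro n _
    rfl

theorem coprime_mod_add (n j q : ℕ) : Nat.Coprime (n % q + j) q ↔ Nat.Coprime (n + j) q := by
  have h : (n % q + j) % q = (n + j) % q := by simp
  have h1 : ∀ m, Nat.Coprime m q ↔ Nat.Coprime (m % q) q := by
    intro m
    unfold Nat.Coprime
    rw [Nat.gcd_comm m, Nat.gcd_comm (m % q), Nat.gcd_comm q (m % q), ← Nat.gcd_rec]
  rw [h1 (n % q + j), h1 (n + j), h]

/-- The number of residues `y` modulo `q` for which all `y + j`, `j ∈ T`, are coprime to `q`. -/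
noncomputable def coprimePatternCount (q : ℕ) (T : Finset ℕ) : ℝ :=
  ∑ y ∈ range q, if ∀ j ∈ T, Nat.Coprime (y + j) q then (1 : ℝ) else 0

theorem coprimePatternCount_mul {a b : ℕ} (ha : 0 < a) (hb : 0 < b) (hab : Nat.Coprime a b)
    (T : Finset ℕ) :
    coprimePatternCount (a * b) T = coprimePatternCount a T * coprimePatternCount b T := by
  unfold coprimePatternCount
  rw [sum_mul_sum, ← sum_range_mul_of_coprime ha hb hab (fun x y =>
    (if ∀ j ∈ T, Nat.Coprime (x + j) a then (1 : ℝ) else 0) *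
    (if ∀ j ∈ T, Nat.Coprime (y + j) b then (1 : ℝ) else 0))]
  refine sum_congr rfl fun n _ => ?_
  simp only [coprime_mod_add, Nat.coprime_mul_iff_right]
  by_cases h1 : ∀ j ∈ T, Nat.Coprime (n + j) a <;> by_cases h2 : ∀ j ∈ T, Nat.Coprime (n + j) b
  · rw [if_pos h1, if_pos h2, if_pos fun j hj => ⟨h1 j hj, h2 j hj⟩, mul_one]
  · rw [if_neg h2, if_neg fun h => h2 fun j hj => (h j hj).2, mul_zero]
  · rw [if_neg h1, if_neg fun h => h1 fun j hj => (h j hj).1, zero_mul]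
  · rw [if_neg h1, if_neg fun h => h1 fun j hj => (h j hj).1, zero_mul]

theorem coprimePatternCount_prime {p : ℕ} (hp : p.Prime) (T : Finset ℕ) (hT : ∀ j ∈ T, j < p) :
    coprimePatternCount p T = p - T.card := by
  unfold coprimePatternCount
  rw [sum_boole]
  have h1 : (range p).filter (fun y => ¬ ∀ j ∈ T, Nat.Coprime (y + j) p) =
      T.image fun j => (p - j) % p := by
    ext y
    simp only [mem_filter, mem_range, mem_image]
    push Not
    constructor
    · rintro ⟨hy, j, hj, hc⟩
      have hjp := hT j hj
      rw [Nat.gcd_comm] at hc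
      replace hc := hp.dvd_iff_not_coprime.2 hc
      obtain ⟨c, hc⟩ := hc
      refine ⟨j, hj, ?_⟩
      have hc2 : c < 2 := by
        by_contra h
        have : p * 2 ≤ p * c := Nat.mul_le_mul_left p (not_lt.1 h)
        omega
      interval_cases c
      · have : j = 0 := by omega
        have : y = 0 := by omega
        subst_vars
        simp
      · have : p - j = y := by omega
        rw [this, Nat.mod_eq_of_lt hy]
    · rintro ⟨j, hj, rfl⟩
      have hjp := hT j hj
      refine ⟨Nat.mod_lt _ hp.pos, j, hj, ?_⟩
      rw [Nat.gcd_comm]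
      refine hp.dvd_iff_not_coprime.1 ?_
      have : (p - j) % p + j ≡ (p - j) + j [MOD p] := Nat.ModEq.add_right j (Nat.mod_modEq _ _)
      rw [Nat.sub_add_cancel hjp.le] at this
      exact (Nat.modEq_zero_iff_dvd).1 (this.trans (by simp [Nat.ModEq]))
  have h2 : (T.image fun j => (p - j) % p).card = T.card := by
    refine card_image_of_injOn fun i hi j hj h => ?_
    have hi' := hT i hi
    have hj' := hT j hj
    have h : (p - i) % p = (p - j) % p := h
    rcases Nat.eq_zero_or_pos i with rfl | hi0 <;> rcases Nat.eq_zero_or_pos j with rfl | hj0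
    · rfl
    · rw [Nat.sub_zero, Nat.mod_self, Nat.mod_eq_of_lt (by omega)] at h
      omega
    · rw [Nat.sub_zero, Nat.mod_self, Nat.mod_eq_of_lt (by omega)] at h
      omega
    · rw [Nat.mod_eq_of_lt (by omega), Nat.mod_eq_of_lt (by omega)] at h
      omega
  have h3 := card_filter_add_card_filter_not (s := range p)
    (fun y => ∀ j ∈ T, Nat.Coprime (y + j) p)
  rw [h1, h2, card_range] at h3
  rw [eq_sub_iff_add_eq]
  exact_mod_cast h3

/-- By the Chinese remainder theorem, a pattern that is injective modulo each prime factor of `q`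
omits exactly `T.card` residues for each of them. -/
theorem coprimePatternCount_eq {q : ℕ} (hq : Squarefree q) (T : Finset ℕ)
    (hT : ∀ p ∈ q.primeFactors, ∀ j ∈ T, j < p) :
    coprimePatternCount q T = q * ∏ p ∈ q.primeFactors, (1 - (T.card : ℝ) / p) := by
  have key : ∀ s : Finset ℕ, (∀ p ∈ s, p.Prime ∧ ∀ j ∈ T, j < p) →
      coprimePatternCount (∏ p ∈ s, p) T = ((∏ p ∈ s, p : ℕ) : ℝ) *
        ∏ p ∈ s, (1 - (T.card : ℝ) / p) := by
    intro s
    induction s using Finset.induction_on with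
    | empty =>
      intro _
      simp [coprimePatternCount]
    | insert p s hps ih =>
      intro h
      have hp := (h p (mem_insert_self _ _)).1
      have hs : ∀ l ∈ s, l.Prime := fun l hl => (h l (mem_insert_of_mem hl)).1
      have hcop : Nat.Coprime p (∏ l ∈ s, l) := by
        refine Nat.Coprime.prod_right fun l hl => ?_
        refine (Nat.coprime_primes hp (hs l hl)).2 ?_
        rintro rfl
        exact hps hl
      have hp0 : (p : ℝ) ≠ 0 := by exact_mod_cast hp.ne_zero
      rw [prod_insert hps, prod_insert hps, coprimePatternCount_mul hp.pos
        (prod_pos fun l hl => (hs l hl).pos) hcop,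
        coprimePatternCount_prime hp T (h p (mem_insert_self _ _)).2,
        ih fun l hl => h l (mem_insert_of_mem hl)]
      push_cast
      field_simp
  have h := key q.primeFactors fun p hp => ⟨Nat.prime_of_mem_primeFactors hp, hT p hp⟩
  rwa [Nat.prod_primeFactors_of_squarefree hq] at h

/-- Factorial moments of the number of elements of `S` that survive a random shift. -/
theorem sum_choose_card_coprime {q : ℕ} (hq : Squarefree q) (S : Finset ℕ)
    (hS : ∀ p ∈ q.primeFactors, ∀ j ∈ S, j < p) (s : ℕ) :
    ∑ y ∈ range q, ((((S.filter fun j => Nat.Coprime (y + j) q).card).choose s : ℕ) : ℝ) =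
      q * (S.card.choose s * ∏ p ∈ q.primeFactors, (1 - (s : ℝ) / p)) := by
  have h1 : ∀ y, ((((S.filter fun j => Nat.Coprime (y + j) q).card).choose s : ℕ) : ℝ) =
      ∑ T ∈ powersetCard s S, if ∀ j ∈ T, Nat.Coprime (y + j) q then (1 : ℝ) else 0 := by
    intro y
    rw [sum_boole, ← card_powersetCard]
    congr 2
    ext T
    simp only [mem_powersetCard, mem_filter, subset_iff]
    constructor
    · rintro ⟨h, h'⟩
      exact ⟨⟨fun j hj => (h hj).1, h'⟩, fun j hj => (h hj).2⟩
    · rintro ⟨⟨h, h'⟩, h''⟩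
      exact ⟨fun j hj => ⟨h hj, h'' j hj⟩, h'⟩
  simp_rw [h1]
  rw [sum_comm]
  have h2 : ∀ T ∈ powersetCard s S,
      ∑ y ∈ range q, (if ∀ j ∈ T, Nat.Coprime (y + j) q then (1 : ℝ) else 0) =
        q * ∏ p ∈ q.primeFactors, (1 - (s : ℝ) / p) := by
    intro T hT
    obtain ⟨h3, h4⟩ := mem_powersetCard.1 hT
    have := coprimePatternCount_eq hq T fun p hp j hj => hS p hp j (h3 hj)
    rw [h4] at this
    exact this
  rw [sum_congr rfl h2, sum_const, card_powersetCard, nsmul_eq_mul]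
  ring

theorem one_sub_pow_le (x : ℝ) (h0 : 0 ≤ x) (h1 : x ≤ 1) (s : ℕ) :
    (1 - x) ^ s ≤ 1 - s * x + (s * x) ^ 2 := by
  induction s with
  | zero => simp
  | succ s ih =>
    rw [pow_succ]
    push_cast
    have h2 := mul_le_mul_of_nonneg_right ih (by linarith : 0 ≤ 1 - x)
    have hs : (0 : ℝ) ≤ s := Nat.cast_nonneg s
    have h3 : 0 ≤ (s : ℝ) * x ^ 2 := by positivity
    have h4 : 0 ≤ (s * x) ^ 2 * x := by positivity
    nlinarith [sq_nonneg x]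

theorem one_sub_sum_le_prod {α : Type*} (s : Finset α) (e : α → ℝ) (h0 : ∀ i ∈ s, 0 ≤ e i)
    (h1 : ∀ i ∈ s, e i ≤ 1) : 1 - ∑ i ∈ s, e i ≤ ∏ i ∈ s, (1 - e i) := by
  classical
  induction s using Finset.induction_on with
  | empty => simp
  | insert a s ha ih =>
    rw [sum_insert ha, prod_insert ha]
    have h2 := ih (fun i hi => h0 i (mem_insert_of_mem hi)) fun i hi => h1 i (mem_insert_of_mem hi)
    have h3 := h0 a (mem_insert_self _ _)
    have h4 := h1 a (mem_insert_self _ _)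
    have h5 : 0 ≤ ∑ i ∈ s, e i := sum_nonneg fun i hi => h0 i (mem_insert_of_mem hi)
    nlinarith [mul_le_mul_of_nonneg_left h2 (by linarith : 0 ≤ 1 - e a), mul_nonneg h3 h5]

/-- For a modulus with only large prime factors, coprimality at `s` distinct points is nearly
independent. -/
theorem abs_prod_sub_density_pow_le {q Y k : ℕ} (hq : q ≠ 0) (hY : 2 * k ≤ Y) (hY0 : 0 < Y)
    (hqY : ∀ p ∈ q.primeFactors, Y < p) (s : ℕ) (hs : s ≤ k) :
    |∏ p ∈ q.primeFactors, (1 - (s : ℝ) / p) - coprimeDensity q ^ s| ≤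
      coprimeDensity q * (2 * k ^ 2 / Y) := by
  have hP0 := (coprimeDensity_pos hq).le
  have hP1 := coprimeDensity_le_one q
  rcases Nat.eq_zero_or_pos s with rfl | hs0
  · simp only [Nat.cast_zero, zero_div, sub_zero, prod_const_one, pow_zero, sub_self, abs_zero]
    positivity
  have hY' : (0 : ℝ) < Y := by exact_mod_cast hY0
  have hkY : 2 * (k : ℝ) ≤ Y := by exact_mod_cast hY
  have hsk : (s : ℝ) ≤ k := by exact_mod_cast hs
  have hx : ∀ p ∈ q.primeFactors,
      0 ≤ 1 / (p : ℝ) ∧ 1 / (p : ℝ) ≤ 1 ∧ s * (1 / (p : ℝ)) ≤ 1 / 2 := by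
    intro p hp
    have h1 : (Y : ℝ) < p := by exact_mod_cast hqY p hp
    have h2 : (1 : ℝ) ≤ p := by exact_mod_cast (Nat.prime_of_mem_primeFactors hp).one_le
    have h3 : (0 : ℝ) < p := by linarith
    refine ⟨by positivity, ?_, ?_⟩
    · rw [div_le_one h3]; exact h2
    · rw [mul_one_div, div_le_div_iff₀ h3 (by norm_num)]
      linarith
  have hprod : coprimeDensity q ^ s = ∏ p ∈ q.primeFactors, (1 - 1 / (p : ℝ)) ^ s := by
    rw [coprimeDensity_eq_prod hq, prod_pow]
  have hle : ∏ p ∈ q.primeFactors, (1 - (s : ℝ) / p) ≤ coprimeDensity q ^ s := by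
    rw [hprod]
    refine prod_le_prod (fun p hp => ?_) fun p hp => ?_
    · have := (hx p hp).2.2
      rw [mul_one_div] at this
      linarith
    · have h := one_add_mul_le_pow (a := -(1 / (p : ℝ))) (by linarith [(hx p hp).2.1]) s
      have e1 : 1 + (s : ℝ) * -(1 / (p : ℝ)) = 1 - s / p := by ring
      have e2 : 1 + -(1 / (p : ℝ)) = 1 - 1 / p := by ring
      rwa [e1, e2] at h
  set e : ℕ → ℝ := fun p => 2 * (s * (1 / (p : ℝ))) ^ 2 with he
  have he0 : ∀ p ∈ q.primeFactors, 0 ≤ e p := fun p _ => by positivity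
  have he1 : ∀ p ∈ q.primeFactors, e p ≤ 1 := by
    intro p hp
    obtain ⟨h1, -, h3⟩ := hx p hp
    have h4 : 0 ≤ s * (1 / (p : ℝ)) := by positivity
    simp only [he]
    nlinarith
  have hge : coprimeDensity q ^ s * (1 - ∑ p ∈ q.primeFactors, e p) ≤
      ∏ p ∈ q.primeFactors, (1 - (s : ℝ) / p) := by
    calc _ ≤ coprimeDensity q ^ s * ∏ p ∈ q.primeFactors, (1 - e p) := by
          have := one_sub_sum_le_prod q.primeFactors e he0 he1
          gcongr
      _ = ∏ p ∈ q.primeFactors, ((1 - 1 / (p : ℝ)) ^ s * (1 - e p)) := by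
          rw [hprod, prod_mul_distrib]
      _ ≤ _ := by
          refine prod_le_prod (fun p hp => ?_) fun p hp => ?_
          · have h1 := (hx p hp).2.1
            have h2 := he1 p hp
            exact mul_nonneg (pow_nonneg (by linarith) _) (by linarith)
          · obtain ⟨h1, h2, h3⟩ := hx p hp
            have h4 := one_sub_pow_le _ h1 h2 s
            have h5 := mul_le_mul_of_nonneg_right h4 (by linarith [he1 p hp] : 0 ≤ 1 - e p)
            refine h5.trans ?_
            simp only [he]
            have h6 : (s : ℝ) / p = s * (1 / (p : ℝ)) := by ring
            have h7 : 0 ≤ s * (1 / (p : ℝ)) := by positivity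
            rw [h6]
            generalize (s : ℝ) * (1 / (p : ℝ)) = t at *
            nlinarith [mul_nonneg (sq_nonneg t) (by linarith : 0 ≤ 1 / 2 - t),
              mul_nonneg (sq_nonneg t) (sq_nonneg t)]
  have hsum : ∑ p ∈ q.primeFactors, e p ≤ 2 * k ^ 2 / Y := by
    have h1 : ∑ p ∈ q.primeFactors, ((p : ℝ) ^ 2)⁻¹ ≤ 1 / Y := by
      have hsub : q.primeFactors ⊆ Ioc Y (max Y q) := by
        intro p hp
        refine mem_Ioc.2 ⟨hqY p hp, le_max_of_le_right ?_⟩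
        exact Nat.le_of_dvd (Nat.pos_of_ne_zero hq) (Nat.dvd_of_mem_primeFactors hp)
      refine (sum_le_sum_of_subset_of_nonneg hsub fun _ _ _ => by positivity).trans ?_
      refine (sum_Ioc_inv_sq_le_sub hY0.ne' (le_max_left _ _)).trans ?_
      rw [one_div]
      have : (0 : ℝ) ≤ ((max Y q : ℕ) : ℝ)⁻¹ := by positivity
      linarith
    calc ∑ p ∈ q.primeFactors, e p = 2 * s ^ 2 * ∑ p ∈ q.primeFactors, ((p : ℝ) ^ 2)⁻¹ := by
          rw [mul_sum]
          refine sum_congr rfl fun p _ => ?_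
          simp only [he]
          rw [mul_pow, one_div, inv_pow]
          ring
      _ ≤ 2 * k ^ 2 * (1 / Y) := by gcongr
      _ = _ := by ring
  have hPs : coprimeDensity q ^ s ≤ coprimeDensity q := pow_le_of_le_one hP0 hP1 hs0.ne'
  have hPs0 : 0 ≤ coprimeDensity q ^ s := by positivity
  have hes : 0 ≤ ∑ p ∈ q.primeFactors, e p := sum_nonneg he0
  rw [abs_sub_comm, abs_of_nonneg (by linarith)]
  calc _ ≤ coprimeDensity q ^ s * ∑ p ∈ q.primeFactors, e p := by linarith
    _ ≤ _ := by gcongr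

/-! ### Combining small and large prime factors -/

/-- Bounds for the pure moments of `N - u` imply bounds for mixed moments with binomial
coefficients, by `(s + 1) * (N.choose (s + 1)) = (N.choose s) * ((N - u) + (u - s))`. -/
theorem abs_sum_pow_mul_choose_le {α : Type*} (Ω : Finset α) (N : α → ℕ) (u h L : ℝ) (k : ℕ)
    (hu : 0 ≤ u) (huh : u ≤ h) (hh : 1 ≤ h) (hL0 : 0 ≤ L)
    (hL : ∀ m ≤ k, |∑ x ∈ Ω, ((N x : ℝ) - u) ^ m| ≤ L * h ^ (m / 2)) (s m : ℕ) (hms : m + s ≤ k) :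
    |∑ x ∈ Ω, ((N x : ℝ) - u) ^ m * (N x).choose s| ≤ 2 ^ s * (L * h ^ (s + m / 2)) := by
  induction s generalizing m with
  | zero => simpa using hL m (by omega)
  | succ s ih =>
    have hx : ∀ x, ((s : ℝ) + 1) * (((N x : ℝ) - u) ^ m * (N x).choose (s + 1)) =
        ((N x : ℝ) - u) ^ (m + 1) * (N x).choose s +
          (u - s) * (((N x : ℝ) - u) ^ m * (N x).choose s) := by
      intro x
      have h1 : ((N x).choose (s + 1) : ℝ) * (s + 1) = (N x).choose s * ((N x : ℝ) - s) := by
        rcases le_or_gt s (N x) with hs | hs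
        · have := Nat.choose_succ_right_eq (N x) s
          have h2 : (((N x).choose (s + 1) * (s + 1) : ℕ) : ℝ) =
            (((N x).choose s * (N x - s) : ℕ) : ℝ) := by rw [this]
          push_cast [Nat.cast_sub hs] at h2
          exact h2
        · simp [Nat.choose_eq_zero_of_lt hs, Nat.choose_eq_zero_of_lt (Nat.lt_succ_of_lt hs)]
      linear_combination ((N x : ℝ) - u) ^ m * h1
    have hs0 : (0 : ℝ) ≤ s := Nat.cast_nonneg s
    have e1 := ih (m + 1) (by omega)
    have e2 := ih m (by omega)
    have e3 : ((s : ℝ) + 1) * ∑ x ∈ Ω, ((N x : ℝ) - u) ^ m * (N x).choose (s + 1) =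
        ∑ x ∈ Ω, ((N x : ℝ) - u) ^ (m + 1) * (N x).choose s +
          (u - s) * ∑ x ∈ Ω, ((N x : ℝ) - u) ^ m * (N x).choose s := by
      rw [mul_sum, mul_sum, ← sum_add_distrib]
      exact sum_congr rfl fun x _ => hx x
    have e4 : |u - s| ≤ (s + 1) * h := by
      rw [abs_le]
      constructor <;> nlinarith
    set Z := L * h ^ (s + 1 + m / 2) with hZ
    have hZ0 : 0 ≤ Z := by positivity
    have e5 : L * h ^ (s + (m + 1) / 2) ≤ Z := by
      have : h ^ (s + (m + 1) / 2) ≤ h ^ (s + 1 + m / 2) := pow_le_pow_right₀ hh (by omega)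
      exact mul_le_mul_of_nonneg_left this hL0
    have e6 : (s + 1) * h * (2 ^ s * (L * h ^ (s + m / 2))) = (s + 1) * (2 ^ s * Z) := by
      rw [hZ, show s + 1 + m / 2 = (s + m / 2) + 1 by omega, pow_succ]
      ring
    have e7 : |((s : ℝ) + 1) * ∑ x ∈ Ω, ((N x : ℝ) - u) ^ m * (N x).choose (s + 1)| ≤
        2 ^ s * Z + (s + 1) * (2 ^ s * Z) := by
      rw [e3]
      refine (abs_add_le _ _).trans (add_le_add (e1.trans (by gcongr)) ?_)
      rw [abs_mul, ← e6]
      gcongr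
    rw [abs_mul, abs_of_nonneg (by positivity)] at e7
    have e8 : 0 ≤ (s : ℝ) * (2 ^ s * Z) := by positivity
    have e9 : ((s : ℝ) + 1) * |∑ x ∈ Ω, ((N x : ℝ) - u) ^ m * (N x).choose (s + 1)| ≤
        (s + 1) * (2 ^ (s + 1) * Z) := by
      refine e7.trans ?_
      rw [pow_succ]
      linarith
    exact le_of_mul_le_mul_left e9 (by positivity)

/-- The number of integers coprime to `q` among `n, …, n + H - 1`. -/
def windowCount (q H n : ℕ) : ℕ := ((range H).filter fun j => Nat.Coprime (n + j) q).card

theorem coprimeDeviation_eq (q H n : ℕ) :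
    coprimeDeviation q H n = windowCount q H n - coprimeDensity q * H := by
  unfold coprimeDeviation windowCount
  rw [sum_boole]

theorem coprimeDensity_mul {a b : ℕ} (hab : Nat.Coprime a b) :
    coprimeDensity (a * b) = coprimeDensity a * coprimeDensity b := by
  unfold coprimeDensity
  rw [Nat.totient_mul hab]
  push_cast
  rw [mul_div_mul_comm]

/-- The exponents `e = s + ⌊(k - r) / 2⌋` of `P h` that occur satisfy `1 ≤ e ≤ (k - 1) / 2`; the
upper bound is where `k` is required to be odd. -/
theorem pow_mul_pow_le_of_odd {P h : ℝ} {k r s : ℕ} (hk : 3 ≤ k) (hodd : Odd k) (h0 : 0 ≤ P)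
    (h1 : P ≤ 1) (hh : 1 ≤ h) (hr : r ≤ k) (hs : 2 * s ≤ r) (hrs : r = 0 ∨ 0 < s) :
    P ^ (k - r) * P ^ s * h ^ (s + (k - r) / 2) ≤ P * h + (P * h) ^ ((k - 1) / 2) := by
  obtain ⟨l, rfl⟩ := hodd
  set e := s + (2 * l + 1 - r) / 2 with he
  have hX : 0 ≤ P * h := by positivity
  have he1 : 1 ≤ e := by omega
  have he2 : e ≤ (2 * l + 1 - 1) / 2 := by omega
  have hle : P ^ (2 * l + 1 - r) * P ^ s ≤ P ^ e := by
    rw [← pow_add]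
    exact pow_le_pow_of_le_one h0 h1 (by omega)
  calc _ ≤ P ^ e * h ^ e := by gcongr
    _ = (P * h) ^ e := (mul_pow _ _ _).symm
    _ ≤ _ := by
      rcases le_total (P * h) 1 with hc | hc
      · have := pow_le_of_le_one hX hc (by omega : e ≠ 0)
        have := pow_nonneg hX ((2 * l + 1 - 1) / 2)
        linarith
      · have := pow_le_pow_right₀ hc he2
        linarith

/-- Passage from a modulus `a` to `a * b`, where all prime factors of `b` are large: given the
part of the window coprime to `a`, the count for `a * b` is nearly binomial. -/
theorem abs_sum_windowCount_pow_le {a b k Y H : ℕ} {h L : ℝ} (ha : a ≠ 0) (hb : Squarefree b)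
    (hab : Nat.Coprime a b) (hk : 3 ≤ k) (hodd : Odd k) (hY : 2 * k ≤ Y) (hYH : (3 * H) ^ k ≤ Y)
    (hbY : ∀ p ∈ b.primeFactors, Y < p) (hh : 1 ≤ h) (hhH : h ≤ H) (hL0 : 0 ≤ L)
    (hL : ∀ m ≤ k, |∑ x ∈ range a, ((windowCount a H x : ℝ) - coprimeDensity a * h) ^ m| ≤
      a * (L * h ^ (m / 2))) :
    |∑ n ∈ range (a * b), ((windowCount (a * b) H n : ℝ) - coprimeDensity (a * b) * h) ^ k| ≤
      a * b * ((k + 1) * (2 ^ k * (2 ^ (k + 2)) ^ k * L) *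
        (coprimeDensity b * h + (coprimeDensity b * h) ^ ((k - 1) / 2)) +
        2 * k ^ 2 * coprimeDensity b) := by
  have hb0 : b ≠ 0 := hb.ne_zero
  set P := coprimeDensity b with hP
  have hP0 : 0 ≤ P := (coprimeDensity_pos hb0).le
  have hP1 : P ≤ 1 := coprimeDensity_le_one b
  have hu0 : 0 ≤ coprimeDensity a * h := mul_nonneg (coprimeDensity_pos ha).le (by linarith)
  have huh : coprimeDensity a * h ≤ h :=
    mul_le_of_le_one_left (by linarith) (coprimeDensity_le_one a)
  set u := coprimeDensity a * h with hu
  have hHY : H ≤ Y := by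
    refine le_trans ?_ hYH
    exact (by omega : H ≤ 3 * H).trans (Nat.le_self_pow (by omega) _)
  set S : ℕ → Finset ℕ := fun x => (range H).filter fun j => Nat.Coprime (x + j) a with hS
  set N : ℕ → ℕ := fun x => windowCount a H x with hN
  have hSN : ∀ x, (S x).card = N x := fun x => rfl
  set B : ℕ → ℕ → ℕ := fun x y => ((S x).filter fun j => Nat.Coprime (y + j) b).card with hB
  set X := P * h + (P * h) ^ ((k - 1) / 2) with hX
  have hX0 : 0 ≤ X := by have : 0 ≤ h := by linarith
                         positivity
  set ε := P * (2 * k ^ 2 / Y) with hε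
  have hε0 : 0 ≤ ε := by positivity
  have hNH : ∀ x, (N x : ℝ) ≤ H := by
    intro x
    have : N x ≤ H := by
      have := card_filter_le (range H) (fun j => Nat.Coprime (x + j) a)
      rwa [card_range] at this
    exact_mod_cast this
  have hcrt : ∑ n ∈ range (a * b),
      ((windowCount (a * b) H n : ℝ) - coprimeDensity (a * b) * h) ^ k =
      ∑ x ∈ range a, ∑ y ∈ range b, ((B x y : ℝ) - P * u) ^ k := by
    rw [← sum_range_mul_of_coprime (Nat.pos_of_ne_zero ha) (Nat.pos_of_ne_zero hb0) hab
      (fun x y => ((B x y : ℝ) - P * u) ^ k)]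
    refine sum_congr rfl fun n _ => ?_
    have h1 : windowCount (a * b) H n = B (n % a) (n % b) := by
      simp only [hB, hS, windowCount, coprime_mod_add, filter_filter, Nat.coprime_mul_iff_right]
    rw [h1, coprimeDensity_mul hab]
    congr 1
    rw [hu]
    ring
  -- expansion around the conditional mean `P * N x`
  have hexp : ∀ x, ∑ y ∈ range b, ((B x y : ℝ) - P * u) ^ k =
      ∑ r ∈ range (k + 1), (P * ((N x : ℝ) - u)) ^ (k - r) * k.choose r *
        ∑ y ∈ range b, ((B x y : ℝ) - P * N x) ^ r := by
    intro x
    have h1 : ∀ y, ((B x y : ℝ) - P * u) ^ k = ∑ r ∈ range (k + 1),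
        (P * ((N x : ℝ) - u)) ^ (k - r) * k.choose r * ((B x y : ℝ) - P * N x) ^ r := by
      intro y
      have : (B x y : ℝ) - P * u = ((B x y : ℝ) - P * N x) + P * ((N x : ℝ) - u) := by ring
      rw [this, add_pow]
      refine sum_congr rfl fun r _ => ?_
      ring
    simp_rw [h1]
    rw [sum_comm]
    refine sum_congr rfl fun r _ => ?_
    rw [mul_sum]
  set main : ℕ → ℕ → ℝ := fun r x =>
    binomExp P (N x) (fun z => ((z : ℝ) - P * N x) ^ r) with hmain
  have herr : ∀ x, ∀ r ≤ k, |∑ y ∈ range b, ((B x y : ℝ) - P * N x) ^ r - b * main r x| ≤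
      b * ((2 * N x) ^ r * ε) := by
    intro x r hr
    refine abs_average_sub_binomExp_le (range b) (B x) b P ε hP0 hP1 (N x) r
      (fun s => ∏ p ∈ b.primeFactors, (1 - (s : ℝ) / p)) ?_ (Nat.cast_nonneg _) ?_
    · intro s _
      exact sum_choose_card_coprime hb (S x) (fun p hp j hj => by
        have h1 := mem_range.1 (mem_filter.1 hj).1
        have h2 := hbY p hp
        omega) s
    · intro s hs
      exact abs_prod_sub_density_pow_le hb0 hY (by omega) hbY s (by omega)
  have hmom : ∀ r ≤ k, |∑ x ∈ range a, ((N x : ℝ) - u) ^ (k - r) * main r x| * P ^ (k - r) ≤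
      (k + 1) * (a * ((2 ^ (k + 2)) ^ k * L * X)) := by
    intro r hr
    have h1 : ∑ x ∈ range a, ((N x : ℝ) - u) ^ (k - r) * main r x =
        ∑ s ∈ range (k + 1), centralCoeff P s r *
          ∑ x ∈ range a, ((N x : ℝ) - u) ^ (k - r) * (N x).choose s := by
      simp only [hmain]
      have h2 : ∀ x, binomExp P (N x) (fun z => ((z : ℝ) - P * N x) ^ r) =
          ∑ s ∈ range (k + 1), centralCoeff P s r * (N x).choose s :=
        fun x => binomExp_central P (k + 1) (N x) r (by omega)
      simp_rw [h2, mul_sum]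
      rw [sum_comm]
      refine sum_congr rfl fun s _ => sum_congr rfl fun x _ => ?_
      ring
    rw [h1]
    calc _ ≤ (∑ s ∈ range (k + 1), |centralCoeff P s r| *
          |∑ x ∈ range a, ((N x : ℝ) - u) ^ (k - r) * (N x).choose s|) * P ^ (k - r) := by
          refine mul_le_mul_of_nonneg_right ?_ (by positivity)
          refine (abs_sum_le_sum_abs _ _).trans (le_of_eq ?_)
          exact sum_congr rfl fun s _ => abs_mul _ _
      _ = ∑ s ∈ range (k + 1), |centralCoeff P s r| *
          |∑ x ∈ range a, ((N x : ℝ) - u) ^ (k - r) * (N x).choose s| * P ^ (k - r) := sum_mul _ _ _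
      _ ≤ ∑ s ∈ range (k + 1), a * ((2 ^ (k + 2)) ^ k * L * X) := by
          refine sum_le_sum fun s hs => ?_
          have hrhs : 0 ≤ a * ((2 ^ (k + 2)) ^ k * L * X) := by positivity
          by_cases hsr : r < 2 * s
          · rw [centralCoeff_eq_zero P hsr, abs_zero, zero_mul, zero_mul]
            exact hrhs
          by_cases hr0 : r ≠ 0 ∧ s = 0
          · obtain ⟨h2, rfl⟩ := hr0
            rw [centralCoeff, if_neg h2, abs_zero, zero_mul, zero_mul]
            exact hrhs
          have hrs : r = 0 ∨ 0 < s := by omega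
          have h3 := abs_sum_pow_mul_choose_le (range a) N u h (a * L) k hu0 huh hh
            (by positivity) (fun m hm => by rw [mul_assoc]; exact hL m hm) s (k - r) (by omega)
          have h4 := abs_centralCoeff_le hP0 hP1 s r
          have h5 : ((2 : ℝ) ^ (r + 1) * P) ^ s * 2 ^ s ≤ (2 ^ (k + 2)) ^ k * P ^ s := by
            rw [← mul_pow]
            have : (2 : ℝ) ^ (r + 1) * P * 2 = 2 ^ (r + 2) * P := by ring
            rw [this, mul_pow]
            have h6 : ((2 : ℝ) ^ (r + 2)) ^ s ≤ (2 ^ (k + 2)) ^ k := by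
              rw [← pow_mul, ← pow_mul]
              exact pow_le_pow_right₀ (by norm_num) (Nat.mul_le_mul (by omega) (by omega))
            gcongr
          have h7 := pow_mul_pow_le_of_odd hk hodd hP0 hP1 hh hr (by omega : 2 * s ≤ r) hrs
          calc _ ≤ (2 ^ (r + 1) * P) ^ s * (2 ^ s * (a * L * h ^ (s + (k - r) / 2))) *
                P ^ (k - r) := by gcongr
            _ = ((2 : ℝ) ^ (r + 1) * P) ^ s * 2 ^ s *
                (a * L * h ^ (s + (k - r) / 2) * P ^ (k - r)) := by ring
            _ ≤ (2 ^ (k + 2)) ^ k * P ^ s * (a * L * h ^ (s + (k - r) / 2) * P ^ (k - r)) := by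
                gcongr
            _ = a * ((2 ^ (k + 2)) ^ k * L * (P ^ (k - r) * P ^ s * h ^ (s + (k - r) / 2))) := by
                ring
            _ ≤ _ := by gcongr
      _ = _ := by
          rw [sum_const, card_range, nsmul_eq_mul]
          push_cast
          ring
  have hsplit : ∑ x ∈ range a, ∑ y ∈ range b, ((B x y : ℝ) - P * u) ^ k =
      b * ∑ r ∈ range (k + 1), k.choose r * (P ^ (k - r) *
        ∑ x ∈ range a, ((N x : ℝ) - u) ^ (k - r) * main r x) +
      ∑ x ∈ range a, ∑ r ∈ range (k + 1), (P * ((N x : ℝ) - u)) ^ (k - r) * k.choose r *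
        (∑ y ∈ range b, ((B x y : ℝ) - P * N x) ^ r - b * main r x) := by
    have h1 : b * ∑ r ∈ range (k + 1), k.choose r * (P ^ (k - r) *
        ∑ x ∈ range a, ((N x : ℝ) - u) ^ (k - r) * main r x) =
        ∑ x ∈ range a, ∑ r ∈ range (k + 1), (P * ((N x : ℝ) - u)) ^ (k - r) * k.choose r *
          (b * main r x) := by
      rw [sum_comm, mul_sum]
      refine sum_congr rfl fun r _ => ?_
      rw [mul_sum, mul_sum, mul_sum]
      refine sum_congr rfl fun x _ => ?_
      rw [mul_pow]
      ring
    rw [h1, ← sum_add_distrib]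
    refine sum_congr rfl fun x _ => ?_
    rw [hexp, ← sum_add_distrib]
    refine sum_congr rfl fun r _ => ?_
    ring
  rw [hcrt, hsplit]
  have hA : |b * ∑ r ∈ range (k + 1), k.choose r * (P ^ (k - r) *
        ∑ x ∈ range a, ((N x : ℝ) - u) ^ (k - r) * main r x)| ≤
      b * (2 ^ k * ((k + 1) * (a * ((2 ^ (k + 2)) ^ k * L * X)))) := by
    rw [abs_mul, Nat.abs_cast]
    refine mul_le_mul_of_nonneg_left ?_ (Nat.cast_nonneg _)
    refine (abs_sum_le_sum_abs _ _).trans ?_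
    have h1 : ((2 : ℝ)) ^ k = ∑ r ∈ range (k + 1), (k.choose r : ℝ) := by
      have := Nat.sum_range_choose k
      exact_mod_cast this.symm
    rw [h1, sum_mul]
    refine sum_le_sum fun r hr => ?_
    rw [abs_mul, Nat.abs_cast, abs_mul, abs_of_nonneg (pow_nonneg hP0 _), mul_comm (P ^ _)]
    exact mul_le_mul_of_nonneg_left (hmom r (Nat.lt_succ_iff.1 (mem_range.1 hr)))
      (Nat.cast_nonneg _)
  have hE : |∑ x ∈ range a, ∑ r ∈ range (k + 1), (P * ((N x : ℝ) - u)) ^ (k - r) * k.choose r *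
        (∑ y ∈ range b, ((B x y : ℝ) - P * N x) ^ r - b * main r x)| ≤
      a * (b * ((3 * H) ^ k * ε)) := by
    refine (abs_sum_le_sum_abs _ _).trans ?_
    have h1 : ∀ x ∈ range a, |∑ r ∈ range (k + 1), (P * ((N x : ℝ) - u)) ^ (k - r) * k.choose r *
        (∑ y ∈ range b, ((B x y : ℝ) - P * N x) ^ r - b * main r x)| ≤
        b * ((3 * H) ^ k * ε) := by
      intro x _
      refine (abs_sum_le_sum_abs _ _).trans ?_
      have h2 : |P * ((N x : ℝ) - u)| ≤ H := by
        rw [abs_mul, abs_of_nonneg hP0]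
        have h3 : |(N x : ℝ) - u| ≤ H := by
          have := hNH x
          have h4 : (0 : ℝ) ≤ N x := Nat.cast_nonneg _
          rw [abs_le]
          constructor <;> linarith
        calc _ ≤ 1 * (H : ℝ) := by gcongr
          _ = _ := one_mul _
      have h3 : (3 * (H : ℝ)) ^ k =
          ∑ r ∈ range (k + 1), (2 * (H : ℝ)) ^ r * H ^ (k - r) * k.choose r := by
        rw [← add_pow]
        congr 1
        ring
      rw [h3, sum_mul, mul_sum]
      refine sum_le_sum fun r hr => ?_
      rw [abs_mul, abs_mul, Nat.abs_cast, abs_pow]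
      have h4 := herr x r (Nat.lt_succ_iff.1 (mem_range.1 hr))
      have h5 := hNH x
      calc _ ≤ (H : ℝ) ^ (k - r) * k.choose r * (b * ((2 * H) ^ r * ε)) := by
            have h6 : b * ((2 * (N x : ℝ)) ^ r * ε) ≤ b * ((2 * H) ^ r * ε) := by gcongr
            have h7 := h4.trans h6
            gcongr
        _ = _ := by ring
    refine (sum_le_sum h1).trans (le_of_eq ?_)
    rw [sum_const, card_range, nsmul_eq_mul]
  have hE2 : (3 * (H : ℝ)) ^ k * ε ≤ 2 * k ^ 2 * P := by
    have h1 : (3 * (H : ℝ)) ^ k ≤ Y := by exact_mod_cast hYH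
    have hY0 : (0 : ℝ) < Y := by exact_mod_cast (by omega : 0 < Y)
    calc _ ≤ (Y : ℝ) * ε := by gcongr
      _ = _ := by rw [hε]; field_simp
  refine (abs_add_le _ _).trans ((add_le_add hA hE).trans ?_)
  have h1 : (a : ℝ) * (b * ((3 * H) ^ k * ε)) ≤ a * (b * (2 * k ^ 2 * P)) := by gcongr
  refine (add_le_add_right h1 _).trans (le_of_eq ?_)
  ring

/-! ### The bound for all moduli -/

/-- For a modulus free of large primes the moments about `φ(a) / a * h` have, up to logarithms,
square-root size; replacing `h` by the integer `H` changes the mean by at most `1`. -/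
theorem abs_sum_windowCount_sub_pow_le_of_smooth {a J : ℕ} (ha : Squarefree a) (hJ : 0 < J)
    (haJ : ∀ p ∈ a.primeFactors, p ≤ 2 ^ J) {K H k m : ℕ} {h : ℝ} (hHK : H ≤ 2 ^ K)
    (hKh : (2 : ℝ) ^ K ≤ 4 * h) (hh : 1 ≤ h) (hhH : h ≤ H) (hHh : (H : ℝ) ≤ h + 1) (hm : m ≤ k) :
    |∑ x ∈ range a, ((windowCount a H x : ℝ) - coprimeDensity a * h) ^ m| ≤
      a * (8 ^ k * ((((K : ℝ) + 1) * (Real.exp 5 * (J : ℝ) ^ 4)) ^ 2 ^ k *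
        (18 * 2 ^ 2 ^ k * (K + 1)) ^ k) * h ^ (m / 2)) := by
  set R := ((((K : ℝ) + 1) * (Real.exp 5 * (J : ℝ) ^ 4)) ^ 2 ^ k *
        (18 * 2 ^ 2 ^ k * (K + 1)) ^ k) with hR
  have hR0 : 0 ≤ R := by positivity
  set t := coprimeDensity a * (H - h) with ht
  have hP0 : 0 ≤ coprimeDensity a := (coprimeDensity_pos ha.ne_zero).le
  have ht0 : 0 ≤ t := mul_nonneg hP0 (by linarith)
  have ht1 : t ≤ 1 := mul_le_one₀ (coprimeDensity_le_one a) (by linarith) (by linarith)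
  have h1 : ∑ x ∈ range a, ((windowCount a H x : ℝ) - coprimeDensity a * h) ^ m =
      ∑ i ∈ range (m + 1), (∑ x ∈ range a, coprimeDeviation a H x ^ i) * t ^ (m - i) *
        m.choose i := by
    have h2 : ∀ x, ((windowCount a H x : ℝ) - coprimeDensity a * h) ^ m =
        ∑ i ∈ range (m + 1), coprimeDeviation a H x ^ i * t ^ (m - i) * m.choose i := by
      intro x
      rw [← add_pow, coprimeDeviation_eq, ht]
      congr 1
      ring
    simp_rw [h2]
    rw [sum_comm]
    refine sum_congr rfl fun i _ => ?_
    rw [sum_mul, sum_mul]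
  rw [h1]
  calc _ ≤ ∑ i ∈ range (m + 1), a * (R * (4 * h) ^ (m / 2)) * m.choose i := by
        refine (abs_sum_le_sum_abs _ _).trans (sum_le_sum fun i hi => ?_)
        have him : i ≤ m := Nat.lt_succ_iff.1 (mem_range.1 hi)
        rw [abs_mul, abs_mul, Nat.abs_cast, abs_of_nonneg (pow_nonneg ht0 _)]
        have e1 := abs_sum_coprimeDeviation_pow_le_of_smooth ha hJ haJ K H i k hHK (him.trans hm)
        have e2 : (2 : ℝ) ^ (K * (i / 2)) ≤ (4 * h) ^ (m / 2) := by
          rw [pow_mul]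
          refine (pow_le_pow_left₀ (by positivity) hKh _).trans ?_
          exact pow_le_pow_right₀ (by linarith) (Nat.div_le_div_right him)
        have e3 : |∑ n ∈ range a, coprimeDeviation a H n ^ i| ≤
            a * (R * (4 * h) ^ (m / 2)) := e1.trans (by gcongr)
        have e4 : t ^ (m - i) ≤ 1 := pow_le_one₀ ht0 ht1
        calc _ ≤ a * (R * (4 * h) ^ (m / 2)) * 1 * m.choose i := by gcongr
          _ = _ := by rw [mul_one]
    _ = a * (R * (4 * h) ^ (m / 2)) * 2 ^ m := by
        rw [← mul_sum]
        congr 1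
        exact_mod_cast Nat.sum_range_choose m
    _ = a * (R * (4 ^ (m / 2) * 2 ^ m) * h ^ (m / 2)) := by rw [mul_pow]; ring
    _ ≤ a * (R * 8 ^ k * h ^ (m / 2)) := by
        have e1 : (4 : ℝ) ^ (m / 2) ≤ 4 ^ k := pow_le_pow_right₀ (by norm_num) (by omega)
        have e2 : (2 : ℝ) ^ m ≤ 2 ^ k := pow_le_pow_right₀ (by norm_num) hm
        have e3 : (8 : ℝ) ^ k = 4 ^ k * 2 ^ k := by rw [← mul_pow]; norm_num
        rw [e3]
        gcongr
    _ = _ := by ring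

theorem exists_smooth_rough_factorization {q : ℕ} (hq : Squarefree q) (Y : ℕ) :
    ∃ a b : ℕ, a * b = q ∧ (∀ p ∈ a.primeFactors, p ≤ Y) ∧ ∀ p ∈ b.primeFactors, Y < p := by
  refine ⟨∏ p ∈ q.primeFactors with p ≤ Y, p, ∏ p ∈ q.primeFactors with ¬ p ≤ Y, p, ?_, ?_, ?_⟩
  · rw [prod_filter_mul_prod_filter_not, Nat.prod_primeFactors_of_squarefree hq]
  · intro p hp
    rw [Nat.primeFactors_prod fun l hl => Nat.prime_of_mem_primeFactors (mem_filter.1 hl).1] at hp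
    exact (mem_filter.1 hp).2
  · intro p hp
    rw [Nat.primeFactors_prod fun l hl => Nat.prime_of_mem_primeFactors (mem_filter.1 hl).1] at hp
    exact not_le.1 (mem_filter.1 hp).2

/-- The bound for squarefree moduli. The threshold `2 ^ J` between small and large primes is about
the `k`-th power of the length of the window; so the primes below it cost only powers of `log h`,
while above it the `k`-th power of the window length is absorbed in the error of the binomial
approximation. -/
theorem exists_squarefree_moment_bound (k : ℕ) (hk : 3 ≤ k) (hodd : Odd k) :
    ∃ (C : ℝ) (A : ℕ), ∀ (q : ℕ) (h : ℝ), Squarefree q → 1 ≤ h →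
      |∑ n ∈ range q, ((windowCount q ⌈h⌉₊ n : ℝ) - coprimeDensity q * h) ^ k| ≤
        C * (1 + Real.log h) ^ A *
          (coprimeDensity q * h + (coprimeDensity q * h) ^ ((k - 1) / 2)) * q := by
  set R₀ : ℝ := (3 * (Real.exp 5 * (12 * k) ^ 4)) ^ 2 ^ k * (18 * 2 ^ 2 ^ k * 3) ^ k with hR₀
  set I₀ : ℝ := ((Real.exp 5 * (12 * k) ^ 4) ^ 2) ^ k with hI₀
  set c : ℝ := (k + 1) * (2 ^ k * (2 ^ (k + 2)) ^ k * 8 ^ k) with hc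
  refine ⟨(c * R₀ + 2 * k ^ 2) * I₀, (5 * 2 ^ k + k) + 8 * k, fun q h hq hh => ?_⟩
  set ℓ := 1 + Real.log h with hℓ
  have hℓ1 : 1 ≤ ℓ := by linarith [Real.log_nonneg hh]
  set H := ⌈h⌉₊ with hH
  have hhH : h ≤ H := Nat.le_ceil h
  have hHh : (H : ℝ) ≤ h + 1 := (Nat.ceil_lt_add_one (by linarith)).le
  have hH1 : 1 ≤ H := by
    have : (1 : ℝ) ≤ H := hh.trans hhH
    exact_mod_cast this
  set K := Nat.clog 2 H with hK
  have hHK : H ≤ 2 ^ K := Nat.le_pow_clog (by norm_num) H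
  have hKH : 2 ^ K ≤ 2 * H := by
    rcases Nat.lt_or_ge 1 H with h1 | h1
    · have h2 := Nat.pow_pred_clog_lt_self (b := 2) (by norm_num) h1
      have h3 : 0 < K := Nat.clog_pos (by norm_num) h1
      have h4 : 2 ^ K = 2 * 2 ^ (K - 1) := by rw [← pow_succ']; congr 1; omega
      have h5 : K.pred = K - 1 := rfl
      rw [← hK, h5] at h2
      omega
    · have : H = 1 := by omega
      rw [hK, this]
      simp
  have hKh : (2 : ℝ) ^ K ≤ 4 * h := by
    have : (2 : ℝ) ^ K ≤ 2 * H := by exact_mod_cast hKH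
    linarith
  have hKℓ : (K : ℝ) + 1 ≤ 3 * ℓ := by
    have h1 := Real.log_le_log (by positivity) hKh
    have h2 : (4 : ℝ) = 2 ^ 2 := by norm_num
    rw [Real.log_pow, Real.log_mul (by norm_num) (by linarith), h2, Real.log_pow] at h1
    push_cast at h1
    have h3 : (1 : ℝ) / 2 ≤ Real.log 2 := by linarith [Real.log_two_gt_d9]
    have h4 : Real.log h ≤ 2 * Real.log 2 * Real.log h := by
      nlinarith [Real.log_nonneg hh]
    have h5 : (K : ℝ) * Real.log 2 ≤ (2 + 2 * Real.log h) * Real.log 2 := by linarith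
    have h6 := le_of_mul_le_mul_right h5 (by linarith)
    have := Real.log_nonneg hh
    rw [hℓ]
    linarith
  set J := k * (K + 4) with hJdef
  have hJ : 0 < J := by positivity
  have hJℓ : (J : ℝ) ≤ 12 * k * ℓ := by
    have : (J : ℝ) = k * (K + 4) := by rw [hJdef]; push_cast; rfl
    rw [this]
    have h1 : (K : ℝ) + 4 ≤ 12 * ℓ := by linarith [Nat.cast_nonneg (α := ℝ) K]
    calc _ ≤ (k : ℝ) * (12 * ℓ) := by gcongr
      _ = _ := by ring
  obtain ⟨a, b, hab, haJ, hbJ⟩ := exists_smooth_rough_factorization hq (2 ^ J)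
  have hqa : Squarefree a := hq.squarefree_of_dvd (hab ▸ dvd_mul_right a b)
  have hqb : Squarefree b := hq.squarefree_of_dvd (hab ▸ dvd_mul_left b a)
  have hcop : Nat.Coprime a b := Nat.coprime_of_squarefree_mul (hab ▸ hq)
  have hY : 2 * k ≤ 2 ^ J := by
    have h1 : 2 * k ≤ J := by rw [hJdef]; nlinarith
    exact h1.trans Nat.lt_two_pow_self.le
  have hYH : (3 * H) ^ k ≤ 2 ^ J := by
    have h1 : 3 * H ≤ 2 ^ (K + 4) := by rw [pow_add]; omega
    calc (3 * H) ^ k ≤ (2 ^ (K + 4)) ^ k := Nat.pow_le_pow_left h1 k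
      _ = 2 ^ J := by rw [← pow_mul, hJdef, mul_comm]
  set R := ((((K : ℝ) + 1) * (Real.exp 5 * (J : ℝ) ^ 4)) ^ 2 ^ k *
        (18 * 2 ^ 2 ^ k * (K + 1)) ^ k) with hR
  have hR0 : 0 ≤ R := by positivity
  have hmain := abs_sum_windowCount_pow_le (L := 8 ^ k * R) hqa.ne_zero hqb hcop hk hodd hY hYH hbJ
    hh hhH (by positivity) fun m hm =>
      abs_sum_windowCount_sub_pow_le_of_smooth hqa hJ haJ hHK hKh hh hhH hHh hm
  have hdens : coprimeDensity q = coprimeDensity a * coprimeDensity b := by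
    rw [← hab, coprimeDensity_mul hcop]
  have hqab : (q : ℝ) = a * b := by rw [← hab]; push_cast; rfl
  rw [hab, ← hqab] at hmain
  set P := coprimeDensity q with hP
  have hP0 : 0 < P := coprimeDensity_pos hq.ne_zero
  set e := (k - 1) / 2 with he
  set I := (Real.exp 5 * (J : ℝ) ^ 4) ^ 2 with hI
  have hJ1 : (1 : ℝ) ≤ J := by exact_mod_cast hJ
  have hI1 : 1 ≤ I := one_le_pow₀
    (one_le_mul_of_one_le_of_one_le (Real.one_le_exp (by norm_num)) (one_le_pow₀ hJ1))
  have hPb : coprimeDensity b ≤ I * P := by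
    have h1 := inv_coprimeDensity_le hqa.ne_zero hJ haJ
    have h2 := coprimeDensity_pos hqa.ne_zero
    have h3 := coprimeDensity_pos hqb.ne_zero
    calc coprimeDensity b = 1 / coprimeDensity a * P := by rw [hdens]; field_simp
      _ ≤ I * P := by gcongr
  have hPb0 : 0 < coprimeDensity b := coprimeDensity_pos hqb.ne_zero
  have hIk : I ≤ I ^ k := le_self_pow₀ hI1 (by omega)
  set Z := P * h + (P * h) ^ e with hZ
  have hZ0 : 0 ≤ Z := by positivity
  have hb1 : coprimeDensity b * h ≤ I ^ k * (P * h) := by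
    calc _ ≤ I * P * h := by gcongr
      _ ≤ I ^ k * P * h := by gcongr
      _ = _ := by ring
  have hb2 : (coprimeDensity b * h) ^ e ≤ I ^ k * (P * h) ^ e := by
    calc _ ≤ (I * (P * h)) ^ e := by
          refine pow_le_pow_left₀ (by positivity) ?_ e
          calc _ ≤ I * P * h := by gcongr
            _ = _ := by ring
      _ = I ^ e * (P * h) ^ e := mul_pow _ _ _
      _ ≤ _ := by
          have : I ^ e ≤ I ^ k := pow_le_pow_right₀ hI1 (by omega)
          gcongr
  have hb3 : coprimeDensity b ≤ I ^ k * Z := by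
    have h1 : coprimeDensity b ≤ coprimeDensity b * h := le_mul_of_one_le_right hPb0.le hh
    have h2 : 0 ≤ I ^ k * (P * h) ^ e := by positivity
    rw [hZ, mul_add]
    linarith
  have hb4 : coprimeDensity b * h + (coprimeDensity b * h) ^ e ≤ I ^ k * Z := by
    rw [hZ, mul_add]
    linarith
  have hRb : R ≤ R₀ * ℓ ^ (5 * 2 ^ k + k) := by
    calc R ≤ ((3 * ℓ) * (Real.exp 5 * (12 * k * ℓ) ^ 4)) ^ 2 ^ k *
          (18 * 2 ^ 2 ^ k * (3 * ℓ)) ^ k := by rw [hR]; gcongr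
      _ = (3 * (Real.exp 5 * (12 * k) ^ 4) * ℓ ^ 5) ^ 2 ^ k * (18 * 2 ^ 2 ^ k * 3 * ℓ) ^ k := by
          congr 2 <;> ring
      _ = _ := by
          rw [mul_pow _ (ℓ ^ 5), mul_pow _ ℓ, pow_add, ← pow_mul, hR₀]
          ring
  have hIb : I ^ k ≤ I₀ * ℓ ^ (8 * k) := by
    calc I ^ k ≤ ((Real.exp 5 * (12 * k * ℓ) ^ 4) ^ 2) ^ k := by rw [hI]; gcongr
      _ = ((Real.exp 5 * (12 * k) ^ 4) ^ 2 * ℓ ^ 8) ^ k := by congr 1; ring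
      _ = _ := by rw [mul_pow, ← pow_mul ℓ, hI₀]
  have hc0 : 0 ≤ c := by positivity
  have hR₀0 : 0 ≤ R₀ := by positivity
  have hsum : c * R + 2 * k ^ 2 ≤ (c * R₀ + 2 * k ^ 2) * ℓ ^ (5 * 2 ^ k + k) := by
    have h1 : (1 : ℝ) ≤ ℓ ^ (5 * 2 ^ k + k) := one_le_pow₀ hℓ1
    have h2 := mul_le_mul_of_nonneg_left hRb hc0
    have h3 : 2 * (k : ℝ) ^ 2 ≤ 2 * k ^ 2 * ℓ ^ (5 * 2 ^ k + k) :=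
      le_mul_of_one_le_right (by positivity) h1
    linarith
  calc _ ≤ _ := hmain
    _ = q * (c * R * (coprimeDensity b * h + (coprimeDensity b * h) ^ e) +
          2 * k ^ 2 * coprimeDensity b) := by rw [hc]; ring
    _ ≤ q * (c * R * (I ^ k * Z) + 2 * k ^ 2 * (I ^ k * Z)) := by gcongr
    _ = q * ((c * R + 2 * k ^ 2) * I ^ k * Z) := by ring
    _ ≤ q * ((c * R₀ + 2 * k ^ 2) * ℓ ^ (5 * 2 ^ k + k) * (I₀ * ℓ ^ (8 * k)) * Z) := by gcongr
    _ = _ := by rw [pow_add ℓ (5 * 2 ^ k + k)]; ring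

theorem coprimeWindow_card (q : ℕ) (h : ℝ) (n : ℕ) :
    (coprimeWindow q h n).card = windowCount q ⌈h⌉₊ n := by
  unfold coprimeWindow windowCount
  rw [card_filter, card_filter, sum_Ico_eq_sum_range, Nat.add_sub_cancel_left]

theorem coprime_prod_primeFactors {q : ℕ} (hq : q ≠ 0) (m : ℕ) :
    Nat.Coprime m (∏ p ∈ q.primeFactors, p) ↔ Nat.Coprime m q := by
  constructor
  · intro h
    refine Nat.coprime_of_dvd fun p hp hpm hpq => ?_
    have h1 : p ∣ ∏ p ∈ q.primeFactors, p :=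
      dvd_prod_of_mem _ (Nat.mem_primeFactors.2 ⟨hp, hpq, hq⟩)
    exact Nat.not_coprime_of_dvd_of_dvd hp.one_lt hpm h1 h
  · exact fun h => h.coprime_dvd_right (Nat.prod_primeFactors_dvd q)

theorem sum_range_mul_of_periodic (f : ℕ → ℝ) (a : ℕ) (hf : ∀ n, f (n + a) = f n) (t : ℕ) :
    ∑ n ∈ range (a * t), f n = t * ∑ n ∈ range a, f n := by
  have hf' : ∀ t n, f (a * t + n) = f n := by
    intro t
    induction t with
    | zero => intro n; simp
    | succ t ih =>
      intro n
      rw [show a * (t + 1) + n = (a * t + n) + a by ring, hf, ih]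
  induction t with
  | zero => simp
  | succ t ih =>
    rw [mul_add, mul_one, sum_range_add, ih, sum_congr rfl fun n _ => hf' t n]
    push_cast
    ring

/-- The moment depends on the modulus only through its prime factors, up to the length of the
period. -/
theorem reducedResidueMoment_eq (k : ℕ) {q : ℕ} (hq : q ≠ 0) (h : ℝ) :
    reducedResidueMoment k q h * (∏ p ∈ q.primeFactors, p : ℕ) =
      q * ∑ n ∈ range (∏ p ∈ q.primeFactors, p),
        ((windowCount (∏ p ∈ q.primeFactors, p) ⌈h⌉₊ n : ℝ) -
          coprimeDensity (∏ p ∈ q.primeFactors, p) * h) ^ k := by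
  set a := ∏ p ∈ q.primeFactors, p with ha
  obtain ⟨t, ht⟩ := Nat.prod_primeFactors_dvd q
  rw [← ha] at ht
  have ha0 : a ≠ 0 := by rintro h; rw [h, zero_mul] at ht; exact hq ht
  have hdens : coprimeDensity q = coprimeDensity a := by
    rw [coprimeDensity_eq_prod hq, coprimeDensity_eq_prod ha0, ha,
      Nat.primeFactors_prod fun p hp => Nat.prime_of_mem_primeFactors hp]
  set f : ℕ → ℝ := fun n => ((windowCount a ⌈h⌉₊ n : ℝ) - coprimeDensity a * h) ^ k with hf
  have hwin : ∀ n, windowCount q ⌈h⌉₊ n = windowCount a ⌈h⌉₊ n := by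
    intro n
    unfold windowCount
    simp only [ha, coprime_prod_primeFactors hq]
  have hper : ∀ n, f (n + a) = f n := by
    intro n
    simp only [hf, windowCount]
    have : ∀ j, Nat.Coprime (n + a + j) a ↔ Nat.Coprime (n + j) a := by
      intro j
      rw [← coprime_mod_add, Nat.add_mod_right, coprime_mod_add]
    simp only [this]
  have h1 : reducedResidueMoment k q h = ∑ n ∈ range q, f n := by
    have h2 : reducedResidueMoment k q h = ∑ n ∈ Ico 1 (q + 1), f n := by
      unfold reducedResidueMoment
      refine sum_congr rfl fun n _ => ?_
      rw [coprimeWindow_card, hwin, hdens]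
    have h3 := sum_range_succ' f q
    rw [sum_range_succ] at h3
    have h4 : f q = f 0 := by
      have : ∀ s, f (a * s) = f 0 := by
        intro s
        induction s with
        | zero => simp
        | succ s ih => rw [mul_add, mul_one, hper, ih]
      rw [ht, this]
    rw [h2, sum_Ico_eq_sum_range, Nat.add_sub_cancel]
    simp_rw [add_comm 1]
    linarith
  rw [h1]
  conv_lhs => rw [ht]
  rw [sum_range_mul_of_periodic f a hper t]
  have h5 : (q : ℝ) = a * t := by rw [ht]; push_cast; rfl
  rw [h5]
  ring

theorem theorem1p1 (k : ℕ) (hk : 3 ≤ k) (hodd : Odd k) :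
    ∃ (C : ℝ) (A : ℕ), ∀ (q : ℕ) (h : ℝ), 1 ≤ q → 1 ≤ h →
      |reducedResidueMoment k q h| ≤
        C * (1 + Real.log h) ^ A *
          (coprimeDensity q * h + (coprimeDensity q * h) ^ ((k - 1) / 2)) * q := by
  obtain ⟨C, A, hCA⟩ := exists_squarefree_moment_bound k hk hodd
  refine ⟨C, A, fun q h hq hh => ?_⟩
  have hq0 : q ≠ 0 := by omega
  have hprime : ∀ p ∈ q.primeFactors, p.Prime := fun p hp => Nat.prime_of_mem_primeFactors hp
  have hM := reducedResidueMoment_eq k hq0 h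
  set a := ∏ p ∈ q.primeFactors, p with ha
  have ha0 : a ≠ 0 := prod_ne_zero_iff.2 fun p hp => (hprime p hp).ne_zero
  have hsq : Squarefree a := by
    rw [ha]
    exact Finset.squarefree_prod_of_pairwise_isCoprime
      (fun p hp l hl hpl => (Nat.coprime_iff_isRelPrime.1
        ((Nat.coprime_primes (hprime p hp) (hprime l hl)).2 hpl)))
      fun p hp => (hprime p hp).squarefree
  have hdens : coprimeDensity q = coprimeDensity a := by
    rw [coprimeDensity_eq_prod hq0, coprimeDensity_eq_prod ha0, ha, Nat.primeFactors_prod hprime]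
  have hbound := hCA a h hsq hh
  have ha' : (0 : ℝ) < a := by exact_mod_cast Nat.pos_of_ne_zero ha0
  rw [hdens]
  refine le_of_mul_le_mul_right ?_ ha'
  calc |reducedResidueMoment k q h| * a = |reducedResidueMoment k q h * a| := by
        rw [abs_mul, Nat.abs_cast]
    _ = q * |∑ n ∈ range a, ((windowCount a ⌈h⌉₊ n : ℝ) - coprimeDensity a * h) ^ k| := by
        rw [hM, abs_mul, Nat.abs_cast]
    _ ≤ q * (C * (1 + Real.log h) ^ A *
          (coprimeDensity a * h + (coprimeDensity a * h) ^ ((k - 1) / 2)) * a) := by gcongr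
    _ = _ := by ring
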